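/- Theorem 1.1 (the Coll–Mayers–Mayers Conjecture holds). Define the integers $a(n)$, $n \ge 0$, by the power series identity $$G(q) := \sum_{n\ge 0} a(n) q^n := \frac{1}{(q;q^4)_\infty\,(-q^3;q^4)_\infty}, \qquad (a;x)_\infty := \prod_{j\ge 0} (1 - a x^j).$$ Let $k$ be any field. The index of a finite-dimensional Lie algebra $L$ over $k$ is $$\operatorname{ind} L := \min_{f \in L^*} \dim_k \{x \in L : f([x,y]) = 0 \text{ for all } y \in L\}.$$ For two partitions $a = (a_1 \ge \dots \ge a_m)$ and $b = (b_1 \ge \dots \ge b_\ell)$ of $n$, the associated seaweed algebra is the Lie subalgebra (under the commutator bracket) of $\mathrm{Mat}_n(k)$ consisting of the matrices that preserve the subspaces $\operatorname{span}(v_1, \dots, v_{a_1+\dots+a_j})$ for $1 \le j \le m$ and $\operatorname{span}(v_{b_1+\dots+b_j+1}, \dots, v_n)$ for $1 \le j \le \ell$ of $k^n$, where $v_1,\dots,v_n$ is the standard basis. The index of a partition $\lambda$ of $n$ is the index of the seaweed algebra associated with the pair $(\lambda, (n))$, where $(n)$ is the partition of $n$ with the single part $n$ (the empty partition if $n=0$).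 Let $e_n$ and $o_n$ be the numbers of partitions of $n$ into odd parts whose index is even, respectively odd. Then: (1) $a(n) \ge 0$ for every $n \ge 0$. (2) $G(q) = \sum_{n \ge 0} |e_n - o_n|\, q^n$; that is, $a(n) = |e_n - o_n|$ for every $n \ge 0$. -/

import Mathlib

namespace CollMayersMayers

noncomputable section

/-! ### The index of a Lie algebra and seaweed algebras -/

section LieIndex

variable (k : Type*) [Field k] (L : Type*) [LieRing L] [LieAlgebra k L]

/-- The kernel `{x | ∀ y, f ⁅x, y⁆ = 0}` of the Kirillov form `(x, y) ↦ f ⁅x, y⁆` of a linear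
functional `f` on a Lie algebra `L`. -/
def kirillovKer (f : Module.Dual k L) : Submodule k L where
  carrier := {x | ∀ y : L, f ⁅x, y⁆ = 0}
  zero_mem' := fun y => by simp
  add_mem' := fun {a b} ha hb y => by
    have h1 := ha y
    have h2 := hb y
    simp [h1, h2]
  smul_mem' := fun c a ha y => by
    have h1 := ha y
    simp [h1]

/-- The index of a (finite-dimensional) Lie algebra `L` over `k`: the minimum over all linear
functionals `f` on `L` of the dimension of the kernel of the Kirillov form of `f`. -/
def lieIndex : ℕ :=
  sInf (Set.range fun f : Module.Dual k L => Module.finrank k (kirillovKer k L f))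

end LieIndex

section Seaweed

attribute [local instance] LieRing.ofAssociativeRing

variable (k : Type*) [Field k] {n : ℕ}

/-- The span of the first `s` standard basis vectors of `k ^ n`. -/
def headSpan (n s : ℕ) : Submodule k (Fin n → k) :=
  Submodule.span k {v | ∃ i : Fin n, i.val < s ∧ v = Pi.single i 1}

/-- The span of the standard basis vectors of `k ^ n` other than the first `s` ones. -/
def tailSpan (n s : ℕ) : Submodule k (Fin n → k) :=
  Submodule.span k {v | ∃ i : Fin n, s ≤ i.val ∧ v = Pi.single i 1}

/-- The parts of a partition in non-increasing order. -/
def sortedParts (p : n.Partition) : List ℕ := p.parts.sort (· ≥ ·)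

/-- The sum of the `j` largest parts of a partition. -/
def partialSum (p : n.Partition) (j : ℕ) : ℕ := ((sortedParts p).take j).sum

/-- The seaweed algebra attached to two partitions `a₁ ≥ a₂ ≥ …` and `b₁ ≥ b₂ ≥ …` of `n`: the
matrices that preserve all the subspaces `span (e₁, …, e_{a₁ + ⋯ + a_j})` and
`span (e_{b₁ + ⋯ + b_j + 1}, …, e_n)`. (For `j = 0`, and for `j` beyond the number of parts, these
are `0` or the whole space and impose no condition.) -/
def seaweed (a b : n.Partition) : LieSubalgebra k (Matrix (Fin n) (Fin n) k) where
  carrier := {M |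
    (∀ j : ℕ, ∀ v ∈ headSpan k n (partialSum a j), M.mulVec v ∈ headSpan k n (partialSum a j)) ∧
    (∀ j : ℕ, ∀ v ∈ tailSpan k n (partialSum b j), M.mulVec v ∈ tailSpan k n (partialSum b j))}
  zero_mem' := by
    refine ⟨fun j v _ => ?_, fun j v _ => ?_⟩ <;> simp
  add_mem' := fun {M N} hM hN => by
    refine ⟨fun j v hv => ?_, fun j v hv => ?_⟩ <;> rw [Matrix.add_mulVec]
    · exact Submodule.add_mem _ (hM.1 j v hv) (hN.1 j v hv)
    · exact Submodule.add_mem _ (hM.2 j v hv) (hN.2 j v hv)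
  smul_mem' := fun c M hM => by
    refine ⟨fun j v hv => ?_, fun j v hv => ?_⟩ <;> rw [Matrix.smul_mulVec]
    · exact Submodule.smul_mem _ c (hM.1 j v hv)
    · exact Submodule.smul_mem _ c (hM.2 j v hv)
  lie_mem' := fun {M N} hM hN => by
    refine ⟨fun j v hv => ?_, fun j v hv => ?_⟩ <;>
      rw [Ring.lie_def, Matrix.sub_mulVec, ← Matrix.mulVec_mulVec, ← Matrix.mulVec_mulVec]
    · exact Submodule.sub_mem _ (hM.1 j _ (hN.1 j v hv)) (hN.1 j _ (hM.1 j v hv))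
    · exact Submodule.sub_mem _ (hM.2 j _ (hN.2 j v hv)) (hN.2 j _ (hM.2 j v hv))

/-- The index of a pair of partitions of `n`: the index of the associated seaweed algebra. -/
def pairIndex (a b : n.Partition) : ℕ := lieIndex k (seaweed k a b)

/-- The index of a partition `p` of `n`: the index of the pair consisting of `p` and `{n}`. -/
def partitionIndex (p : n.Partition) : ℕ := pairIndex k p (Nat.Partition.indiscrete n)

/-- The number of partitions of `n` into odd parts whose index is even. -/
def evenCount (n : ℕ) : ℕ :=
  ((Nat.Partition.odds n).filter fun p => Even (partitionIndex k p)).card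

/-- The number of partitions of `n` into odd parts whose index is odd. -/
def oddCount (n : ℕ) : ℕ :=
  ((Nat.Partition.odds n).filter fun p => Odd (partitionIndex k p)).card

end Seaweed

/-! ### The generating function -/

section GeneratingFunction

open PowerSeries
open scoped PowerSeries.WithPiTopology

/-- The `q`-Pochhammer symbol `(a; x)_∞ = ∏_{n ≥ 0} (1 - a x ^ n)` for formal power series, the
product being taken in the coefficientwise topology. -/
def qPochhammer (a x : PowerSeries ℤ) : PowerSeries ℤ := ∏' n : ℕ, (1 - a * x ^ n)

/-- The denominator `(q, -q³; q⁴)_∞ = (q; q⁴)_∞ (-q³; q⁴)_∞`. -/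
def denominator : PowerSeries ℤ := qPochhammer X (X ^ 4) * qPochhammer (-X ^ 3) (X ^ 4)

/-- The formal power series `G(q) = 1 / (q, -q³; q⁴)_∞` (the denominator has constant
coefficient `1`, so it is invertible). -/
def G : PowerSeries ℤ := invOfUnit denominator 1

/-- The infinite products in question converge. -/
theorem multipliable_qPochhammer (a x : PowerSeries ℤ) (hx : constantCoeff x = 0) :
    Multipliable fun n : ℕ => (1 - a * x ^ n : PowerSeries ℤ) := by
  have h : Filter.Tendsto (fun n : ℕ => (-(a * x ^ n) : PowerSeries ℤ).order)
      Filter.atTop (nhds ⊤) := by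
    refine ENat.tendsto_nhds_top_iff_natCast_lt.mpr fun m =>
      Filter.eventually_atTop.mpr ⟨m + 1, fun n hn => ?_⟩
    rw [order_neg]
    have h1 : (n : ℕ∞) ≤ (x ^ n).order := by
      apply le_order_pow_of_constantCoeff_eq_zero n hx
    have h2 : (m : ℕ∞) < n := by exact_mod_cast hn
    exact h2.trans_le (h1.trans (le_trans (by simp) (le_order_mul (φ := a) (ψ := x ^ n))))
  simpa [sub_eq_add_neg] using
    WithPiTopology.multipliable_one_add_of_tendsto_order_atTop_nhds_top ℤ h

theorem constantCoeff_qPochhammer (a x : PowerSeries ℤ) (ha : constantCoeff a = 0)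
    (hx : constantCoeff x = 0) : constantCoeff (qPochhammer a x) = 1 := by
  unfold qPochhammer
  rw [(multipliable_qPochhammer a x hx).map_tprod (constantCoeff (R := ℤ))
    (WithPiTopology.continuous_constantCoeff ℤ)]
  simp [ha]

/-- `G` is the inverse of the infinite product. -/
theorem denominator_mul_G : denominator * G = 1 := by
  apply mul_invOfUnit
  simp [denominator, constantCoeff_qPochhammer]

end GeneratingFunction

end

end CollMayersMayers

namespace CollMayersMayers

open PowerSeries Filter Topology
open scoped PowerSeries.WithPiTopology

/-! ### Finite truncations of the product and their evaluation -/

/-! Both claims reduce to the nonnegativity of the coefficients of `G`. An alternating form has even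
rank, so the index of a finite-dimensional Lie algebra has the parity of its dimension
(`lieIndex_mod_two`). The seaweed algebra of a partition with m odd parts is a block triangular
matrix algebra, of dimension congruent to m(m+1)/2 mod 2. The denominator is the product of the
factors 1 - (-1)^j q^(2j+1), so a(n) counts partitions into odd parts with sign (-1)^h, where n = 2h
+ m. Comparing parities gives e_n - o_n = (-1)^⌈n/2⌉ a(n) (`evenCount_sub_oddCount`).

For n ≥ 50000, positivity comes from a saddle-point estimate (`coeff_G_pos_of_ge`). For q = exp(-τ)
one has log G(±q) = C(τ) ± S(τ), where C sums 1/(2n sinh nτ) over even n and S sums 1/(2n cosh nτ)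
over odd n. Near 0, C behaves like π²/(48τ) and S is of lower order, so the radius exp(-t) with n t²
= π²/48 is stationary. Symmetrising in q → -q reduces Cauchy's integral to angles 0 ≤ θ ≤ π/2. The
window θ ≤ t/2 contributes at least 0.26 t ε G(e^(-t)) with ε = (nt)^(-1/2), and the rest costs at
most 4t² G(e^(-t)). The serious rival is q = i: there C and S have principal parts -π²/(96σ) and
iL/σ, with L half of Catalan's constant, whose real parts reach about 0.185/t, against 0.2056/t at
the peak.

For n < 50000 the same estimates give |a(n)| < 2^304 (`abs_coeff_G_lt`), so these coefficients can
be packed as digits in base 2^305. The denominator equals (q; -q²)_∞, and Euler's expansion turns G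
into a quotient of two short explicit expressions. The kernel checks this quotient modulo
2^(305·50000) and reads off the signs of the digits (`coeff_G_nonneg_of_checkSigns`). -/

/-- The `j`-th factor of the denominator, ordered by degree. -/
noncomputable def denFactor (j : ℕ) : PowerSeries ℤ := 1 - C ((-1) ^ j) * X ^ (2 * j + 1)

/-- The inverse of `denFactor j`, a geometric series. -/
noncomputable def geomFactor (j : ℕ) : PowerSeries ℤ :=
  PowerSeries.mk fun n => if 2 * j + 1 ∣ n then ((-1) ^ j) ^ (n / (2 * j + 1)) else 0

/-- The truncated product for the generating function. -/
noncomputable def partialGF (J : ℕ) : PowerSeries ℤ := ∏ j ∈ Finset.range J, geomFactor j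

theorem geomFactor_mul_denFactor (j : ℕ) : geomFactor j * denFactor j = 1 := by
  ext n
  rw [denFactor, mul_sub, mul_one, mul_left_comm, map_sub, coeff_C_mul, coeff_mul_X_pow',
    geomFactor, coeff_mk, coeff_one]
  simp only [coeff_mk]
  rcases Nat.eq_zero_or_pos n with rfl | hn
  · simp
  rw [if_neg hn.ne']
  by_cases hd : 2 * j + 1 ∣ n
  · obtain ⟨k, rfl⟩ := hd
    obtain ⟨k, rfl⟩ : ∃ k', k = k' + 1 := Nat.exists_eq_succ_of_ne_zero (by rintro rfl; simp at hn)
    have h1 : (2 * j + 1) * (k + 1) - (2 * j + 1) = (2 * j + 1) * k := by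
      rw [mul_add, mul_one, Nat.add_sub_cancel]
    rw [if_pos (dvd_mul_right _ _), if_pos (Nat.le_mul_of_pos_right _ (by omega)), h1,
      if_pos (dvd_mul_right _ _), Nat.mul_div_cancel_left _ (by omega),
      Nat.mul_div_cancel_left _ (by omega), pow_succ']
    ring
  · rw [if_neg hd]
    split_ifs with h1 h2
    · exact absurd ((Nat.dvd_sub_iff_left h1 dvd_rfl).1 h2) hd
    · simp
    · simp

theorem partialGF_mul_prod (J : ℕ) :
    partialGF J * ∏ j ∈ Finset.range J, denFactor j = 1 := by
  rw [partialGF, ← Finset.prod_mul_distrib]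
  exact Finset.prod_eq_one fun j _ => geomFactor_mul_denFactor j

/-- The indices j = 2i and j = 2i + 1 give 1 - q^(4i+1) and 1 + q^(4i+3), so the two q-Pochhammer
symbols interleave into one product. -/
theorem prod_denFactor_two_mul (J : ℕ) : ∏ j ∈ Finset.range (2 * J), denFactor j =
    (∏ i ∈ Finset.range J, (1 - X * (X ^ 4) ^ i)) *
      ∏ i ∈ Finset.range J, (1 - -X ^ 3 * (X ^ 4) ^ i) := by
  induction J with
  | zero => simp
  | succ J ih =>
    rw [show 2 * (J + 1) = 2 * J + 1 + 1 by ring, Finset.prod_range_succ, Finset.prod_range_succ,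
      ih, Finset.prod_range_succ, Finset.prod_range_succ]
    have h1 : denFactor (2 * J) = 1 - X * (X ^ 4) ^ J := by
      rw [denFactor, pow_mul, ← pow_mul X 4]
      simp
      ring
    have h2 : denFactor (2 * J + 1) = 1 - -X ^ 3 * (X ^ 4) ^ J := by
      rw [denFactor, pow_succ, pow_mul, ← pow_mul X 4]
      simp
      ring
    rw [h1, h2]
    ring

theorem tendsto_prod_denFactor :
    Tendsto (fun J => ∏ j ∈ Finset.range (2 * J), denFactor j) atTop (𝓝 denominator) := by
  simp only [prod_denFactor_two_mul]
  exact ((multipliable_qPochhammer X (X ^ 4) (by simp)).hasProd.tendsto_prod_nat).mul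
    ((multipliable_qPochhammer (-X ^ 3) (X ^ 4) (by simp)).hasProd.tendsto_prod_nat)

theorem eventually_coeff_prod_denFactor (n : ℕ) :
    ∀ᶠ J in atTop, ∀ i ≤ n,
      coeff i (∏ j ∈ Finset.range (2 * J), denFactor j) = coeff i denominator := by
  have h := (WithPiTopology.tendsto_iff_coeff_tendsto ℤ _ _ _).1 tendsto_prod_denFactor
  simp only [nhds_discrete, tendsto_pure] at h
  have : ∀ m, ∀ᶠ J in atTop, ∀ i < m,
      coeff i (∏ j ∈ Finset.range (2 * J), denFactor j) = coeff i denominator := by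
    intro m
    induction m with
    | zero => simp
    | succ m ih =>
      filter_upwards [ih, h m] with J h1 h2 i hi
      rcases Nat.lt_succ_iff_lt_or_eq.1 hi with h3 | rfl
      · exact h1 i h3
      · exact h2
  filter_upwards [this (n + 1)] with J hJ i hi using hJ i (by omega)

/-- Up to degree n the truncated series already inverts the denominator, and this determines its
coefficients in that range. -/
theorem eventually_coeff_partialGF (n : ℕ) :
    ∀ᶠ J in atTop, coeff n (partialGF (2 * J)) = coeff n G := by
  filter_upwards [eventually_coeff_prod_denFactor n] with J hJ
  have h1 : ∀ i ≤ n, coeff i (partialGF (2 * J) * denominator) = coeff i (1 : PowerSeries ℤ) := by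
    intro i hi
    rw [← partialGF_mul_prod (2 * J), coeff_mul, coeff_mul]
    refine Finset.sum_congr rfl fun x hx => ?_
    rw [hJ x.2 (by have := Finset.HasAntidiagonal.mem_antidiagonal.1 hx; omega)]
  calc coeff n (partialGF (2 * J)) = coeff n (partialGF (2 * J) * denominator * G) := by
        rw [mul_assoc, denominator_mul_G, mul_one]
    _ = coeff n (1 * G) := by
        rw [coeff_mul, coeff_mul]
        refine Finset.sum_congr rfl fun x hx => ?_
        rw [h1 x.1 (by have := Finset.HasAntidiagonal.mem_antidiagonal.1 hx; omega)]
    _ = coeff n G := by rw [one_mul]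

/-! ### Weighted ℓ¹ norms and evaluation in the unit disc. -/

/-- Evaluation of an integral power series at a complex number. -/
noncomputable def evalAt (q : ℂ) (A : PowerSeries ℤ) : ℂ := ∑' n, ((coeff n A : ℤ) : ℂ) * q ^ n

/-- Absolute convergence of a power series on the closed disc of radius `r`. -/
def SummableAt (r : ℝ) (A : PowerSeries ℤ) : Prop :=
  Summable fun n => |((coeff n A : ℤ) : ℝ)| * r ^ n

/-- The weighted `ℓ¹` norm of a power series. -/
noncomputable def weightedNorm (r : ℝ) (A : PowerSeries ℤ) : ℝ :=
  ∑' n, |((coeff n A : ℤ) : ℝ)| * r ^ n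

theorem SummableAt.summable_norm {r : ℝ} {A : PowerSeries ℤ} (h : SummableAt r A) {q : ℂ}
    (hq : ‖q‖ = r) :
    Summable fun n => ‖((coeff n A : ℤ) : ℂ) * q ^ n‖ := by
  refine h.congr fun n => ?_
  rw [norm_mul, norm_pow, hq, Complex.norm_intCast]

theorem coeff_mul_mul_pow {R : Type*} [CommRing R] (A B : PowerSeries ℤ) (q : R) (n : ℕ) :
    ((coeff n (A * B) : ℤ) : R) * q ^ n = ∑ kl ∈ Finset.HasAntidiagonal.antidiagonal n,
      (((coeff kl.1 A : ℤ) : R) * q ^ kl.1) * (((coeff kl.2 B : ℤ) : R) * q ^ kl.2) := by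
  rw [coeff_mul, Int.cast_sum, Finset.sum_mul]
  refine Finset.sum_congr rfl fun x hx => ?_
  rw [← Finset.HasAntidiagonal.mem_antidiagonal.1 hx, pow_add]
  push_cast
  ring

theorem SummableAt.mul {r : ℝ} (hr : 0 ≤ r) {A B : PowerSeries ℤ} (hA : SummableAt r A)
    (hB : SummableAt r B) : SummableAt r (A * B) ∧
      weightedNorm r (A * B) ≤ weightedNorm r A * weightedNorm r B := by
  have nA : Summable fun n => ‖|((coeff n A : ℤ) : ℝ)| * r ^ n‖ := Summable.norm hA
  have nB : Summable fun n => ‖|((coeff n B : ℤ) : ℝ)| * r ^ n‖ := Summable.norm hB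
  have h1 := summable_norm_sum_mul_antidiagonal_of_summable_norm nA nB
  have h2 := h1.of_norm
  have h3 : ∀ n, |((coeff n (A * B) : ℤ) : ℝ)| * r ^ n ≤
      ∑ kl ∈ Finset.HasAntidiagonal.antidiagonal n,
      (|((coeff kl.1 A : ℤ) : ℝ)| * r ^ kl.1) * (|((coeff kl.2 B : ℤ) : ℝ)| * r ^ kl.2) := by
    intro n
    have : |((coeff n (A * B) : ℤ) : ℝ)| * r ^ n = |((coeff n (A * B) : ℤ) : ℝ) * r ^ n| := by
      rw [abs_mul, abs_of_nonneg (pow_nonneg hr n)]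
    rw [this, coeff_mul_mul_pow]
    refine (Finset.abs_sum_le_sum_abs _ _).trans (le_of_eq (Finset.sum_congr rfl fun x _ => ?_))
    rw [abs_mul, abs_mul, abs_mul, abs_of_nonneg (pow_nonneg hr _), abs_of_nonneg (pow_nonneg hr _)]
  have h4 : SummableAt r (A * B) :=
    Summable.of_nonneg_of_le (fun n => by positivity) h3 h2
  refine ⟨h4, ?_⟩
  rw [weightedNorm, weightedNorm, weightedNorm,
    tsum_mul_tsum_eq_tsum_sum_antidiagonal_of_summable_norm nA nB]
  exact h4.tsum_le_tsum h3 h2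

theorem evalAt_mul {r : ℝ} {A B : PowerSeries ℤ} (hA : SummableAt r A)
    (hB : SummableAt r B) {q : ℂ} (hq : ‖q‖ = r) :
    evalAt q (A * B) = evalAt q A * evalAt q B := by
  rw [evalAt, evalAt, evalAt,
    tsum_mul_tsum_eq_tsum_sum_antidiagonal_of_summable_norm (hA.summable_norm hq)
      (hB.summable_norm hq)]
  exact tsum_congr fun n => coeff_mul_mul_pow A B q n

theorem hasSum_geomFactor (j : ℕ) {q : ℂ} (hq : ‖q‖ < 1) :
    HasSum (fun n => ((coeff n (geomFactor j) : ℤ) : ℂ) * q ^ n)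
      (1 - (-1) ^ j * q ^ (2 * j + 1))⁻¹ := by
  have hi : Function.Injective fun k : ℕ => (2 * j + 1) * k :=
    fun a b hab => Nat.eq_of_mul_eq_mul_left (by omega) hab
  rw [← hi.hasSum_iff]
  · have h1 : ‖(-1) ^ j * q ^ (2 * j + 1)‖ < 1 := by
      rw [norm_mul, norm_pow, norm_pow, norm_neg, norm_one, one_pow, one_mul]
      exact pow_lt_one₀ (norm_nonneg _) hq (by omega)
    have e : ((fun n => ((coeff n (geomFactor j) : ℤ) : ℂ) * q ^ n) ∘ fun k => (2 * j + 1) * k) =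
        fun k => ((-1) ^ j * q ^ (2 * j + 1)) ^ k := by
      funext k
      simp only [Function.comp, geomFactor, coeff_mk]
      rw [if_pos (dvd_mul_right _ _), Nat.mul_div_cancel_left _ (by omega), mul_pow, pow_mul q]
      push_cast
      rfl
    rw [e]
    exact hasSum_geometric_of_norm_lt_one h1
  · intro n hn
    rw [geomFactor, coeff_mk, if_neg]
    · simp
    · rintro ⟨k, rfl⟩
      exact hn ⟨k, rfl⟩

theorem hasSum_abs_geomFactor (j : ℕ) {r : ℝ} (hr0 : 0 ≤ r) (hr : r < 1) :
    HasSum (fun n => |((coeff n (geomFactor j) : ℤ) : ℝ)| * r ^ n)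
      (1 - r ^ (2 * j + 1))⁻¹ := by
  have hi : Function.Injective fun k : ℕ => (2 * j + 1) * k :=
    fun a b hab => Nat.eq_of_mul_eq_mul_left (by omega) hab
  rw [← hi.hasSum_iff]
  · have h1 : r ^ (2 * j + 1) < 1 := pow_lt_one₀ hr0 hr (by omega)
    convert hasSum_geometric_of_lt_one (by positivity) h1 using 1
    ext k
    simp only [Function.comp, geomFactor, coeff_mk]
    rw [if_pos (dvd_mul_right _ _), Nat.mul_div_cancel_left _ (by omega), pow_mul]
    simp
  · intro n hn
    rw [geomFactor, coeff_mk, if_neg]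
    · simp
    · rintro ⟨k, rfl⟩
      exact hn ⟨k, rfl⟩

theorem one_sub_inv_le_exp {x r : ℝ} (hx0 : 0 ≤ x) (hxr : x ≤ r) (hr : r < 1) :
    (1 - x)⁻¹ ≤ Real.exp (x / (1 - r)) := by
  have h1 : 0 < 1 - x := by linarith
  have h2 : (1 - x)⁻¹ = x / (1 - x) + 1 := by field_simp; ring
  have h3 : x / (1 - x) ≤ x / (1 - r) :=
    div_le_div_of_nonneg_left hx0 (by linarith) (by linarith)
  linarith [Real.add_one_le_exp (x / (1 - r))]

/-- The norm bound is independent of J. This is what passes coefficient bounds on to `G` and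
supplies a dominating series for the limit of the products. -/
theorem partialGF_bounds {r : ℝ} (hr0 : 0 ≤ r) (hr : r < 1) (J : ℕ) :
    SummableAt r (partialGF J) ∧ weightedNorm r (partialGF J) ≤ Real.exp (1 / (1 - r) ^ 2) ∧
      ∀ q : ℂ, ‖q‖ = r →
        evalAt q (partialGF J) = ∏ j ∈ Finset.range J, (1 - (-1) ^ j * q ^ (2 * j + 1))⁻¹ := by
  -- The induction keeps the finite sum in the exponent, because the uniform bound does not survive
  -- multiplication by one more factor.
  have key : SummableAt r (partialGF J) ∧
      weightedNorm r (partialGF J) ≤ Real.exp (∑ j ∈ Finset.range J, r ^ j / (1 - r)) ∧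
      ∀ q : ℂ, ‖q‖ = r →
        evalAt q (partialGF J) = ∏ j ∈ Finset.range J, (1 - (-1) ^ j * q ^ (2 * j + 1))⁻¹ := by
    induction J with
    | zero =>
      have h1 : ∀ n ∉ ({0} : Finset ℕ), coeff n (1 : PowerSeries ℤ) = 0 := by
        intro n hn
        rw [coeff_one, if_neg (by simpa using hn)]
      refine ⟨?_, ?_, ?_⟩
      · rw [SummableAt, partialGF, Finset.prod_range_zero]
        exact summable_of_ne_finset_zero (s := {0}) fun n hn => by rw [h1 n hn]; simp
      · rw [weightedNorm, partialGF, Finset.prod_range_zero,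
          tsum_eq_sum (s := {0}) fun n hn => by rw [h1 n hn]; simp]
        simp
      · intro q hq
        rw [evalAt, partialGF, Finset.prod_range_zero,
          tsum_eq_sum (s := {0}) fun n hn => by rw [h1 n hn]; simp]
        simp
    | succ J ih =>
      obtain ⟨i1, i2, i3⟩ := ih
      have hg := hasSum_abs_geomFactor J hr0 hr
      have hgs : SummableAt r (geomFactor J) := hg.summable
      have hgn : weightedNorm r (geomFactor J) = (1 - r ^ (2 * J + 1))⁻¹ := hg.tsum_eq
      have e : partialGF (J + 1) = partialGF J * geomFactor J := by
        rw [partialGF, Finset.prod_range_succ]; rfl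
      have hm := SummableAt.mul hr0 i1 hgs
      refine ⟨by rw [e]; exact hm.1, ?_, ?_⟩
      · rw [e, Finset.sum_range_succ, Real.exp_add]
        refine hm.2.trans ?_
        rw [hgn]
        have h1 : r ^ (2 * J + 1) ≤ r ^ J := pow_le_pow_of_le_one hr0 hr.le (by omega)
        have h2 : r ^ (2 * J + 1) ≤ r := by
          calc r ^ (2 * J + 1) ≤ r ^ 1 := pow_le_pow_of_le_one hr0 hr.le (by omega)
            _ = r := pow_one r
        have h3 := one_sub_inv_le_exp (by positivity) h2 hr
        have h4 : 0 < 1 - r := by linarith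
        have h5 : Real.exp (r ^ (2 * J + 1) / (1 - r)) ≤ Real.exp (r ^ J / (1 - r)) :=
          Real.exp_le_exp.2 (by gcongr)
        have h6 : 0 ≤ (1 - r ^ (2 * J + 1))⁻¹ := by
          rw [inv_nonneg]; linarith
        exact mul_le_mul i2 (h3.trans h5) h6 (Real.exp_pos _).le
      · intro q hq
        rw [e, evalAt_mul i1 hgs hq, i3 q hq, Finset.prod_range_succ]
        congr 1
        exact (hasSum_geomFactor J (by rw [hq]; exact hr)).tsum_eq
  refine ⟨key.1, key.2.1.trans (Real.exp_le_exp.2 ?_), key.2.2⟩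
  have h4 : 0 < 1 - r := by linarith
  rw [← Finset.sum_div, div_le_div_iff₀ h4 (by positivity)]
  have := (summable_geometric_of_lt_one hr0 hr).sum_le_tsum (Finset.range J)
    (fun i _ => by positivity)
  rw [tsum_geometric_of_lt_one hr0 hr] at this
  calc _ ≤ (1 - r)⁻¹ * (1 - r) ^ 2 := by gcongr
    _ = _ := by field_simp

theorem abs_coeff_partialGF_le {r : ℝ} (hr0 : 0 ≤ r) (hr : r < 1) (J n : ℕ) :
    |((coeff n (partialGF J) : ℤ) : ℝ)| * r ^ n ≤ Real.exp (1 / (1 - r) ^ 2) := by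
  obtain ⟨h1, h2, -⟩ := partialGF_bounds hr0 hr J
  refine le_trans ?_ h2
  have := h1.le_tsum n fun m _ => by positivity
  exact this

theorem abs_coeff_G_le {r : ℝ} (hr0 : 0 ≤ r) (hr : r < 1) (n : ℕ) :
    |((coeff n G : ℤ) : ℝ)| * r ^ n ≤ Real.exp (1 / (1 - r) ^ 2) := by
  obtain ⟨J, hJ⟩ := (eventually_coeff_partialGF n).exists
  rw [← hJ]
  exact abs_coeff_partialGF_le hr0 hr _ n

theorem le_const_mul_pow {x r s C : ℝ} (hr : 0 ≤ r) (hs : 0 < s) {n : ℕ} (h : x * s ^ n ≤ C) :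
    x * r ^ n ≤ C * (r / s) ^ n := by
  rw [div_pow, mul_div_assoc', le_div_iff₀ (by positivity)]
  calc x * r ^ n * s ^ n = (x * s ^ n) * r ^ n := by ring
    _ ≤ C * r ^ n := by gcongr

theorem exists_between_radius {r : ℝ} (hr0 : 0 ≤ r) (hr : r < 1) :
    ∃ s, 0 < s ∧ s < 1 ∧ 0 ≤ r / s ∧ r / s < 1 := by
  refine ⟨(r + 1) / 2, by linarith, by linarith, by positivity, ?_⟩
  rw [div_lt_one (by linarith)]
  linarith

theorem summableAt_G {r : ℝ} (hr0 : 0 ≤ r) (hr : r < 1) : SummableAt r G := by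
  obtain ⟨s, hs0, hs, hrs0, hrs⟩ := exists_between_radius hr0 hr
  refine Summable.of_nonneg_of_le (fun n => by positivity)
    (fun n => le_const_mul_pow hr0 hs0 (abs_coeff_G_le hs0.le hs n))
    ((summable_geometric_of_lt_one hrs0 hrs).mul_left _)

/-- Dominated convergence: coefficients stabilise, and the uniform estimate at a radius s between
‖q‖ and 1 dominates the terms by a geometric series of ratio ‖q‖/s. -/
theorem tendsto_prod_evalAt_G {q : ℂ} (hq : ‖q‖ < 1) :
    Tendsto (fun J => ∏ j ∈ Finset.range (2 * J), (1 - (-1) ^ j * q ^ (2 * j + 1))⁻¹) atTop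
      (𝓝 (evalAt q G)) := by
  obtain ⟨s, hs0, hs, hrs0, hrs⟩ := exists_between_radius (norm_nonneg q) hq
  have e : ∀ J, ∏ j ∈ Finset.range (2 * J), (1 - (-1) ^ j * q ^ (2 * j + 1))⁻¹ =
      ∑' n, ((coeff n (partialGF (2 * J)) : ℤ) : ℂ) * q ^ n :=
    fun J => ((partialGF_bounds (norm_nonneg q) hq (2 * J)).2.2 q rfl).symm
  simp only [e]
  refine tendsto_tsum_of_dominated_convergence
    (bound := fun n => Real.exp (1 / (1 - s) ^ 2) * (‖q‖ / s) ^ n)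
    ((summable_geometric_of_lt_one hrs0 hrs).mul_left _) (fun n => ?_)
    (Eventually.of_forall fun J n => ?_)
  · refine tendsto_const_nhds.congr' ?_
    filter_upwards [eventually_coeff_partialGF n] with J hJ
    rw [hJ]
  · rw [norm_mul, norm_pow, Complex.norm_intCast]
    exact le_const_mul_pow (norm_nonneg q) hs0 (abs_coeff_partialGF_le hs0.le hs _ n)

/-! ### The logarithm of the generating function -/

/-- The terms `q ^ n / (n (1 - (-1) ^ n q ^ (2 n)))` of the logarithm of the generating function. -/
noncomputable def logTerm (q : ℂ) (n : ℕ) : ℂ := q ^ n / (n * (1 - (-1) ^ n * q ^ (2 * n)))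

theorem summable_log_double {q : ℂ} (hq : ‖q‖ < 1) :
    Summable (Function.uncurry fun j n : ℕ => ((-1) ^ j * q ^ (2 * j + 1)) ^ n / (n : ℂ)) := by
  refine Summable.of_norm_bounded
    ((summable_geometric_of_lt_one (norm_nonneg q) hq).mul_of_nonneg
      (summable_geometric_of_lt_one (norm_nonneg q) hq) (fun _ => by positivity)
      fun _ => by positivity) ?_
  rintro ⟨j, n⟩
  simp only [Function.uncurry]
  rcases Nat.eq_zero_or_pos n with rfl | hn
  · simp
  · rw [norm_div, norm_pow, norm_mul, norm_pow, norm_neg, norm_one, one_pow, one_mul, norm_pow,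
      Complex.norm_natCast, ← pow_mul, ← pow_add]
    have h1 : (1 : ℝ) ≤ n := by exact_mod_cast hn
    calc ‖q‖ ^ ((2 * j + 1) * n) / n ≤ ‖q‖ ^ ((2 * j + 1) * n) :=
          div_le_self (by positivity) h1
      _ ≤ ‖q‖ ^ (j + n) := pow_le_pow_of_le_one (norm_nonneg q) hq.le (by nlinarith)

/-- After expanding each -log(1 - x), summing over j before n leaves a geometric series of ratio
(-1)^n q^(2n). -/
theorem tsum_log_inner {q : ℂ} (hq : ‖q‖ < 1) (n : ℕ) :
    ∑' j : ℕ, ((-1) ^ j * q ^ (2 * j + 1)) ^ n / (n : ℂ) = logTerm q n := by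
  rcases Nat.eq_zero_or_pos n with rfl | hn
  · simp [logTerm]
  have h1 : ‖(-1) ^ n * q ^ (2 * n)‖ < 1 := by
    rw [norm_mul, norm_pow, norm_pow, norm_neg, norm_one, one_pow, one_mul]
    exact pow_lt_one₀ (norm_nonneg _) hq (by omega)
  have h2 := (hasSum_geometric_of_norm_lt_one h1).mul_left (q ^ n / n)
  have e : (fun j : ℕ => ((-1) ^ j * q ^ (2 * j + 1)) ^ n / (n : ℂ)) =
      fun j => q ^ n / n * ((-1) ^ n * q ^ (2 * n)) ^ j := by
    ext j
    rw [mul_pow, mul_pow, ← pow_mul, ← pow_mul, ← pow_mul, ← pow_mul, mul_comm j n, add_mul,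
      one_mul, pow_add, show 2 * j * n = 2 * n * j by ring]
    ring
  rw [e, h2.tsum_eq, logTerm, div_mul_eq_mul_div, ← div_eq_mul_inv, div_div, mul_comm (n : ℂ),
    ← div_div]

theorem hasSum_log_outer {q : ℂ} (hq : ‖q‖ < 1) :
    HasSum (fun j : ℕ => -Complex.log (1 - (-1) ^ j * q ^ (2 * j + 1))) (∑' n, logTerm q n) := by
  have h := summable_log_double hq
  have h1 : ∀ j : ℕ, HasSum (fun n : ℕ => ((-1) ^ j * q ^ (2 * j + 1)) ^ n / (n : ℂ))
      (-Complex.log (1 - (-1) ^ j * q ^ (2 * j + 1))) := by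
    intro j
    apply Complex.hasSum_taylorSeries_neg_log
    rw [norm_mul, norm_pow, norm_pow, norm_neg, norm_one, one_pow, one_mul]
    exact pow_lt_one₀ (norm_nonneg _) hq (by omega)
  have h2 := h.hasSum.prod_fiberwise h1
  have h3 := h.tsum_comm
  simp only [tsum_log_inner hq] at h3
  rw [h3]
  have h4 : ∑' j : ℕ, ∑' n : ℕ, ((-1) ^ j * q ^ (2 * j + 1)) ^ n / (n : ℂ) =
      ∑' p, Function.uncurry (fun j n : ℕ => ((-1) ^ j * q ^ (2 * j + 1)) ^ n / (n : ℂ)) p :=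
    (h.tsum_prod' fun j => (h1 j).summable).symm
  rw [h4]
  exact h2

/-- Each finite product is the exponential of a sum of principal logarithms, so no branch of log G
has to be chosen. -/
theorem evalAt_G_eq_exp {q : ℂ} (hq : ‖q‖ < 1) :
    evalAt q G = Complex.exp (∑' n, logTerm q n) := by
  have h1 := (hasSum_log_outer hq).tendsto_sum_nat
  have h2 : Tendsto (fun J : ℕ => 2 * J) atTop atTop :=
    tendsto_id.const_mul_atTop' (by norm_num)
  have h3 := (Complex.continuous_exp.tendsto _).comp (h1.comp h2)
  refine tendsto_nhds_unique (tendsto_prod_evalAt_G hq) (h3.congr fun J => ?_)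
  simp only [Function.comp]
  rw [Complex.exp_sum]
  refine Finset.prod_congr rfl fun j _ => ?_
  rw [Complex.exp_neg, Complex.exp_log]
  have h5 : ‖(-1) ^ j * q ^ (2 * j + 1)‖ < 1 := by
    rw [norm_mul, norm_pow, norm_pow, norm_neg, norm_one, one_pow, one_mul]
    exact pow_lt_one₀ (norm_nonneg _) hq (by omega)
  intro h6
  rw [sub_eq_zero] at h6
  rw [← h6, norm_one] at h5
  exact lt_irrefl _ h5

end CollMayersMayers

namespace CollMayersMayers

open Complex

/-! ### Elementary bounds for hyperbolic functions -/

theorem sinh_re_im (z : ℂ) : (sinh z).re = Real.sinh z.re * Real.cos z.im ∧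
    (sinh z).im = Real.cosh z.re * Real.sin z.im := by
  have h : sinh z = ((Real.sinh z.re * Real.cos z.im : ℝ) : ℂ)
      + ((Real.cosh z.re * Real.sin z.im : ℝ) : ℂ) * I := by
    conv_lhs => rw [← re_add_im z, sinh_add, cosh_mul_I, sinh_mul_I]
    push_cast
    ring
  rw [h]
  constructor <;> simp [-ofReal_mul, -ofReal_sinh, -ofReal_cosh, -ofReal_cos, -ofReal_sin]

theorem cosh_re_im (z : ℂ) : (cosh z).re = Real.cosh z.re * Real.cos z.im ∧
    (cosh z).im = Real.sinh z.re * Real.sin z.im := by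
  have h : cosh z = ((Real.cosh z.re * Real.cos z.im : ℝ) : ℂ)
      + ((Real.sinh z.re * Real.sin z.im : ℝ) : ℂ) * I := by
    conv_lhs => rw [← re_add_im z, cosh_add, cosh_mul_I, sinh_mul_I]
    push_cast
    ring
  rw [h]
  constructor <;> simp [-ofReal_mul, -ofReal_sinh, -ofReal_cosh, -ofReal_cos, -ofReal_sin]

theorem normSq_sinh (z : ℂ) : normSq (sinh z) = Real.sinh z.re ^ 2 + Real.sin z.im ^ 2 := by
  rw [normSq_apply, (sinh_re_im z).1, (sinh_re_im z).2]
  have h1 := Real.cosh_sq z.re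
  have h2 := Real.sin_sq_add_cos_sq z.im
  linear_combination Real.sin z.im ^ 2 * h1 + Real.sinh z.re ^ 2 * h2

theorem normSq_cosh (z : ℂ) : normSq (cosh z) = Real.sinh z.re ^ 2 + Real.cos z.im ^ 2 := by
  rw [normSq_apply, (cosh_re_im z).1, (cosh_re_im z).2]
  have h1 := Real.cosh_sq z.re
  have h2 := Real.sin_sq_add_cos_sq z.im
  linear_combination Real.cos z.im ^ 2 * h1 + Real.sinh z.re ^ 2 * h2

theorem re_inv_sinh (z : ℂ) : ((sinh z)⁻¹).re =
    Real.sinh z.re * Real.cos z.im / (Real.sinh z.re ^ 2 + Real.sin z.im ^ 2) := by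
  rw [inv_re, normSq_sinh, (sinh_re_im z).1]

theorem re_inv_cosh (z : ℂ) : ((cosh z)⁻¹).re =
    Real.cosh z.re * Real.cos z.im / (Real.sinh z.re ^ 2 + Real.cos z.im ^ 2) := by
  rw [inv_re, normSq_cosh, (cosh_re_im z).1]

theorem sinh_re_le_norm_sinh {z : ℂ} : Real.sinh z.re ≤ ‖sinh z‖ := by
  rw [norm_def, normSq_sinh]
  exact Real.le_sqrt_of_sq_le (by nlinarith [sq_nonneg (Real.sin z.im)])

theorem sinh_re_le_norm_cosh {z : ℂ} : Real.sinh z.re ≤ ‖cosh z‖ := by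
  rw [norm_def, normSq_cosh]
  exact Real.le_sqrt_of_sq_le (by nlinarith [sq_nonneg (Real.cos z.im)])

theorem abs_cos_im_le_norm_cosh {z : ℂ} : |Real.cos z.im| ≤ ‖cosh z‖ := by
  rw [norm_def, normSq_cosh]
  exact Real.le_sqrt_of_sq_le (by rw [sq_abs]; nlinarith [sq_nonneg (Real.sinh z.re)])

theorem norm_sinh_le_cosh_re {z : ℂ} : ‖sinh z‖ ≤ Real.cosh z.re := by
  rw [norm_def, normSq_sinh]
  refine Real.sqrt_le_iff.2 ⟨(Real.cosh_pos _).le, ?_⟩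
  rw [Real.cosh_sq]
  linarith [Real.sin_sq_le_one z.im]

theorem norm_cosh_le_cosh_re {z : ℂ} : ‖cosh z‖ ≤ Real.cosh z.re := by
  rw [norm_def, normSq_cosh]
  refine Real.sqrt_le_iff.2 ⟨(Real.cosh_pos _).le, ?_⟩
  rw [Real.cosh_sq]
  linarith [Real.cos_sq_le_one z.im]

theorem re_le_norm_sinh {z : ℂ} (h : 0 ≤ z.re) : z.re ≤ ‖sinh z‖ :=
  (Real.self_le_sinh_iff.2 h).trans sinh_re_le_norm_sinh

theorem re_le_norm_cosh {z : ℂ} (h : 0 ≤ z.re) : z.re ≤ ‖cosh z‖ :=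
  (Real.self_le_sinh_iff.2 h).trans sinh_re_le_norm_cosh

theorem sinh_ne_zero_of_re_pos {z : ℂ} (h : 0 < z.re) : sinh z ≠ 0 :=
  norm_pos_iff.1 (h.trans_le (re_le_norm_sinh h.le))

theorem cosh_ne_zero_of_re_pos {z : ℂ} (h : 0 < z.re) : cosh z ≠ 0 :=
  norm_pos_iff.1 (h.trans_le (re_le_norm_cosh h.le))

theorem norm_inv_sinh_le {z : ℂ} (h : 0 < z.re) : ‖(sinh z)⁻¹‖ ≤ 1 / z.re := by
  rw [norm_inv, ← one_div]
  exact one_div_le_one_div_of_le h (re_le_norm_sinh h.le)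

theorem norm_inv_cosh_le {z : ℂ} (h : 0 < z.re) : ‖(cosh z)⁻¹‖ ≤ 1 / z.re := by
  rw [norm_inv, ← one_div]
  exact one_div_le_one_div_of_le h (re_le_norm_cosh h.le)

theorem re_inv_sinh_le {z : ℂ} (h : 0 < z.re) : ((sinh z)⁻¹).re ≤ (Real.sinh z.re)⁻¹ := by
  have h0 : 0 < Real.sinh z.re := Real.sinh_pos_iff.2 h
  refine (re_le_norm _).trans ?_
  rw [norm_inv]
  exact inv_anti₀ h0 sinh_re_le_norm_sinh

/-- A quantitative form of `re_inv_sinh_le`. -/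
theorem re_inv_sinh_le_sub {z : ℂ} (h : 0 < z.re) {c : ℝ} (hc : c * Real.sinh z.re ^ 2 ≤
    (1 - c) * Real.sin z.im ^ 2) :
    ((sinh z)⁻¹).re ≤ (Real.sinh z.re)⁻¹ - c * (Real.sinh z.re)⁻¹ := by
  have h0 : 0 < Real.sinh z.re := Real.sinh_pos_iff.2 h
  have h1 : 0 < Real.sinh z.re ^ 2 + Real.sin z.im ^ 2 := by positivity
  rw [re_inv_sinh, div_le_iff₀ h1]
  have h2 : Real.sinh z.re * Real.cos z.im ≤ Real.sinh z.re := by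
    nlinarith [Real.cos_le_one z.im]
  refine h2.trans ?_
  rw [← one_sub_mul, mul_assoc, ← sub_nonneg]
  have : (1 - c) * ((Real.sinh z.re)⁻¹ * (Real.sinh z.re ^ 2 + Real.sin z.im ^ 2)) - Real.sinh z.re
      = (Real.sinh z.re)⁻¹ * ((1 - c) * Real.sin z.im ^ 2 - c * Real.sinh z.re ^ 2) := by
    field_simp
    ring
  rw [this]
  exact mul_nonneg (inv_nonneg.2 h0.le) (by linarith)

/-- By AM-GM, sinh² x + cos² y ≥ 2 sinh x |cos y|. For small x this halves the bound given by the
modulus. -/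
theorem abs_re_inv_cosh_le {z : ℂ} (h : 0 < z.re) :
    |((cosh z)⁻¹).re| ≤ Real.cosh z.re / (2 * z.re) := by
  have h0 : 0 < Real.sinh z.re := Real.sinh_pos_iff.2 h
  have h1 : 0 < Real.sinh z.re ^ 2 + Real.cos z.im ^ 2 := by positivity
  have h2 : z.re ≤ Real.sinh z.re := Real.self_le_sinh_iff.2 h.le
  rw [re_inv_cosh, abs_div, abs_mul, abs_of_pos h1, abs_of_pos (Real.cosh_pos _),
    div_le_div_iff₀ h1 (by positivity), mul_assoc]
  refine mul_le_mul_of_nonneg_left ?_ (Real.cosh_pos _).le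
  have := sq_nonneg (Real.sinh z.re - |Real.cos z.im|)
  have h3 := abs_nonneg (Real.cos z.im)
  rw [sub_sq, sq_abs] at this
  nlinarith

/-- Writing sinh² = (cosh - 1)(cosh + 1) bounds the quotient by 1/(cosh x - 1), and cosh x - 1 ≥
x²/2. -/
theorem cosh_div_sinh_sq_le {x : ℝ} (hx : 0 < x) : Real.cosh x / Real.sinh x ^ 2 ≤ 2 / x ^ 2 := by
  have hs : 0 < Real.sinh x := Real.sinh_pos_iff.2 hx
  have hc := Real.cosh_sq x
  have hc1 := Real.one_le_cosh x
  have h2 : x ≤ Real.sinh x := Real.self_le_sinh_iff.2 hx.le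
  have h3 : x ^ 2 ≤ 2 * (Real.cosh x - 1) := by
    have h4 : Real.cosh x = 1 + 2 * Real.sinh (x / 2) ^ 2 := by
      have := Real.cosh_two_mul (x / 2)
      rw [show 2 * (x / 2) = x by ring, Real.cosh_sq] at this
      linarith
    have h5 : x / 2 ≤ Real.sinh (x / 2) := Real.self_le_sinh_iff.2 (by positivity)
    nlinarith
  rw [div_le_div_iff₀ (by positivity) (by positivity)]
  nlinarith

/-- The constant is the Taylor remainder factor 4/(3!·3) of exp, averaged over z and -z. -/
theorem norm_sinh_sub_self_le {z : ℂ} (hz : ‖z‖ ≤ 1) : ‖sinh z - z‖ ≤ 2 / 9 * ‖z‖ ^ 3 := by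
  have h1 := Complex.exp_bound hz (n := 3) (by norm_num)
  have h2 := Complex.exp_bound (x := -z) (by rwa [norm_neg]) (n := 3) (by norm_num)
  rw [norm_neg] at h2
  have h : sinh z - z = ((exp z - ∑ m ∈ Finset.range 3, z ^ m / (m.factorial : ℂ))
      - (exp (-z) - ∑ m ∈ Finset.range 3, (-z) ^ m / (m.factorial : ℂ))) / 2 := by
    rw [Complex.sinh]
    simp [Finset.sum_range_succ, Nat.factorial]
    ring
  rw [h, norm_div]
  have h3 := norm_sub_le (exp z - ∑ m ∈ Finset.range 3, z ^ m / (m.factorial : ℂ))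
    (exp (-z) - ∑ m ∈ Finset.range 3, (-z) ^ m / (m.factorial : ℂ))
  norm_num [Nat.factorial] at h1 h2 h3 ⊢
  linarith

theorem norm_cosh_sub_one_le {z : ℂ} (hz : ‖z‖ ≤ 1) : ‖cosh z - 1‖ ≤ 3 / 4 * ‖z‖ ^ 2 := by
  have h1 := Complex.exp_bound hz (n := 2) (by norm_num)
  have h2 := Complex.exp_bound (x := -z) (by rwa [norm_neg]) (n := 2) (by norm_num)
  rw [norm_neg] at h2
  have h : cosh z - 1 = ((exp z - ∑ m ∈ Finset.range 2, z ^ m / (m.factorial : ℂ))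
      + (exp (-z) - ∑ m ∈ Finset.range 2, (-z) ^ m / (m.factorial : ℂ))) / 2 := by
    rw [Complex.cosh]
    simp [Finset.sum_range_succ, Nat.factorial]
    ring
  rw [h, norm_div]
  have h3 := norm_add_le (exp z - ∑ m ∈ Finset.range 2, z ^ m / (m.factorial : ℂ))
    (exp (-z) - ∑ m ∈ Finset.range 2, (-z) ^ m / (m.factorial : ℂ))
  norm_num [Nat.factorial] at h1 h2 h3 ⊢
  linarith

theorem le_norm_sinh {z : ℂ} (hz : ‖z‖ ≤ 1) : 7 / 9 * ‖z‖ ≤ ‖sinh z‖ := by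
  have h1 := norm_sinh_sub_self_le hz
  have h2 := norm_sub_norm_le z (z - sinh z)
  rw [sub_sub_cancel, norm_sub_rev z] at h2
  have h3 : ‖z‖ ^ 3 ≤ ‖z‖ := by
    calc ‖z‖ ^ 3 ≤ ‖z‖ ^ 1 := pow_le_pow_of_le_one (norm_nonneg _) hz (by norm_num)
      _ = _ := pow_one _
  linarith

/-- The function `1 / sinh z - 1 / z`. -/
noncomputable def cschRegular (z : ℂ) : ℂ := (sinh z)⁻¹ - z⁻¹

theorem norm_cschRegular_le {z : ℂ} (h0 : 0 < z.re) (hz : ‖z‖ ≤ 1) :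
    ‖cschRegular z‖ ≤ 2 / 7 * ‖z‖ := by
  have hz0 : z ≠ 0 := by rintro rfl; simp at h0
  have hs : sinh z ≠ 0 := sinh_ne_zero_of_re_pos h0
  have h1 := norm_sinh_sub_self_le hz
  have h2 := le_norm_sinh hz
  have hzp : 0 < ‖z‖ := norm_pos_iff.2 hz0
  have : cschRegular z = (z - sinh z) / (z * sinh z) := by
    rw [cschRegular]; field_simp
  rw [this, norm_div, norm_mul, norm_sub_rev, div_le_iff₀ (by positivity)]
  calc _ ≤ 2 / 9 * ‖z‖ ^ 3 := h1
    _ = 2 / 7 * ‖z‖ * (‖z‖ * (7 / 9 * ‖z‖)) := by ring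
    _ ≤ _ := by gcongr

theorem norm_cschRegular_le' {z : ℂ} (h0 : 0 < z.re) : ‖cschRegular z‖ ≤ 2 / z.re := by
  have h1 := norm_inv_sinh_le h0
  have h2 : ‖z⁻¹‖ ≤ 1 / z.re := by
    rw [norm_inv, ← one_div]
    exact one_div_le_one_div_of_le h0 (re_le_norm z)
  calc _ ≤ ‖(sinh z)⁻¹‖ + ‖z⁻¹‖ := norm_sub_le _ _
    _ ≤ 1 / z.re + 1 / z.re := add_le_add h1 h2
    _ = _ := by ring

theorem hasDerivAt_cschRegular {z : ℂ} (h0 : 0 < z.re) :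
    HasDerivAt cschRegular (-cosh z / sinh z ^ 2 - -1 / z ^ 2) z := by
  have hz0 : z ≠ 0 := by rintro rfl; simp at h0
  have hs : sinh z ≠ 0 := sinh_ne_zero_of_re_pos h0
  have h1 := (Complex.hasDerivAt_sinh z).inv hs
  have h2 := (hasDerivAt_id z).inv hz0
  exact h1.sub h2

theorem norm_deriv_cschRegular_le' {z : ℂ} (h0 : 0 < z.re) :
    ‖-cosh z / sinh z ^ 2 - -1 / z ^ 2‖ ≤ 3 / z.re ^ 2 := by
  have hs : 0 < Real.sinh z.re := Real.sinh_pos_iff.2 h0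
  have h1 : ‖-cosh z / sinh z ^ 2‖ ≤ 2 / z.re ^ 2 := by
    refine le_trans ?_ (cosh_div_sinh_sq_le h0)
    rw [norm_div, norm_neg, norm_pow]
    have h1 := @norm_cosh_le_cosh_re z
    have h2 := @sinh_re_le_norm_sinh z
    gcongr
  have h2 : ‖-1 / z ^ 2‖ ≤ 1 / z.re ^ 2 := by
    rw [norm_div, norm_neg, norm_one, norm_pow]
    have := re_le_norm z
    gcongr
  calc _ ≤ _ := norm_sub_le _ _
    _ ≤ 2 / z.re ^ 2 + 1 / z.re ^ 2 := add_le_add h1 h2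
    _ = _ := by ring

/-- The double poles cancel: over the common denominator z² sinh² z the numerator is O(|z|^4). The
constant exceeds (40/81 + 3/4)/(7/9)². -/
theorem norm_deriv_cschRegular_le {z : ℂ} (h0 : 0 < z.re) (hz : ‖z‖ ≤ 1) :
    ‖-cosh z / sinh z ^ 2 - -1 / z ^ 2‖ ≤ 21 / 10 := by
  have hz0 : z ≠ 0 := by rintro rfl; simp at h0
  have hs : sinh z ≠ 0 := sinh_ne_zero_of_re_pos h0
  have hzp : 0 < ‖z‖ := norm_pos_iff.2 hz0
  have h1 := norm_sinh_sub_self_le hz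
  have h2 := le_norm_sinh hz
  have h3 := norm_cosh_sub_one_le hz
  have e : -cosh z / sinh z ^ 2 - -1 / z ^ 2
      = ((sinh z - z) * (sinh z - z + 2 * z) - z ^ 2 * (cosh z - 1)) / (z ^ 2 * sinh z ^ 2) := by
    field_simp
    ring
  have h4 : ‖sinh z - z + 2 * z‖ ≤ 20 / 9 * ‖z‖ := by
    have h5 : ‖z‖ ^ 3 ≤ ‖z‖ := by
      calc ‖z‖ ^ 3 ≤ ‖z‖ ^ 1 := pow_le_pow_of_le_one (norm_nonneg _) hz (by norm_num)
        _ = _ := pow_one _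
    calc _ ≤ ‖sinh z - z‖ + ‖2 * z‖ := norm_add_le _ _
      _ ≤ 2 / 9 * ‖z‖ ^ 3 + 2 * ‖z‖ := by rw [norm_mul]; norm_num; exact h1
      _ ≤ _ := by linarith
  rw [e, norm_div, norm_mul, norm_pow, norm_pow, div_le_iff₀ (by positivity)]
  calc _ ≤ ‖sinh z - z‖ * ‖sinh z - z + 2 * z‖ + ‖z‖ ^ 2 * ‖cosh z - 1‖ := by
        refine (norm_sub_le _ _).trans ?_
        rw [norm_mul, norm_mul, norm_pow]
    _ ≤ (2 / 9 * ‖z‖ ^ 3) * (20 / 9 * ‖z‖) + ‖z‖ ^ 2 * (3 / 4 * ‖z‖ ^ 2) := by gcongr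
    _ ≤ 21 / 10 * (‖z‖ ^ 2 * (7 / 9 * ‖z‖) ^ 2) := by
        have : 0 ≤ ‖z‖ ^ 4 := by positivity
        nlinarith
    _ ≤ _ := by gcongr

theorem hasDerivAt_inv_cosh {z : ℂ} (h0 : 0 < z.re) :
    HasDerivAt (fun z => (cosh z)⁻¹) (-sinh z / cosh z ^ 2) z :=
  (Complex.hasDerivAt_cosh z).inv (cosh_ne_zero_of_re_pos h0)

theorem norm_deriv_inv_cosh_le' {z : ℂ} (h0 : 0 < z.re) :
    ‖-sinh z / cosh z ^ 2‖ ≤ 2 / z.re ^ 2 := by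
  have hs : 0 < Real.sinh z.re := Real.sinh_pos_iff.2 h0
  refine le_trans ?_ (cosh_div_sinh_sq_le h0)
  rw [norm_div, norm_neg, norm_pow]
  have h1 := @norm_sinh_le_cosh_re z
  have h2 := @sinh_re_le_norm_cosh z
  gcongr

theorem norm_deriv_inv_cosh_le {z : ℂ} (hz : ‖z‖ ≤ 1) (hi : |z.im| ≤ 1 / 2) :
    ‖-sinh z / cosh z ^ 2‖ ≤ 8 / 5 := by
  have h1 : ‖sinh z‖ ≤ 11 / 9 := by
    have h1 := norm_sinh_sub_self_le hz
    have h2 : ‖z‖ ^ 3 ≤ 1 := pow_le_one₀ (norm_nonneg _) hz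
    calc ‖sinh z‖ = ‖sinh z - z + z‖ := by rw [sub_add_cancel]
      _ ≤ ‖sinh z - z‖ + ‖z‖ := norm_add_le _ _
      _ ≤ _ := by linarith
  have h2 : 7 / 8 ≤ ‖cosh z‖ := by
    refine le_trans ?_ abs_cos_im_le_norm_cosh
    refine le_trans ?_ (le_abs_self _)
    have := Real.one_sub_sq_div_two_le_cos (x := z.im)
    have h3 : z.im ^ 2 ≤ (1 / 2) ^ 2 := sq_le_sq' (by linarith [neg_abs_le z.im])
      ((le_abs_self _).trans hi)
    linarith
  rw [norm_div, norm_neg, norm_pow, div_le_iff₀ (by positivity)]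
  nlinarith

end CollMayersMayers

namespace CollMayersMayers

open Complex

/-! ### The logarithm of the generating function -/

/-- Only the terms from M on need the telescoping majorant; the first M stay free for sharper
estimates. -/
theorem tsum_le_of_telescope {f u : ℕ → ℝ} (hf : ∀ j, 0 ≤ f j) (M : ℕ)
    (hu : ∀ j, M ≤ j → f j ≤ u j - u (j + 1)) (hu0 : ∀ j, 0 ≤ u j) :
    Summable f ∧ ∑' j, f j ≤ ∑ j ∈ Finset.range M, f j + u M := by
  have key : ∀ n, ∑ j ∈ Finset.range n, f j ≤ ∑ j ∈ Finset.range M, f j + u M := by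
    intro n
    have h1 : ∀ m, ∑ j ∈ Finset.range (M + m), f j
        ≤ ∑ j ∈ Finset.range M, f j + u M - u (M + m) := by
      intro m
      induction m with
      | zero => simp
      | succ m ih =>
        rw [← add_assoc, Finset.sum_range_succ]
        linarith [hu (M + m) (by omega)]
    refine le_trans (Finset.sum_le_sum_of_subset_of_nonneg
      (Finset.range_mono (show n ≤ M + n by omega)) fun i _ _ => hf i) ?_
    linarith [h1 n, hu0 (M + n)]
  exact ⟨summable_of_sum_range_le hf key, Real.tsum_le_of_sum_range_le hf key⟩

theorem one_div_sq_le_telescope {j : ℕ} (hj : 1 ≤ j) {B : ℝ} (hB : 0 ≤ B) :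
    B / ((j : ℝ) + 1) ^ 2 ≤ B / j - B / ((j + 1 : ℕ) : ℝ) := by
  have h : (1 : ℝ) ≤ j := by exact_mod_cast hj
  push_cast
  rw [div_sub_div _ _ (by positivity) (by positivity),
    div_le_div_iff₀ (by positivity) (by positivity)]
  have : 0 ≤ B * ((j : ℝ) + 1) := by positivity
  nlinarith

/-- Because 4j(j+1) ≤ (2j+1)². -/
theorem one_div_odd_sq_le_telescope {j : ℕ} (hj : 1 ≤ j) {B : ℝ} (hB : 0 ≤ B) :
    B / (2 * (j : ℝ) + 1) ^ 2 ≤ B / (4 * j) - B / (4 * ((j + 1 : ℕ) : ℝ)) := by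
  have h : (1 : ℝ) ≤ j := by exact_mod_cast hj
  push_cast
  rw [div_sub_div _ _ (by positivity) (by positivity),
    div_le_div_iff₀ (by positivity) (by positivity)]
  nlinarith

theorem tsum_le_of_le_div_sq {f : ℕ → ℝ} (hf : ∀ j, 0 ≤ f j) {A B : ℝ} (hB : 0 ≤ B) {M : ℕ}
    (hM : 1 ≤ M) (hA : ∀ j, j < M → f j ≤ A) (hfB : ∀ j, f j ≤ B / ((j : ℝ) + 1) ^ 2) :
    Summable f ∧ ∑' j, f j ≤ A * M + B / M := by
  obtain ⟨h1, h2⟩ := tsum_le_of_telescope hf M (u := fun j => B / j)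
    (fun j hj => (hfB j).trans (one_div_sq_le_telescope (hM.trans hj) hB))
    (fun j => by positivity)
  refine ⟨h1, h2.trans ?_⟩
  have : ∑ j ∈ Finset.range M, f j ≤ ∑ j ∈ Finset.range M, A :=
    Finset.sum_le_sum fun j hj => hA j (Finset.mem_range.1 hj)
  simp only [Finset.sum_const, Finset.card_range, nsmul_eq_mul] at this
  linarith

theorem tsum_le_of_le_div_odd_sq {f : ℕ → ℝ} (hf : ∀ j, 0 ≤ f j) {B : ℝ} (hB : 0 ≤ B) {M : ℕ}
    (hM : 1 ≤ M) (hfB : ∀ j, f j ≤ B / (2 * (j : ℝ) + 1) ^ 2) :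
    Summable f ∧ ∑' j, f j ≤ ∑ j ∈ Finset.range M, f j + B / (4 * M) :=
  tsum_le_of_telescope hf M (u := fun j => B / (4 * j))
    (fun j hj => (hfB j).trans (one_div_odd_sq_le_telescope (hM.trans hj) hB))
    (fun j => by positivity)

/-- The terms of `cschSum`. -/
noncomputable def cschTerm (τ : ℂ) (j : ℕ) : ℂ :=
  (sinh (((2 * ((j : ℝ) + 1) : ℝ) : ℂ) * τ))⁻¹ / ((4 * ((j : ℝ) + 1) : ℝ) : ℂ)

/-- The terms of `sechSum`. -/
noncomputable def sechTerm (τ : ℂ) (j : ℕ) : ℂ :=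
  (cosh (((2 * (j : ℝ) + 1 : ℝ) : ℂ) * τ))⁻¹ / ((2 * (2 * (j : ℝ) + 1) : ℝ) : ℂ)

/-- The series `∑ 1 / (2 n sinh (n τ))` over the even `n ≥ 1`. -/
noncomputable def cschSum (τ : ℂ) : ℂ := ∑' j, cschTerm τ j

/-- The series `∑ 1 / (2 n cosh (n τ))` over the odd `n ≥ 1`. -/
noncomputable def sechSum (τ : ℂ) : ℂ := ∑' j, sechTerm τ j

theorem norm_cschTerm_le {τ : ℂ} (h : 0 < τ.re) (j : ℕ) :
    ‖cschTerm τ j‖ ≤ 1 / (8 * τ.re) / ((j : ℝ) + 1) ^ 2 := by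
  have h1 := norm_inv_sinh_le (z := ((2 * ((j : ℝ) + 1) : ℝ) : ℂ) * τ)
    (by rw [re_ofReal_mul]; positivity)
  rw [re_ofReal_mul] at h1
  rw [cschTerm, norm_div, norm_real, Real.norm_of_nonneg (by positivity),
    div_le_iff₀ (by positivity)]
  refine h1.trans (le_of_eq ?_)
  field_simp
  norm_num

theorem norm_sechTerm_le {τ : ℂ} (h : 0 < τ.re) (j : ℕ) :
    ‖sechTerm τ j‖ ≤ 1 / (2 * τ.re) / (2 * (j : ℝ) + 1) ^ 2 := by
  have h1 := norm_inv_cosh_le (z := ((2 * (j : ℝ) + 1 : ℝ) : ℂ) * τ)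
    (by rw [re_ofReal_mul]; positivity)
  rw [re_ofReal_mul] at h1
  rw [sechTerm, norm_div, norm_real, Real.norm_of_nonneg (by positivity),
    div_le_iff₀ (by positivity)]
  refine h1.trans (le_of_eq ?_)
  field_simp

theorem summable_norm_cschTerm {τ : ℂ} (h : 0 < τ.re) : Summable fun j => ‖cschTerm τ j‖ := by
  refine (tsum_le_of_telescope (fun _ => norm_nonneg _) 1 (u := fun j => 1 / (8 * τ.re) / j)
    (fun j hj => (norm_cschTerm_le h j).trans (one_div_sq_le_telescope hj ?_)) fun j => ?_).1 <;>
  positivity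

theorem summable_norm_sechTerm {τ : ℂ} (h : 0 < τ.re) : Summable fun j => ‖sechTerm τ j‖ :=
  (tsum_le_of_le_div_odd_sq (fun _ => norm_nonneg _) (by positivity) le_rfl
    (norm_sechTerm_le h)).1

theorem summable_cschTerm {τ : ℂ} (h : 0 < τ.re) : Summable (cschTerm τ) :=
  (summable_norm_cschTerm h).of_norm

theorem summable_sechTerm {τ : ℂ} (h : 0 < τ.re) : Summable (sechTerm τ) :=
  (summable_norm_sechTerm h).of_norm

theorem re_cschSum {τ : ℂ} (h : 0 < τ.re) : (cschSum τ).re = ∑' j, (cschTerm τ j).re :=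
  Complex.re_tsum (summable_cschTerm h)

theorem re_sechSum {τ : ℂ} (h : 0 < τ.re) : (sechSum τ).re = ∑' j, (sechTerm τ j).re :=
  Complex.re_tsum (summable_sechTerm h)

theorem summable_re_cschTerm {τ : ℂ} (h : 0 < τ.re) : Summable fun j => (cschTerm τ j).re :=
  ((Complex.hasSum_iff _ _).1 (summable_cschTerm h).hasSum).1.summable

theorem summable_re_sechTerm {τ : ℂ} (h : 0 < τ.re) : Summable fun j => (sechTerm τ j).re :=
  ((Complex.hasSum_iff _ _).1 (summable_sechTerm h).hasSum).1.summable

theorem cschTerm_re (τ : ℂ) (j : ℕ) : (cschTerm τ j).re =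
    ((sinh (((2 * ((j : ℝ) + 1) : ℝ) : ℂ) * τ))⁻¹).re / (4 * ((j : ℝ) + 1)) := by
  rw [cschTerm, div_ofReal_re]

theorem sechTerm_re (τ : ℂ) (j : ℕ) : (sechTerm τ j).re =
    ((cosh (((2 * (j : ℝ) + 1 : ℝ) : ℂ) * τ))⁻¹).re / (2 * (2 * (j : ℝ) + 1)) := by
  rw [sechTerm, div_ofReal_re]

theorem cschTerm_ofReal_re (t : ℝ) (j : ℕ) : (cschTerm t j).re =
    (Real.sinh (2 * ((j : ℝ) + 1) * t))⁻¹ / (4 * ((j : ℝ) + 1)) := by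
  rw [cschTerm_re, ← ofReal_mul, ← ofReal_sinh, ← ofReal_inv, ofReal_re]

theorem sechTerm_ofReal_re (t : ℝ) (j : ℕ) : (sechTerm t j).re =
    (Real.cosh ((2 * (j : ℝ) + 1) * t))⁻¹ / (2 * (2 * (j : ℝ) + 1)) := by
  rw [sechTerm_re, ← ofReal_mul, ← ofReal_cosh, ← ofReal_inv, ofReal_re]

theorem cschTerm_re_le {τ : ℂ} (h : 0 < τ.re) (j : ℕ) :
    (cschTerm τ j).re ≤ (cschTerm τ.re j).re := by
  have h1 := re_inv_sinh_le (z := ((2 * ((j : ℝ) + 1) : ℝ) : ℂ) * τ)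
    (by rw [re_ofReal_mul]; positivity)
  rw [re_ofReal_mul] at h1
  rw [cschTerm_ofReal_re, cschTerm_re]
  gcongr

theorem cschSum_re_le {τ : ℂ} (h : 0 < τ.re) : (cschSum τ).re ≤ (cschSum τ.re).re := by
  rw [re_cschSum h, re_cschSum (τ := (τ.re : ℂ)) (by simpa using h)]
  exact (summable_re_cschTerm h).tsum_le_tsum (cschTerm_re_le h)
    (summable_re_cschTerm (by simpa using h))

/-- Every term has its largest real part on the real axis, so a loss c in the first term is a loss
of at least c in the sum. -/
theorem cschSum_re_le_sub {τ : ℂ} (h : 0 < τ.re) {c : ℝ}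
    (hc : (cschTerm τ 0).re ≤ (cschTerm τ.re 0).re - c) :
    (cschSum τ).re ≤ (cschSum τ.re).re - c := by
  have h' : 0 < (τ.re : ℂ).re := by simpa using h
  rw [re_cschSum h, re_cschSum h', (summable_re_cschTerm h).tsum_eq_zero_add,
    (summable_re_cschTerm h').tsum_eq_zero_add]
  have := ((summable_nat_add_iff 1).2 (summable_re_cschTerm h)).tsum_le_tsum
    (fun j => cschTerm_re_le h (j + 1)) ((summable_nat_add_iff 1).2 (summable_re_cschTerm h'))
  linarith

theorem sinh_two_mul_le {t : ℝ} (h0 : 0 < t) (h : t ≤ 1 / 493) :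
    Real.sinh (2 * t) ≤ 2 * t * (1 + 1 / 10000) := by
  have hz : ‖((2 * t : ℝ) : ℂ)‖ = 2 * t := by
    rw [norm_real, Real.norm_of_nonneg (by positivity)]
  have h2 := norm_sinh_sub_self_le (z := ((2 * t : ℝ) : ℂ)) (by rw [hz]; linarith)
  rw [hz, ← ofReal_sinh, ← ofReal_sub, norm_real] at h2
  have h3 := (le_abs_self _).trans h2
  have h4 : t ^ 2 ≤ (1 / 493) ^ 2 := by gcongr
  nlinarith

theorem cschTerm_ofReal_zero_ge {t : ℝ} (h0 : 0 < t) (h : t ≤ 1 / 493) :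
    1249 / 10000 / t ≤ (cschTerm t 0).re := by
  have h1 := sinh_two_mul_le h0 h
  have h2 : 0 < Real.sinh (2 * t) := Real.sinh_pos_iff.2 (by positivity)
  rw [cschTerm_ofReal_re]
  norm_num
  rw [div_le_div_iff₀ h0 (by norm_num), inv_mul_eq_div, le_div_iff₀ h2]
  nlinarith

/-- A lower bound for the decrease of the first term of `cschSum` away from the real axis. -/
theorem cschSum_re_le_of_sin {τ : ℂ} (h0 : 0 < τ.re) (h : τ.re ≤ 1 / 493) {c : ℝ} (hc0 : 0 ≤ c)
    (hc : c * (2 * τ.re * (1 + 1 / 10000)) ^ 2 ≤ (1 - c) * Real.sin (2 * τ.im) ^ 2) :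
    (cschSum τ).re ≤ (cschSum τ.re).re - c * (1249 / 10000 / τ.re) := by
  apply cschSum_re_le_sub h0
  have h1 := re_inv_sinh_le_sub (z := ((2 : ℝ) : ℂ) * τ) (c := c)
    (by rw [re_ofReal_mul]; positivity) (by
      rw [re_ofReal_mul, im_ofReal_mul]
      refine le_trans ?_ hc
      have := sinh_two_mul_le h0 h
      have h2 : 0 < Real.sinh (2 * τ.re) := Real.sinh_pos_iff.2 (by positivity)
      gcongr)
  rw [re_ofReal_mul] at h1
  have h2 := cschTerm_ofReal_zero_ge h0 h
  have h3 : c * (1249 / 10000 / τ.re) ≤ c * (cschTerm τ.re 0).re := by gcongr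
  refine le_trans ?_ (sub_le_sub_left h3 _)
  rw [cschTerm_ofReal_re, cschTerm_re]
  norm_num at h1 ⊢
  linarith

/-- Here the first term has nonpositive real part, so the whole first term at the real point, about
1/(8t), is lost. -/
theorem cschSum_re_le_of_cos {τ : ℂ} (h0 : 0 < τ.re) (h : τ.re ≤ 1 / 493)
    (hc : Real.cos (2 * τ.im) ≤ 0) :
    (cschSum τ).re ≤ (cschSum τ.re).re - 1249 / 10000 / τ.re := by
  apply cschSum_re_le_sub h0
  refine le_trans ?_ (sub_nonneg.2 (cschTerm_ofReal_zero_ge h0 h))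
  rw [cschTerm_re, re_inv_sinh]
  have h2 : 0 < Real.sinh (2 * τ.re) := Real.sinh_pos_iff.2 (by positivity)
  refine div_nonpos_of_nonpos_of_nonneg (div_nonpos_of_nonpos_of_nonneg ?_ (by positivity))
    (by positivity)
  norm_num [re_ofReal_mul, im_ofReal_mul]
  exact mul_nonpos_of_nonneg_of_nonpos h2.le hc

theorem abs_re_sechSum_le {τ : ℂ} (h0 : 0 < τ.re) :
    |(sechSum τ).re| ≤ ∑ j ∈ Finset.range 25, |(sechTerm τ j).re| + 1 / 200 / τ.re := by
  have h1 := tsum_le_of_le_div_odd_sq (f := fun j => |(sechTerm τ j).re|) (fun _ => abs_nonneg _)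
    (B := 1 / (2 * τ.re)) (by positivity) (M := 25) (by norm_num)
    (fun j => (abs_re_le_norm _).trans (norm_sechTerm_le h0 j))
  rw [re_sechSum h0]
  have h2 : |∑' j, (sechTerm τ j).re| ≤ ∑' j, |(sechTerm τ j).re| := by
    have := norm_tsum_le_tsum_norm (f := fun j => (sechTerm τ j).re) h1.1
    simpa using this
  refine h2.trans (h1.2.trans (le_of_eq ?_))
  congr 1
  field_simp
  norm_num

/-- The constant 1.34 lies below the value 1.4 guaranteed on the real axis by `sechSum_ofReal_ge`,
so leaving the axis costs at most the tail 1/(200t). -/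
theorem abs_re_sechSum_le_of_abs_im_le {τ : ℂ} (h0 : 0 < τ.re) (h : τ.re ≤ 1 / 493)
    (hi : |τ.im| ≤ 2 * τ.re) : |(sechSum τ).re| ≤ 134 / 100 + 1 / 200 / τ.re := by
  refine (abs_re_sechSum_le h0).trans (add_le_add_left ?_ _)
  have key : ∀ j ∈ Finset.range 25, |(sechTerm τ j).re| ≤ 511 / 1000 * (1 / (2 * (j : ℝ) + 1)) := by
    intro j hj
    have hj' : (j : ℝ) ≤ 24 := by
      have : j ≤ 24 := by have := Finset.mem_range.1 hj; omega
      exact_mod_cast this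
    have h1 : 98 / 100 ≤ ‖cosh (((2 * (j : ℝ) + 1 : ℝ) : ℂ) * τ)‖ := by
      refine le_trans ?_ abs_cos_im_le_norm_cosh
      refine le_trans ?_ (le_abs_self _)
      rw [im_ofReal_mul]
      have := Real.one_sub_sq_div_two_le_cos (x := (2 * (j : ℝ) + 1) * τ.im)
      -- The largest multiplier is 2·24 + 1 = 49, and |Im τ| ≤ 2/493.
      have h3 : ((2 * (j : ℝ) + 1) * τ.im) ^ 2 ≤ (49 * (2 / 493)) ^ 2 := by
        rw [mul_pow, mul_pow, ← sq_abs τ.im]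
        gcongr
        · linarith
        · linarith
      linarith
    refine (abs_re_le_norm _).trans ?_
    rw [sechTerm, norm_div, norm_inv, norm_real, Real.norm_of_nonneg (by positivity)]
    have : ‖cosh (((2 * (j : ℝ) + 1 : ℝ) : ℂ) * τ)‖⁻¹ ≤ (98 / 100)⁻¹ := by gcongr
    rw [div_le_iff₀ (by positivity)]
    refine this.trans ?_
    rw [show 511 / 1000 * (1 / (2 * (j : ℝ) + 1)) * (2 * (2 * (j : ℝ) + 1)) = 1022 / 1000 by
      field_simp; norm_num]
    norm_num
  refine (Finset.sum_le_sum key).trans ?_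
  rw [← Finset.mul_sum]
  norm_num [Finset.sum_range_succ]

/-- Only the first term is bounded through cos θ. The next 24 use the AM-GM bound, with cosh ≤ 1.006
because the arguments are at most 49/493; the remaining tail is 1/(200t). -/
theorem abs_re_sechSum_le_of_cos {τ : ℂ} (h0 : 0 < τ.re) (h : τ.re ≤ 1 / 493)
    (hc : Real.cos τ.im ≠ 0) :
    |(sechSum τ).re| ≤ 1 / (2 * |Real.cos τ.im|) + 613 / 10000 / τ.re := by
  refine (abs_re_sechSum_le h0).trans ?_
  have key : ∀ j ∈ Finset.range 24, |(sechTerm τ (j + 1)).re| ≤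
      1006 / 4000 / τ.re * (1 / (2 * (j : ℝ) + 3) ^ 2) := by
    intro j hj
    have hj' : (j : ℝ) ≤ 23 := by
      have : j ≤ 23 := by have := Finset.mem_range.1 hj; omega
      exact_mod_cast this
    have h1 := abs_re_inv_cosh_le (z := ((2 * ((j + 1 : ℕ) : ℝ) + 1 : ℝ) : ℂ) * τ)
      (by rw [re_ofReal_mul]; positivity)
    rw [re_ofReal_mul] at h1
    rw [sechTerm_re, abs_div, abs_of_pos (a := 2 * (2 * ((j + 1 : ℕ) : ℝ) + 1)) (by positivity)]
    have h2 : Real.cosh ((2 * ((j + 1 : ℕ) : ℝ) + 1) * τ.re) ≤ 1006 / 1000 := by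
      have hx0 : 0 ≤ (2 * ((j + 1 : ℕ) : ℝ) + 1) * τ.re := by positivity
      have hx1 : (2 * ((j + 1 : ℕ) : ℝ) + 1) * τ.re ≤ 49 * (1 / 493) := by
        push_cast
        gcongr
        linarith
      have h3 := Real.cosh_le_exp_half_sq ((2 * ((j + 1 : ℕ) : ℝ) + 1) * τ.re)
      have h4 : ((2 * ((j + 1 : ℕ) : ℝ) + 1) * τ.re) ^ 2 / 2 ≤ 1 / 200 := by
        have := pow_le_pow_left₀ hx0 hx1 2
        norm_num at this ⊢
        linarith
      refine h3.trans ((Real.exp_le_exp.2 h4).trans ?_)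
      have := Real.exp_bound_div_one_sub_of_interval (x := 1 / 200) (by norm_num) (by norm_num)
      refine this.trans ?_
      norm_num
    rw [div_le_iff₀ (by positivity)]
    refine h1.trans ?_
    rw [div_le_iff₀ (by positivity)]
    refine h2.trans (le_of_eq ?_)
    push_cast
    field_simp
    ring
  have h1 : |(sechTerm τ 0).re| ≤ 1 / (2 * |Real.cos τ.im|) := by
    refine (abs_re_le_norm _).trans ?_
    have h2 := @abs_cos_im_le_norm_cosh τ
    have h3 := abs_pos.2 hc
    simp only [sechTerm, CharP.cast_eq_zero, mul_zero, zero_add, ofReal_one, one_mul, mul_one]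
    rw [norm_div, norm_inv, norm_real, Real.norm_of_nonneg (by norm_num), ← one_div, div_div,
      mul_comm]
    gcongr
  rw [Finset.sum_range_succ']
  have h2 := Finset.sum_le_sum key
  rw [← Finset.mul_sum] at h2
  have h3 : ∑ j ∈ Finset.range 24, (1 / (2 * (j : ℝ) + 3) ^ 2) ≤ 2238 / 10000 := by
    norm_num [Finset.sum_range_succ]
  have h4 : 1006 / 4000 / τ.re * ∑ j ∈ Finset.range 24, (1 / (2 * (j : ℝ) + 3) ^ 2)
      ≤ 1006 / 4000 / τ.re * (2238 / 10000) := by gcongr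
  have h5 : 1006 / 4000 / τ.re * (2238 / 10000) + 1 / 200 / τ.re ≤ 613 / 10000 / τ.re := by
    rw [div_mul_eq_mul_div, ← add_div]
    gcongr
    norm_num
  linarith

theorem sechSum_ofReal_ge {t : ℝ} (h0 : 0 < t) (h : t ≤ 1 / 493) :
    14 / 10 ≤ (sechSum t).re := by
  have ht : 0 < (t : ℂ).re := by simpa using h0
  rw [re_sechSum ht]
  refine le_trans ?_ ((summable_re_sechTerm ht).sum_le_tsum (Finset.range 50) fun j _ => ?_)
  · have key : ∀ j ∈ Finset.range 50, 489 / 1000 * (1 / (2 * (j : ℝ) + 1)) ≤ (sechTerm t j).re := by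
      intro j hj
      have hj' : (j : ℝ) ≤ 49 := by
        have : j ≤ 49 := by have := Finset.mem_range.1 hj; omega
        exact_mod_cast this
      rw [sechTerm_ofReal_re]
      have hx1 : (2 * (j : ℝ) + 1) * t ≤ 99 * (1 / 493) := by
        gcongr
        linarith
      have h3 := Real.cosh_le_exp_half_sq ((2 * (j : ℝ) + 1) * t)
      have h4 : ((2 * (j : ℝ) + 1) * t) ^ 2 / 2 ≤ 1 / 49 := by
        have := pow_le_pow_left₀ (by positivity) hx1 2
        norm_num at this ⊢
        linarith
      have h2 : Real.cosh ((2 * (j : ℝ) + 1) * t) ≤ 49 / 48 := by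
        refine h3.trans ((Real.exp_le_exp.2 h4).trans ?_)
        have := Real.exp_bound_div_one_sub_of_interval (x := 1 / 49) (by norm_num) (by norm_num)
        refine this.trans ?_
        norm_num
      have h5 : (49 / 48 : ℝ)⁻¹ ≤ (Real.cosh ((2 * (j : ℝ) + 1) * t))⁻¹ :=
        inv_anti₀ (Real.cosh_pos _) h2
      rw [le_div_iff₀ (by positivity)]
      refine le_trans ?_ h5
      rw [show 489 / 1000 * (1 / (2 * (j : ℝ) + 1)) * (2 * (2 * (j : ℝ) + 1)) = 978 / 1000 by
        field_simp; norm_num]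
      norm_num
    refine le_trans ?_ (Finset.sum_le_sum key)
    rw [← Finset.mul_sum]
    norm_num [Finset.sum_range_succ]
  · rw [sechTerm_ofReal_re]
    have := Real.cosh_pos ((2 * (j : ℝ) + 1) * t)
    positivity

end CollMayersMayers

namespace CollMayersMayers

open Complex

/-! ### Variation of the logarithm near the positive real axis -/

theorem norm_sub_le_of_vertical {f f' : ℂ → ℂ} (hf : ∀ z : ℂ, 0 < z.re → HasDerivAt f (f' z) z)
    {w : ℂ} (hw : 0 < w.re) {C : ℝ}
    (hC : ∀ z : ℂ, z.re = w.re → |z.im| ≤ |w.im| → ‖f' z‖ ≤ C) :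
    ‖f w - f w.re‖ ≤ C * |w.im| := by
  have hseg : ∀ z ∈ segment ℝ (w.re : ℂ) w, z.re = w.re ∧ |z.im| ≤ |w.im| := by
    rintro z ⟨a, b, ha, hb, hab, rfl⟩
    constructor
    · simp only [add_re, real_smul, re_ofReal_mul, ofReal_re]
      rw [← add_mul, hab, one_mul]
    · simp only [add_im, real_smul, im_ofReal_mul, ofReal_im, mul_zero, zero_add]
      rw [abs_mul, abs_of_nonneg hb]
      exact mul_le_of_le_one_left (abs_nonneg _) (by linarith)
  have h := (convex_segment (w.re : ℂ) w).norm_image_sub_le_of_norm_hasDerivWithin_le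
    (f := f) (f' := f') (C := C)
    (fun z hz => (hf z (by rw [(hseg z hz).1]; exact hw)).hasDerivWithinAt)
    (fun z hz => hC z (hseg z hz).1 (hseg z hz).2) (left_mem_segment ℝ _ _)
    (right_mem_segment ℝ _ _)
  have e : w - (w.re : ℂ) = (w.im : ℂ) * I := by
    apply Complex.ext <;> simp
  rwa [e, norm_mul, norm_I, mul_one, norm_real, Real.norm_eq_abs] at h

theorem norm_le_one_of_re_le {z : ℂ} (h0 : 0 ≤ z.re) (h1 : z.re ≤ 22 / 25)
    (h2 : |z.im| ≤ z.re / 2) : ‖z‖ ≤ 1 := by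
  rw [norm_def]
  refine Real.sqrt_le_one.2 ?_
  rw [normSq_apply]
  have h3 := abs_nonneg z.im
  have h4 := sq_abs z.im
  nlinarith

/-- The cutoff M = ⌊0.44/t⌋ keeps multiples of τ up to 2Mt ≤ 0.88 in the region where the derivative
bounds on the unit disc apply. -/
theorem floor_bounds {t : ℝ} (h0 : 0 < t) (h : t ≤ 1 / 493) :
    1 ≤ ⌊11 / 25 / t⌋₊ ∧ (⌊11 / 25 / t⌋₊ : ℝ) * t ≤ 11 / 25 ∧
      437 / 1000 ≤ (⌊11 / 25 / t⌋₊ : ℝ) * t := by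
  have h1 : (⌊11 / 25 / t⌋₊ : ℝ) ≤ 11 / 25 / t := Nat.floor_le (by positivity)
  have h2 : 11 / 25 / t < ⌊11 / 25 / t⌋₊ + 1 := Nat.lt_floor_add_one _
  rw [le_div_iff₀ h0] at h1
  rw [div_lt_iff₀ h0] at h2
  refine ⟨?_, h1, by linarith⟩
  by_contra hc
  have h3 : ⌊11 / 25 / t⌋₊ = 0 := by omega
  rw [h3] at h2
  norm_num at h2
  linarith

theorem norm_sub_cschRegular_le {w : ℂ} (hw : 0 < w.re) :
    ‖cschRegular w - cschRegular w.re‖ ≤ 3 / w.re ^ 2 * |w.im| :=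
  norm_sub_le_of_vertical (fun _ hz => hasDerivAt_cschRegular hz) hw fun z hz _ => by
    rw [← hz]; exact norm_deriv_cschRegular_le' (by rw [hz]; exact hw)

theorem norm_sub_cschRegular_le_of_re_le {w : ℂ} (hw : 0 < w.re) (h1 : w.re ≤ 22 / 25)
    (h2 : |w.im| ≤ w.re / 2) :
    ‖cschRegular w - cschRegular w.re‖ ≤ 21 / 10 * |w.im| :=
  norm_sub_le_of_vertical (fun _ hz => hasDerivAt_cschRegular hz) hw fun z hz hz' =>
    norm_deriv_cschRegular_le (by rw [hz]; exact hw)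
      (norm_le_one_of_re_le (by rw [hz]; exact hw.le) (by rwa [hz]) (by rw [hz]; linarith))

theorem norm_sub_inv_cosh_le {w : ℂ} (hw : 0 < w.re) :
    ‖(cosh w)⁻¹ - (cosh w.re)⁻¹‖ ≤ 2 / w.re ^ 2 * |w.im| :=
  norm_sub_le_of_vertical (f := fun z => (cosh z)⁻¹) (fun _ hz => hasDerivAt_inv_cosh hz) hw
    fun z hz _ => by
    rw [← hz]; exact norm_deriv_inv_cosh_le' (by rw [hz]; exact hw)

theorem norm_sub_inv_cosh_le_of_re_le {w : ℂ} (hw : 0 < w.re) (h1 : w.re ≤ 22 / 25)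
    (h2 : |w.im| ≤ w.re / 2) :
    ‖(cosh w)⁻¹ - (cosh w.re)⁻¹‖ ≤ 8 / 5 * |w.im| :=
  norm_sub_le_of_vertical (f := fun z => (cosh z)⁻¹) (fun _ hz => hasDerivAt_inv_cosh hz) hw
    fun z hz hz' =>
    norm_deriv_inv_cosh_le
      (norm_le_one_of_re_le (by rw [hz]; exact hw.le) (by rwa [hz]) (by rw [hz]; linarith))
      (by linarith)

/-- Below the cutoff the derivative of 1/cosh is bounded, above it decays quadratically. In units of
|Im τ|/Re τ the two ranges give 0.352 and 0.573. -/
theorem norm_sechSum_sub_le {τ : ℂ} (h0 : 0 < τ.re) (h : τ.re ≤ 1 / 493)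
    (hi : |τ.im| ≤ τ.re / 2) : ‖sechSum τ - sechSum τ.re‖ ≤ |τ.im| / τ.re := by
  have h0' : 0 < (τ.re : ℂ).re := by simpa using h0
  obtain ⟨hM, hM1, hM2⟩ := floor_bounds h0 h
  set M := ⌊11 / 25 / τ.re⌋₊
  have hMp : (0 : ℝ) < M := by exact_mod_cast hM
  have e : ∀ j, sechTerm τ j - sechTerm τ.re j =
      ((cosh (((2 * (j : ℝ) + 1 : ℝ) : ℂ) * τ))⁻¹
        - (cosh (((((2 * (j : ℝ) + 1 : ℝ) : ℂ) * τ).re : ℝ) : ℂ))⁻¹) /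
        ((2 * (2 * (j : ℝ) + 1) : ℝ) : ℂ) := by
    intro j
    rw [sechTerm, sechTerm, sub_div, re_ofReal_mul]
    push_cast
    rfl
  have b1 : ∀ j : ℕ, ‖sechTerm τ j - sechTerm τ.re j‖ ≤
      |τ.im| / τ.re ^ 2 / (2 * (j : ℝ) + 1) ^ 2 := by
    intro j
    have h1 := norm_sub_inv_cosh_le (w := ((2 * (j : ℝ) + 1 : ℝ) : ℂ) * τ)
      (by rw [re_ofReal_mul]; positivity)
    rw [e, norm_div, norm_real, Real.norm_of_nonneg (by positivity), div_le_iff₀ (by positivity)]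
    refine h1.trans (le_of_eq ?_)
    rw [re_ofReal_mul, im_ofReal_mul, abs_mul, abs_of_pos (a := 2 * (j : ℝ) + 1) (by positivity)]
    field_simp
  have b2 : ∀ j < M, ‖sechTerm τ j - sechTerm τ.re j‖ ≤ 4 / 5 * |τ.im| := by
    intro j hj
    have hj' : (j : ℝ) + 1 ≤ M := by exact_mod_cast hj
    have h1 := norm_sub_inv_cosh_le_of_re_le (w := ((2 * (j : ℝ) + 1 : ℝ) : ℂ) * τ)
      (by rw [re_ofReal_mul]; positivity) (by rw [re_ofReal_mul]; nlinarith) (by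
        rw [re_ofReal_mul, im_ofReal_mul, abs_mul,
          abs_of_pos (a := 2 * (j : ℝ) + 1) (by positivity), mul_div_assoc]
        gcongr)
    rw [e, norm_div, norm_real, Real.norm_of_nonneg (by positivity), div_le_iff₀ (by positivity)]
    refine h1.trans (le_of_eq ?_)
    rw [im_ofReal_mul, abs_mul, abs_of_pos (a := 2 * (j : ℝ) + 1) (by positivity)]
    ring
  obtain ⟨s1, s2⟩ := tsum_le_of_le_div_odd_sq (fun _ => norm_nonneg _) (by positivity) hM b1
  have h3 : ∑ j ∈ Finset.range M, ‖sechTerm τ j - sechTerm τ.re j‖ ≤ M * (4 / 5 * |τ.im|) := by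
    refine (Finset.sum_le_sum fun j hj => b2 j (Finset.mem_range.1 hj)).trans ?_
    simp
  have h4 : sechSum τ - sechSum τ.re = ∑' j, (sechTerm τ j - sechTerm τ.re j) :=
    ((summable_sechTerm h0).tsum_sub (summable_sechTerm h0')).symm
  rw [h4]
  refine (norm_tsum_le_tsum_norm s1).trans (s2.trans ?_)
  have h5 : |τ.im| / τ.re ^ 2 / (4 * M) ≤ 573 / 1000 * (|τ.im| / τ.re) := by
    rw [div_div, ← mul_div_assoc, div_le_div_iff₀ (by positivity) h0]
    have : 0 ≤ |τ.im| * τ.re := by positivity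
    nlinarith
  have h6 : M * (4 / 5 * |τ.im|) ≤ 352 / 1000 * (|τ.im| / τ.re) := by
    rw [← mul_div_assoc, le_div_iff₀ h0]
    have := abs_nonneg τ.im
    nlinarith
  have : 0 ≤ |τ.im| / τ.re := by positivity
  linarith

theorem hasSum_one_div_eight_mul_sq :
    HasSum (fun j : ℕ => 1 / (8 * ((j : ℝ) + 1) ^ 2)) (Real.pi ^ 2 / 48) := by
  have h := (hasSum_nat_add_iff' 1).2 hasSum_zeta_two
  simp only [Finset.sum_range_one, CharP.cast_eq_zero, ne_eq, OfNat.ofNat_ne_zero,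
    not_false_eq_true, zero_pow, div_zero, sub_zero] at h
  have h2 := h.div_const 8
  have e : Real.pi ^ 2 / 6 / 8 = Real.pi ^ 2 / 48 := by ring
  rw [e] at h2
  have e' : (fun j : ℕ => 1 / (8 * ((j : ℝ) + 1) ^ 2)) =
      fun j : ℕ => 1 / ((j + 1 : ℕ) : ℝ) ^ 2 / 8 := by
    ext j
    push_cast
    field_simp
  rw [e']
  exact h2

theorem cschTerm_sub (τ : ℂ) (j : ℕ) :
    cschTerm τ j - ((1 / (8 * ((j : ℝ) + 1) ^ 2) : ℝ) : ℂ) / τ =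
      cschRegular (((2 * ((j : ℝ) + 1) : ℝ) : ℂ) * τ) / ((4 * ((j : ℝ) + 1) : ℝ) : ℂ) := by
  rw [cschTerm, cschRegular, sub_div]
  congr 1
  have : ((j : ℂ) + 1) ≠ 0 := Nat.cast_add_one_ne_zero j
  push_cast
  by_cases h : τ = 0
  · simp [h]
  · field_simp
    norm_num

theorem cschSum_sub_eq_tsum {τ : ℂ} (h0 : 0 < τ.re) :
    HasSum (fun j : ℕ =>
      cschRegular (((2 * ((j : ℝ) + 1) : ℝ) : ℂ) * τ) / ((4 * ((j : ℝ) + 1) : ℝ) : ℂ))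
      (cschSum τ - ((Real.pi ^ 2 / 48 : ℝ) : ℂ) / τ) := by
  simp only [← cschTerm_sub]
  exact (summable_cschTerm h0).hasSum.sub
    ((Complex.hasSum_ofReal.2 hasSum_one_div_eight_mul_sq).div_const τ)

/-- The same splitting, applied after removing the principal part π²/(48τ); the two ranges give
0.463 and 0.860. -/
theorem norm_cschSum_sub_le {τ : ℂ} (h0 : 0 < τ.re) (h : τ.re ≤ 1 / 493)
    (hi : |τ.im| ≤ τ.re / 2) :
    ‖(cschSum τ - ((Real.pi ^ 2 / 48 : ℝ) : ℂ) / τ)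
      - (cschSum τ.re - ((Real.pi ^ 2 / 48 : ℝ) : ℂ) / (τ.re : ℂ))‖ ≤
      7 / 5 * (|τ.im| / τ.re) := by
  have h0' : 0 < (τ.re : ℂ).re := by simpa using h0
  obtain ⟨hM, hM1, hM2⟩ := floor_bounds h0 h
  set M := ⌊11 / 25 / τ.re⌋₊
  have hMp : (0 : ℝ) < M := by exact_mod_cast hM
  have hs := (cschSum_sub_eq_tsum h0).sub (cschSum_sub_eq_tsum h0')
  set f : ℕ → ℂ := fun j =>
    cschRegular (((2 * ((j : ℝ) + 1) : ℝ) : ℂ) * τ) / ((4 * ((j : ℝ) + 1) : ℝ) : ℂ)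
    - cschRegular (((2 * ((j : ℝ) + 1) : ℝ) : ℂ) * (τ.re : ℂ)) / ((4 * ((j : ℝ) + 1) : ℝ) : ℂ)
    with hf
  have e : ∀ j, f j = (cschRegular (((2 * ((j : ℝ) + 1) : ℝ) : ℂ) * τ)
        - cschRegular (((((2 * ((j : ℝ) + 1) : ℝ) : ℂ) * τ).re : ℝ) : ℂ)) /
        ((4 * ((j : ℝ) + 1) : ℝ) : ℂ) := by
    intro j
    simp only [hf]
    rw [sub_div, re_ofReal_mul]
    push_cast
    rfl
  have b1 : ∀ j : ℕ, ‖f j‖ ≤ 3 / 8 * |τ.im| / τ.re ^ 2 / ((j : ℝ) + 1) ^ 2 := by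
    intro j
    have h1 := norm_sub_cschRegular_le (w := ((2 * ((j : ℝ) + 1) : ℝ) : ℂ) * τ)
      (by rw [re_ofReal_mul]; positivity)
    rw [e, norm_div, norm_real, Real.norm_of_nonneg (by positivity), div_le_iff₀ (by positivity)]
    refine h1.trans (le_of_eq ?_)
    rw [re_ofReal_mul, im_ofReal_mul, abs_mul, abs_of_pos (a := 2 * ((j : ℝ) + 1)) (by positivity)]
    field_simp
    ring
  have b2 : ∀ j < M, ‖f j‖ ≤ 21 / 20 * |τ.im| := by
    intro j hj
    have hj' : (j : ℝ) + 1 ≤ M := by exact_mod_cast hj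
    have h1 := norm_sub_cschRegular_le_of_re_le (w := ((2 * ((j : ℝ) + 1) : ℝ) : ℂ) * τ)
      (by rw [re_ofReal_mul]; positivity) (by rw [re_ofReal_mul]; nlinarith) (by
        rw [re_ofReal_mul, im_ofReal_mul, abs_mul,
          abs_of_pos (a := 2 * ((j : ℝ) + 1)) (by positivity), mul_div_assoc]
        gcongr)
    rw [e, norm_div, norm_real, Real.norm_of_nonneg (by positivity), div_le_iff₀ (by positivity)]
    refine h1.trans (le_of_eq ?_)
    rw [im_ofReal_mul, abs_mul, abs_of_pos (a := 2 * ((j : ℝ) + 1)) (by positivity)]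
    ring
  obtain ⟨s1, s2⟩ := tsum_le_of_le_div_sq (fun _ => norm_nonneg _) (by positivity) hM b2 b1
  rw [← hs.tsum_eq]
  refine (norm_tsum_le_tsum_norm s1).trans (s2.trans ?_)
  have h5 : 3 / 8 * |τ.im| / τ.re ^ 2 / M ≤ 860 / 1000 * (|τ.im| / τ.re) := by
    rw [div_div, ← mul_div_assoc, div_le_div_iff₀ (by positivity) h0]
    have : 0 ≤ |τ.im| * τ.re := by positivity
    nlinarith
  have h6 : 21 / 20 * |τ.im| * M ≤ 463 / 1000 * (|τ.im| / τ.re) := by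
    rw [← mul_div_assoc, le_div_iff₀ h0]
    have := abs_nonneg τ.im
    nlinarith
  have : 0 ≤ |τ.im| / τ.re := by positivity
  linarith

/-! ### The logarithm near the imaginary unit -/

/-- The cutoff M = ⌊1/(2‖σ‖)⌋ keeps the arguments in the unit disc: each of the first M terms is at
most ‖σ‖/7, together 1/14. The tail uses the decay of `cschRegular`. -/
theorem tsum_norm_cschRegular_even_le {σ : ℂ} (h0 : 0 < σ.re) (h : ‖σ‖ ≤ 1 / 29) :
    (Summable fun j : ℕ => ‖cschRegular (((2 * ((j : ℝ) + 1) : ℝ) : ℂ) * σ) /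
      ((4 * ((j : ℝ) + 1) : ℝ) : ℂ)‖) ∧
    ∑' j : ℕ, ‖cschRegular (((2 * ((j : ℝ) + 1) : ℝ) : ℂ) * σ) /
      ((4 * ((j : ℝ) + 1) : ℝ) : ℂ)‖ ≤ 1 / 14 + 54 / 100 * (‖σ‖ / σ.re) := by
  have hσ : 0 < ‖σ‖ := norm_pos_iff.2 (by rintro rfl; simp at h0)
  have hM1 : (⌊1 / 2 / ‖σ‖⌋₊ : ℝ) ≤ 1 / 2 / ‖σ‖ := Nat.floor_le (by positivity)
  have hM2 : 1 / 2 / ‖σ‖ < ⌊1 / 2 / ‖σ‖⌋₊ + 1 := Nat.lt_floor_add_one _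
  have hM : 1 ≤ ⌊1 / 2 / ‖σ‖⌋₊ := by
    rw [Nat.one_le_floor_iff, le_div_iff₀ hσ]; linarith
  set M := ⌊1 / 2 / ‖σ‖⌋₊
  have hMp : (0 : ℝ) < M := by exact_mod_cast hM
  rw [le_div_iff₀ hσ] at hM1
  rw [div_lt_iff₀ hσ] at hM2
  have b1 : ∀ j : ℕ, ‖cschRegular (((2 * ((j : ℝ) + 1) : ℝ) : ℂ) * σ) /
      ((4 * ((j : ℝ) + 1) : ℝ) : ℂ)‖ ≤ 1 / 4 / σ.re / ((j : ℝ) + 1) ^ 2 := by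
    intro j
    have h1 := norm_cschRegular_le' (z := ((2 * ((j : ℝ) + 1) : ℝ) : ℂ) * σ)
      (by rw [re_ofReal_mul]; positivity)
    rw [norm_div, norm_real, Real.norm_of_nonneg (by positivity), div_le_iff₀ (by positivity)]
    refine h1.trans (le_of_eq ?_)
    rw [re_ofReal_mul]
    field_simp
  have b2 : ∀ j < M, ‖cschRegular (((2 * ((j : ℝ) + 1) : ℝ) : ℂ) * σ) /
      ((4 * ((j : ℝ) + 1) : ℝ) : ℂ)‖ ≤ 1 / 7 * ‖σ‖ := by
    intro j hj
    have hj' : (j : ℝ) + 1 ≤ M := by exact_mod_cast hj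
    have hn : ‖((2 * ((j : ℝ) + 1) : ℝ) : ℂ) * σ‖ = 2 * ((j : ℝ) + 1) * ‖σ‖ := by
      rw [norm_mul, norm_real, Real.norm_of_nonneg (by positivity)]
    have h1 := norm_cschRegular_le (z := ((2 * ((j : ℝ) + 1) : ℝ) : ℂ) * σ)
      (by rw [re_ofReal_mul]; positivity) (by rw [hn]; nlinarith)
    rw [norm_div, norm_real, Real.norm_of_nonneg (by positivity), div_le_iff₀ (by positivity)]
    refine h1.trans (le_of_eq ?_)
    rw [hn]
    ring
  obtain ⟨s1, s2⟩ := tsum_le_of_le_div_sq (fun _ => norm_nonneg _) (by positivity) hM b2 b1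
  refine ⟨s1, s2.trans ?_⟩
  have h5 : 1 / 4 / σ.re / M ≤ 54 / 100 * (‖σ‖ / σ.re) := by
    rw [div_div, ← mul_div_assoc, div_le_div_iff₀ (by positivity) h0]
    have : 463 / 1000 ≤ ‖σ‖ * M := by linarith
    nlinarith
  linarith

theorem tsum_norm_cschRegular_odd_le {σ : ℂ} (h0 : 0 < σ.re) (h : ‖σ‖ ≤ 1 / 29) :
    (Summable fun j : ℕ => ‖cschRegular (((2 * (j : ℝ) + 1 : ℝ) : ℂ) * σ) /
      ((2 * (2 * (j : ℝ) + 1) : ℝ) : ℂ)‖) ∧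
    ∑' j : ℕ, ‖cschRegular (((2 * (j : ℝ) + 1 : ℝ) : ℂ) * σ) /
      ((2 * (2 * (j : ℝ) + 1) : ℝ) : ℂ)‖ ≤ 1 / 14 + 54 / 100 * (‖σ‖ / σ.re) := by
  have hσ : 0 < ‖σ‖ := norm_pos_iff.2 (by rintro rfl; simp at h0)
  have hM1 : (⌊1 / 2 / ‖σ‖⌋₊ : ℝ) ≤ 1 / 2 / ‖σ‖ := Nat.floor_le (by positivity)
  have hM2 : 1 / 2 / ‖σ‖ < ⌊1 / 2 / ‖σ‖⌋₊ + 1 := Nat.lt_floor_add_one _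
  have hM : 1 ≤ ⌊1 / 2 / ‖σ‖⌋₊ := by
    rw [Nat.one_le_floor_iff, le_div_iff₀ hσ]; linarith
  set M := ⌊1 / 2 / ‖σ‖⌋₊
  have hMp : (0 : ℝ) < M := by exact_mod_cast hM
  rw [le_div_iff₀ hσ] at hM1
  rw [div_lt_iff₀ hσ] at hM2
  have b1 : ∀ j : ℕ, ‖cschRegular (((2 * (j : ℝ) + 1 : ℝ) : ℂ) * σ) /
      ((2 * (2 * (j : ℝ) + 1) : ℝ) : ℂ)‖ ≤ 1 / σ.re / (2 * (j : ℝ) + 1) ^ 2 := by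
    intro j
    have h1 := norm_cschRegular_le' (z := ((2 * (j : ℝ) + 1 : ℝ) : ℂ) * σ)
      (by rw [re_ofReal_mul]; positivity)
    rw [norm_div, norm_real, Real.norm_of_nonneg (by positivity), div_le_iff₀ (by positivity)]
    refine h1.trans (le_of_eq ?_)
    rw [re_ofReal_mul]
    field_simp
  have b2 : ∀ j ∈ Finset.range M, ‖cschRegular (((2 * (j : ℝ) + 1 : ℝ) : ℂ) * σ) /
      ((2 * (2 * (j : ℝ) + 1) : ℝ) : ℂ)‖ ≤ 1 / 7 * ‖σ‖ := by
    intro j hj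
    have hj' : (j : ℝ) + 1 ≤ M := by exact_mod_cast Finset.mem_range.1 hj
    have hn : ‖((2 * (j : ℝ) + 1 : ℝ) : ℂ) * σ‖ = (2 * (j : ℝ) + 1) * ‖σ‖ := by
      rw [norm_mul, norm_real, Real.norm_of_nonneg (by positivity)]
    have h1 := norm_cschRegular_le (z := ((2 * (j : ℝ) + 1 : ℝ) : ℂ) * σ)
      (by rw [re_ofReal_mul]; positivity) (by rw [hn]; nlinarith)
    rw [norm_div, norm_real, Real.norm_of_nonneg (by positivity), div_le_iff₀ (by positivity)]
    refine h1.trans (le_of_eq ?_)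
    rw [hn]
    ring
  obtain ⟨s1, s2⟩ := tsum_le_of_le_div_odd_sq (fun _ => norm_nonneg _) (by positivity) hM b1
  refine ⟨s1, s2.trans ?_⟩
  have h3 := Finset.sum_le_sum b2
  rw [Finset.sum_const, Finset.card_range, nsmul_eq_mul] at h3
  have h5 : 1 / σ.re / (4 * M) ≤ 54 / 100 * (‖σ‖ / σ.re) := by
    rw [div_div, ← mul_div_assoc, div_le_div_iff₀ (by positivity) h0]
    have : 463 / 1000 ≤ ‖σ‖ * M := by linarith
    nlinarith
  linarith

theorem cschSum_ofReal_ge {t : ℝ} (h0 : 0 < t) (h : t ≤ 1 / 493) :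
    Real.pi ^ 2 / 48 / t - 62 / 100 ≤ (cschSum t).re := by
  have h0' : 0 < (t : ℂ).re := by simpa using h0
  have hn : ‖(t : ℂ)‖ = t := by rw [norm_real, Real.norm_of_nonneg h0.le]
  obtain ⟨s1, s2⟩ := tsum_norm_cschRegular_even_le h0' (by rw [hn]; linarith)
  have h1 := (norm_tsum_le_tsum_norm s1).trans s2
  rw [(cschSum_sub_eq_tsum h0').tsum_eq, hn, ofReal_re, div_self h0.ne'] at h1
  have h2 := (abs_le.1 ((abs_re_le_norm _).trans h1)).1
  rw [sub_re, ← ofReal_div, ofReal_re] at h2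
  linarith

theorem catalan_half_le {l : ℝ}
    (h : HasSum (fun j : ℕ => (-1) ^ j * (1 / (2 * (2 * (j : ℝ) + 1) ^ 2))) l) :
    0 ≤ l ∧ l ≤ 46 / 100 := by
  have ha : Antitone fun j : ℕ => 1 / (2 * (2 * (j : ℝ) + 1) ^ 2) := by
    intro a b hab
    have : (a : ℝ) ≤ b := by exact_mod_cast hab
    simp only
    gcongr
  constructor
  · have := ha.alternating_series_le_tendsto h.tendsto_sum_nat 1
    norm_num [Finset.sum_range_succ] at this
    linarith
  · refine (ha.tendsto_le_alternating_series h.tendsto_sum_nat 3).trans ?_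
    norm_num [Finset.sum_range_succ]

end CollMayersMayers

namespace CollMayersMayers

open Complex

/-! ### Translation by -iπ/2, which moves the origin to q = i. -/

theorem sinh_sub_nat_mul_pi_mul_I (z : ℂ) (n : ℕ) :
    sinh (z - n * (Real.pi * I)) = (-1) ^ n * sinh z := by
  induction n with
  | zero => simp
  | succ n ih =>
    have : z - ((n + 1 : ℕ) : ℂ) * (Real.pi * I) = (z - n * (Real.pi * I)) - Real.pi * I := by
      push_cast; ring
    rw [this, sinh_sub, cosh_mul_I, sinh_mul_I, Complex.cos_pi, Complex.sin_pi, ih]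
    ring

theorem cosh_sub_nat_mul_pi_mul_I (z : ℂ) (n : ℕ) :
    cosh (z - n * (Real.pi * I)) = (-1) ^ n * cosh z := by
  induction n with
  | zero => simp
  | succ n ih =>
    have : z - ((n + 1 : ℕ) : ℂ) * (Real.pi * I) = (z - n * (Real.pi * I)) - Real.pi * I := by
      push_cast; ring
    rw [this, cosh_sub, cosh_mul_I, sinh_mul_I, Complex.cos_pi, Complex.sin_pi, ih]
    ring

theorem cschTerm_sub_pi_div_two (σ : ℂ) (j : ℕ) :
    cschTerm (σ - Real.pi / 2 * I) j = (-1) ^ (j + 1) * cschTerm σ j := by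
  rw [cschTerm, cschTerm]
  have : ((2 * ((j : ℝ) + 1) : ℝ) : ℂ) * (σ - Real.pi / 2 * I)
      = ((2 * ((j : ℝ) + 1) : ℝ) : ℂ) * σ - ((j + 1 : ℕ) : ℂ) * (Real.pi * I) := by
    push_cast; ring
  rw [this, sinh_sub_nat_mul_pi_mul_I, mul_inv, mul_div_assoc]
  congr 1
  rw [← inv_pow]
  norm_num

theorem sechTerm_sub_pi_div_two (σ : ℂ) (j : ℕ) :
    sechTerm (σ - Real.pi / 2 * I) j = (-1) ^ j * I *
      ((sinh (((2 * (j : ℝ) + 1 : ℝ) : ℂ) * σ))⁻¹ / ((2 * (2 * (j : ℝ) + 1) : ℝ) : ℂ)) := by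
  rw [sechTerm]
  have : ((2 * (j : ℝ) + 1 : ℝ) : ℂ) * (σ - Real.pi / 2 * I)
      = (((2 * (j : ℝ) + 1 : ℝ) : ℂ) * σ - Real.pi / 2 * I) - (j : ℂ) * (Real.pi * I) := by
    push_cast; ring
  rw [this, cosh_sub_nat_mul_pi_mul_I, cosh_sub, cosh_mul_I, sinh_mul_I, Complex.cos_pi_div_two,
    Complex.sin_pi_div_two, mul_zero, zero_sub, one_mul, mul_inv, ← mul_neg, mul_inv, inv_neg,
    inv_I, neg_neg, ← inv_pow]
  norm_num
  ring

/-- The shift inserts signs (-1)^(j+1), so the principal part becomes c/σ with c = -π²/96; ten terms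
of the alternating series suffice for the stated bound. -/
theorem norm_cschSum_sub_le_of_sub_pi_div_two {σ : ℂ} (h0 : 0 < σ.re) (h : ‖σ‖ ≤ 1 / 29) :
    ∃ c : ℝ, c ≤ -(102 / 1000) ∧ ‖cschSum (σ - Real.pi / 2 * I) - (c : ℂ) / σ‖ ≤
      1 / 14 + 54 / 100 * (‖σ‖ / σ.re) := by
  have hs : Summable fun j : ℕ => (-1) ^ j * (1 / (8 * ((j : ℝ) + 1) ^ 2)) := by
    refine Summable.of_norm_bounded hasSum_one_div_eight_mul_sq.summable fun j => ?_
    rw [norm_mul, norm_pow, norm_neg, norm_one, one_pow, one_mul,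
      Real.norm_of_nonneg (by positivity)]
  refine ⟨-∑' j : ℕ, (-1) ^ j * (1 / (8 * ((j : ℝ) + 1) ^ 2)), ?_, ?_⟩
  · have ha : Antitone fun j : ℕ => 1 / (8 * ((j : ℝ) + 1) ^ 2) := by
      intro a b hab
      have : (a : ℝ) ≤ b := by exact_mod_cast hab
      simp only
      gcongr
    have := ha.alternating_series_le_tendsto hs.hasSum.tendsto_sum_nat 5
    norm_num [Finset.sum_range_succ] at this
    norm_num
    linarith
  · obtain ⟨s1, s2⟩ := tsum_norm_cschRegular_even_le h0 h
    have h0' : 0 < (σ - Real.pi / 2 * I).re := by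
      have : (σ - Real.pi / 2 * I).re = σ.re := by
        simp
      rwa [this]
    have h1 := (summable_cschTerm h0').hasSum.sub
      ((Complex.hasSum_ofReal.2 hs.hasSum.neg).div_const σ)
    have e : (fun j : ℕ => cschTerm (σ - Real.pi / 2 * I) j -
        ((-((-1) ^ j * (1 / (8 * ((j : ℝ) + 1) ^ 2))) : ℝ) : ℂ) / σ) = fun j : ℕ =>
        (-1) ^ (j + 1) * (cschRegular (((2 * ((j : ℝ) + 1) : ℝ) : ℂ) * σ) /
          ((4 * ((j : ℝ) + 1) : ℝ) : ℂ)) := by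
      ext j
      rw [cschTerm_sub_pi_div_two, ← cschTerm_sub]
      push_cast
      ring
    rw [e] at h1
    change ‖∑' j, cschTerm (σ - Real.pi / 2 * I) j - _‖ ≤ _
    rw [← h1.tsum_eq]
    have en : ∀ j : ℕ, ‖(-1) ^ (j + 1) * (cschRegular (((2 * ((j : ℝ) + 1) : ℝ) : ℂ) * σ) /
          ((4 * ((j : ℝ) + 1) : ℝ) : ℂ))‖ = ‖cschRegular (((2 * ((j : ℝ) + 1) : ℝ) : ℂ) * σ) /
          ((4 * ((j : ℝ) + 1) : ℝ) : ℂ)‖ := by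
      intro j
      rw [norm_mul, norm_pow, norm_neg, norm_one, one_pow, one_mul]
    refine (norm_tsum_le_tsum_norm (by simp only [en]; exact s1)).trans ?_
    simp only [en]
    exact s2

/-- The shift turns cosh into sinh up to a fourth root of unity. The coefficient l is half of
Catalan's constant. -/
theorem norm_sechSum_sub_le_of_sub_pi_div_two {σ : ℂ} (h0 : 0 < σ.re) (h : ‖σ‖ ≤ 1 / 29) :
    ∃ l : ℝ, 0 ≤ l ∧ l ≤ 46 / 100 ∧ ‖sechSum (σ - Real.pi / 2 * I) - (l : ℂ) * I / σ‖ ≤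
      1 / 14 + 54 / 100 * (‖σ‖ / σ.re) := by
  have hs : Summable fun j : ℕ => (-1) ^ j * (1 / (2 * (2 * (j : ℝ) + 1) ^ 2)) := by
    refine Summable.of_norm_bounded (tsum_le_of_le_div_odd_sq
      (f := fun j : ℕ => 1 / (2 * (2 * (j : ℝ) + 1) ^ 2)) (fun j => by positivity)
      (B := 1 / 2) (by norm_num) le_rfl fun j => le_of_eq ?_).1 fun j => ?_
    · field_simp
    · rw [norm_mul, norm_pow, norm_neg, norm_one, one_pow, one_mul,
        Real.norm_of_nonneg (by positivity)]
  obtain ⟨hl0, hl1⟩ := catalan_half_le hs.hasSum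
  refine ⟨_, hl0, hl1, ?_⟩
  obtain ⟨s1, s2⟩ := tsum_norm_cschRegular_odd_le h0 h
  have h0' : 0 < (σ - Real.pi / 2 * I).re := by
    have : (σ - Real.pi / 2 * I).re = σ.re := by
      simp
    rwa [this]
  have h1 := (summable_sechTerm h0').hasSum.sub
    (((Complex.hasSum_ofReal.2 hs.hasSum).mul_right I).div_const σ)
  have e : (fun j : ℕ => sechTerm (σ - Real.pi / 2 * I) j -
      (((-1) ^ j * (1 / (2 * (2 * (j : ℝ) + 1) ^ 2)) : ℝ) : ℂ) * I / σ) = fun j : ℕ =>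
      (-1) ^ j * I * (cschRegular (((2 * (j : ℝ) + 1 : ℝ) : ℂ) * σ) /
        ((2 * (2 * (j : ℝ) + 1) : ℝ) : ℂ)) := by
    ext j
    have hj : (2 * (j : ℂ) + 1) ≠ 0 := by exact_mod_cast (by omega : 2 * j + 1 ≠ 0)
    have hσ : σ ≠ 0 := by rintro rfl; simp at h0
    rw [sechTerm_sub_pi_div_two, cschRegular, sub_div, mul_sub]
    congr 1
    push_cast
    field_simp
  rw [e] at h1
  change ‖∑' j, sechTerm (σ - Real.pi / 2 * I) j - _‖ ≤ _
  rw [← h1.tsum_eq]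
  have en : ∀ j : ℕ, ‖(-1) ^ j * I * (cschRegular (((2 * (j : ℝ) + 1 : ℝ) : ℂ) * σ) /
        ((2 * (2 * (j : ℝ) + 1) : ℝ) : ℂ))‖ = ‖cschRegular (((2 * (j : ℝ) + 1 : ℝ) : ℂ) * σ) /
        ((2 * (2 * (j : ℝ) + 1) : ℝ) : ℂ)‖ := by
    intro j
    rw [norm_mul, norm_mul, norm_I, norm_pow, norm_neg, norm_one, one_pow, one_mul, one_mul]
  refine (norm_tsum_le_tsum_norm (by simp only [en]; exact s1)).trans ?_
  simp only [en]
  exact s2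

theorem re_add_abs_re_le_near_I {σ : ℂ} (h0 : 0 < σ.re) (h : ‖σ‖ ≤ 1 / 29) :
    (cschSum (σ - Real.pi / 2 * I)).re + |(sechSum (σ - Real.pi / 2 * I)).re| ≤
      (46 / 100 * |σ.im| - 102 / 1000 * σ.re) / (σ.re ^ 2 + σ.im ^ 2)
      + (1 / 7 + 108 / 100 * (‖σ‖ / σ.re)) := by
  obtain ⟨c, hc, h1⟩ := norm_cschSum_sub_le_of_sub_pi_div_two h0 h
  obtain ⟨l, hl0, hl, h2⟩ := norm_sechSum_sub_le_of_sub_pi_div_two h0 h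
  have hp : 0 < σ.re ^ 2 + σ.im ^ 2 := by positivity
  have hns : normSq σ = σ.re ^ 2 + σ.im ^ 2 := by rw [normSq_apply]; ring
  have e1 : ((c : ℂ) / σ).re = c * σ.re / (σ.re ^ 2 + σ.im ^ 2) := by
    rw [div_re, hns]; simp
  have e2 : ((l : ℂ) * I / σ).re = l * σ.im / (σ.re ^ 2 + σ.im ^ 2) := by
    rw [div_re, hns]; simp
  have h3 := (le_abs_self _).trans ((abs_re_le_norm _).trans h1)
  have h4 := (abs_re_le_norm _).trans h2
  rw [sub_re, e1] at h3
  rw [sub_re, e2] at h4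
  have h5 := abs_sub_abs_le_abs_sub (sechSum (σ - Real.pi / 2 * I)).re
    (l * σ.im / (σ.re ^ 2 + σ.im ^ 2))
  have h6 : c * σ.re / (σ.re ^ 2 + σ.im ^ 2) + |l * σ.im / (σ.re ^ 2 + σ.im ^ 2)| ≤
      (46 / 100 * |σ.im| - 102 / 1000 * σ.re) / (σ.re ^ 2 + σ.im ^ 2) := by
    rw [abs_div, abs_of_pos hp, ← add_div, abs_mul, abs_of_nonneg hl0]
    gcongr
    have := abs_nonneg σ.im
    nlinarith
  linarith

/-! ### Comparison of log |G| with its peak along the arc 0 ≤ θ ≤ π/2. -/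

theorem pi_sq_div_ge : 2056 / 10000 ≤ Real.pi ^ 2 / 48 := by
  have := Real.pi_gt_d4
  nlinarith

/-- The logarithm of the generating function at `exp (-t)`. -/
noncomputable def logPeak (t : ℝ) : ℝ := (cschSum t).re + (sechSum t).re

theorem logPeak_ge {t : ℝ} (h0 : 0 < t) (h : t ≤ 1 / 493) :
    2056 / 10000 / t + 78 / 100 ≤ logPeak t := by
  have h1 := cschSum_ofReal_ge h0 h
  have h2 := sechSum_ofReal_ge h0 h
  have h3 : 2056 / 10000 / t ≤ Real.pi ^ 2 / 48 / t :=
    div_le_div_of_nonneg_right pi_sq_div_ge h0.le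
  rw [logPeak]
  linarith

/-- A/t bounds the principal part and Y bounds ‖σ‖/t for σ = t + iφ. The final constant comes from
1/7 - 78/100 ≤ -63/100. -/
theorem log_le_near_I {t φ : ℝ} (h0 : 0 < t) (h : t ≤ 1 / 493) (hφ0 : 0 ≤ φ)
    (hφ : φ ≤ 16 * t) {A : ℝ}
    (hA : 46 / 100 * φ - 102 / 1000 * t ≤ A * (t ^ 2 + φ ^ 2) / t) {Y : ℝ} (hY : 0 ≤ Y)
    (hφY : t ^ 2 + φ ^ 2 ≤ (Y * t) ^ 2) :
    (cschSum ⟨t, φ - Real.pi / 2⟩).re + |(sechSum ⟨t, φ - Real.pi / 2⟩).re| ≤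
      logPeak t - (2056 / 10000 - A) / t + (108 / 100 * Y - 63 / 100) := by
  have e : (⟨t, φ - Real.pi / 2⟩ : ℂ) = (⟨t, φ⟩ : ℂ) - Real.pi / 2 * I := by
    apply Complex.ext <;> simp
  have hn : ‖(⟨t, φ⟩ : ℂ)‖ ≤ Y * t := by
    rw [norm_def, normSq_mk]
    exact Real.sqrt_le_iff.2 ⟨by positivity, by linarith⟩
  have hn' : ‖(⟨t, φ⟩ : ℂ)‖ ≤ 1 / 29 := by
    rw [norm_def, normSq_mk]
    refine Real.sqrt_le_iff.2 ⟨by positivity, ?_⟩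
    nlinarith
  have h1 := re_add_abs_re_le_near_I (σ := ⟨t, φ⟩) h0 hn'
  rw [← e] at h1
  refine h1.trans ?_
  simp only
  have h2 := logPeak_ge h0 h
  have h3 : (46 / 100 * |φ| - 102 / 1000 * t) / (t ^ 2 + φ ^ 2) ≤ A / t := by
    rw [abs_of_nonneg hφ0, div_le_iff₀ (by positivity)]
    refine hA.trans (le_of_eq ?_)
    ring
  have h4 : ‖(⟨t, φ⟩ : ℂ)‖ / t ≤ Y := by
    rwa [div_le_iff₀ h0]
  rw [sub_div (2056 / 10000) A t]
  linarith

/-- The tightest comparison: (0.46y - 0.102)/(1 + y²), with y = φ/t, has maximum just below A =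
0.1848, which leaves a margin of 0.0208/t. -/
theorem log_le_near_I_inner {t θ : ℝ} (h0 : 0 < t) (h : t ≤ 1 / 493)
    (h1 : Real.pi / 2 - 3 * t ≤ θ) (h2 : θ ≤ Real.pi / 2) :
    (cschSum ⟨t, -θ⟩).re + |(sechSum ⟨t, -θ⟩).re| ≤ logPeak t - 208 / 10000 / t + 282 / 100 := by
  have := log_le_near_I (φ := Real.pi / 2 - θ) h0 h (by linarith) (by linarith)
    (A := 1848 / 10000) (Y := 319 / 100) (by
      rw [le_div_iff₀ h0]
      -- The square is centred at the vertex φ = 0.46 t/(2A) of the quadratic.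
      nlinarith [sq_nonneg ((Real.pi / 2 - θ) - 46 / 100 / (2 * 1848 / 10000) * t)]) (by norm_num)
    (by nlinarith)
  rw [show Real.pi / 2 - θ - Real.pi / 2 = -θ by ring] at this
  refine this.trans ?_
  norm_num

/-- For φ ≥ 3t the same quotient is at most 0.128, and Y = 17 covers √(1 + 16²). -/
theorem log_le_near_I_outer {t θ : ℝ} (h0 : 0 < t) (h : t ≤ 1 / 493)
    (h1 : Real.pi / 2 - 16 * t ≤ θ) (h2 : θ ≤ Real.pi / 2 - 3 * t) :
    (cschSum ⟨t, -θ⟩).re + |(sechSum ⟨t, -θ⟩).re| ≤ logPeak t - 776 / 10000 / t + 18 := by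
  have := log_le_near_I (φ := Real.pi / 2 - θ) h0 h (by linarith) (by linarith)
    (A := 128 / 1000) (Y := 17) (by
      rw [le_div_iff₀ h0]
      nlinarith) (by norm_num)
    (by nlinarith)
  rw [show Real.pi / 2 - θ - Real.pi / 2 = -θ by ring] at this
  refine this.trans ?_
  norm_num

/-- Gives no decay; it serves the crude coefficient bound `abs_coeff_G_lt`. -/
theorem log_le_of_le_two_mul {t θ : ℝ} (h0 : 0 < t) (h : t ≤ 1 / 493) (hθ0 : 0 ≤ θ)
    (hθ : θ ≤ 2 * t) :
    (cschSum ⟨t, -θ⟩).re + |(sechSum ⟨t, -θ⟩).re| ≤ logPeak t + 1 / 200 / t := by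
  have h1 := cschSum_re_le (τ := ⟨t, -θ⟩) h0
  have h2 := abs_re_sechSum_le_of_abs_im_le (τ := ⟨t, -θ⟩) h0 h (by
    simp only [abs_neg]; rwa [abs_of_nonneg hθ0])
  have h3 := sechSum_ofReal_ge h0 h
  simp only [logPeak] at *
  linarith

/-- From sin 2θ ≥ sin t ≈ t the first term loses a fraction of about 1/5, the limit of s²/(s² +
(2t)²) with s = t. -/
theorem log_le_mid₁ {t θ : ℝ} (h0 : 0 < t) (h : t ≤ 1 / 493) (hθ0 : t / 2 ≤ θ)
    (hθ : θ ≤ 2 * t) :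
    (cschSum ⟨t, -θ⟩).re + |(sechSum ⟨t, -θ⟩).re| ≤ logPeak t - 198 / 10000 / t := by
  have hsin : 9999 / 10000 * t ≤ Real.sin (2 * θ) := by
    have h1 := Real.sin_gt_sub_cube h0
    have h2 : Real.sin t ≤ Real.sin (2 * θ) := by
      apply Real.sin_le_sin_of_le_of_le_pi_div_two <;> linarith [Real.pi_gt_three]
    have h3 : t ^ 2 ≤ (1 / 493) ^ 2 := by gcongr
    nlinarith
  have h1 := cschSum_re_le_of_sin (τ := ⟨t, -θ⟩) h0 h (c := 199 / 1000) (by norm_num) (by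
    simp only [mul_neg, Real.sin_neg, neg_sq]
    have := pow_le_pow_left₀ (by positivity) hsin 2
    nlinarith)
  have h2 := abs_re_sechSum_le_of_abs_im_le (τ := ⟨t, -θ⟩) h0 h (by
    simp only [abs_neg]; rwa [abs_of_nonneg (by linarith)])
  have h3 := sechSum_ofReal_ge h0 h
  have h4 : 198 / 10000 / t + 1 / 200 / t ≤ 199 / 1000 * (1249 / 10000 / t) := by
    rw [← add_div, ← mul_div_assoc]
    gcongr
    norm_num
  simp only [logPeak] at *
  linarith

theorem log_le_mid₂ {t θ : ℝ} (h0 : 0 < t) (h : t ≤ 1 / 493) (hθ0 : 2 * t ≤ θ)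
    (hθ : θ ≤ Real.pi / 4) :
    (cschSum ⟨t, -θ⟩).re + |(sechSum ⟨t, -θ⟩).re| ≤ logPeak t - 373 / 10000 / t := by
  have hsin : 3999 / 1000 * t ≤ Real.sin (2 * θ) := by
    have h1 := Real.sin_gt_sub_cube (x := 4 * t) (by linarith)
    have h2 : Real.sin (4 * t) ≤ Real.sin (2 * θ) := by
      apply Real.sin_le_sin_of_le_of_le_pi_div_two <;> linarith [Real.pi_gt_three]
    have h3 : t ^ 2 ≤ (1 / 493) ^ 2 := by gcongr
    nlinarith
  have h1 := cschSum_re_le_of_sin (τ := ⟨t, -θ⟩) h0 h (c := 79 / 100) (by norm_num) (by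
    simp only [mul_neg, Real.sin_neg, neg_sq]
    have := pow_le_pow_left₀ (by positivity) hsin 2
    nlinarith)
  have hcos : 7 / 10 ≤ Real.cos (-θ) := by
    rw [Real.cos_neg]
    have h2 : Real.cos (Real.pi / 4) ≤ Real.cos θ := by
      apply Real.cos_le_cos_of_nonneg_of_le_pi <;> linarith [Real.pi_gt_three]
    rw [Real.cos_pi_div_four] at h2
    have h3 : (7 / 10 : ℝ) * 2 ≤ √2 := Real.le_sqrt_of_sq_le (by norm_num)
    linarith
  have h2 := abs_re_sechSum_le_of_cos (τ := ⟨t, -θ⟩) h0 h (by simp only; linarith)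
  have h3 := sechSum_ofReal_ge h0 h
  have h4 : 373 / 10000 / t + 613 / 10000 / t ≤ 79 / 100 * (1249 / 10000 / t) := by
    rw [← add_div, ← mul_div_assoc]
    gcongr
    norm_num
  have h5 : 1 / (2 * |Real.cos (-θ)|) ≤ 14 / 10 := by
    rw [abs_of_pos (by linarith), div_le_iff₀ (by linarith)]
    linarith
  simp only [logPeak] at *
  linarith

/-- Since cos 2θ ≤ 0, the gain is 0.1249/t. It must pay 0.0613/t for the tail of S and 1/(2 cos θ) ≤
0.0313/t for its first term, which is why the arc stops 16t before π/2. -/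
theorem log_le_mid₃ {t θ : ℝ} (h0 : 0 < t) (h : t ≤ 1 / 493) (hθ0 : Real.pi / 4 ≤ θ)
    (hθ : θ ≤ Real.pi / 2 - 16 * t) :
    (cschSum ⟨t, -θ⟩).re + |(sechSum ⟨t, -θ⟩).re| ≤ logPeak t - 322 / 10000 / t := by
  have h1 := cschSum_re_le_of_cos (τ := ⟨t, -θ⟩) h0 h (by
    simp only [mul_neg, Real.cos_neg]
    apply Real.cos_nonpos_of_pi_div_two_le_of_le <;> linarith)
  have hcos : 1598 / 100 * t ≤ Real.cos (-θ) := by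
    rw [Real.cos_neg, ← Real.sin_pi_div_two_sub]
    have h1 := Real.sin_gt_sub_cube (x := 16 * t) (by linarith)
    have h2 : Real.sin (16 * t) ≤ Real.sin (Real.pi / 2 - θ) := by
      apply Real.sin_le_sin_of_le_of_le_pi_div_two <;> linarith [Real.pi_gt_three]
    have h3 : t ^ 2 ≤ (1 / 493) ^ 2 := by gcongr
    nlinarith
  have hpos : 0 < Real.cos (-θ) := by nlinarith
  have h2 := abs_re_sechSum_le_of_cos (τ := ⟨t, -θ⟩) h0 h (by simp only; exact hpos.ne')
  have h3 := sechSum_ofReal_ge h0 h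
  have h5 : 1 / (2 * |Real.cos (-θ)|) ≤ 313 / 10000 / t := by
    rw [abs_of_pos hpos, div_le_div_iff₀ (by positivity) h0]
    linarith
  have h4 : 322 / 10000 / t + 613 / 10000 / t + 313 / 10000 / t ≤ 1249 / 10000 / t := by
    rw [← add_div, ← add_div]
    gcongr
    norm_num
  simp only [logPeak] at *
  linarith

end CollMayersMayers

namespace CollMayersMayers

open PowerSeries Filter Topology

/-! ### The generating function at `exp (-τ)` -/

theorem exp_neg_pow_div (τ : ℂ) (n : ℕ) :
    Complex.exp (-τ) ^ n / (n * (1 - Complex.exp (-τ) ^ (2 * n))) =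
      (Complex.sinh (n * τ))⁻¹ / (2 * n) := by
  have h1 : Complex.exp (-τ) ^ n = Complex.exp (-(n * τ)) := by
    rw [← Complex.exp_nat_mul]; ring_nf
  have h2 : 1 - Complex.exp (-τ) ^ (2 * n) =
      2 * Complex.exp (-(n * τ)) * Complex.sinh (n * τ) := by
    have h3 : Complex.exp (-(n * τ)) * Complex.exp (n * τ) = 1 := by
      rw [← Complex.exp_add, neg_add_cancel, Complex.exp_zero]
    rw [mul_comm 2 n, pow_mul, h1, Complex.sinh]
    linear_combination -h3
  rw [h2, h1]
  have := Complex.exp_ne_zero (-(n * τ))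
  by_cases hs : Complex.sinh (n * τ) = 0
  · simp [hs]
  rcases Nat.eq_zero_or_pos n with rfl | hn
  · simp
  have hn' : (n : ℂ) ≠ 0 := by exact_mod_cast hn.ne'
  field_simp

theorem exp_neg_pow_div' (τ : ℂ) (n : ℕ) :
    Complex.exp (-τ) ^ n / (n * (1 + Complex.exp (-τ) ^ (2 * n))) =
      (Complex.cosh (n * τ))⁻¹ / (2 * n) := by
  have h1 : Complex.exp (-τ) ^ n = Complex.exp (-(n * τ)) := by
    rw [← Complex.exp_nat_mul]; ring_nf
  have h2 : 1 + Complex.exp (-τ) ^ (2 * n) =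
      2 * Complex.exp (-(n * τ)) * Complex.cosh (n * τ) := by
    have h3 : Complex.exp (-(n * τ)) * Complex.exp (n * τ) = 1 := by
      rw [← Complex.exp_add, neg_add_cancel, Complex.exp_zero]
    rw [mul_comm 2 n, pow_mul, h1, Complex.cosh]
    linear_combination -h3
  rw [h2, h1]
  have := Complex.exp_ne_zero (-(n * τ))
  by_cases hs : Complex.cosh (n * τ) = 0
  · simp [hs]
  rcases Nat.eq_zero_or_pos n with rfl | hn
  · simp
  have hn' : (n : ℂ) ≠ 0 := by exact_mod_cast hn.ne'
  field_simp

theorem logTerm_even (τ : ℂ) (j : ℕ) :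
    logTerm (Complex.exp (-τ)) (2 * (j + 1)) = cschTerm τ j := by
  have h1 : ((-1 : ℂ)) ^ (2 * (j + 1)) = 1 := by rw [pow_mul]; simp
  rw [logTerm, h1, one_mul, exp_neg_pow_div, cschTerm]
  push_cast
  congr 1
  ring

theorem logTerm_odd (τ : ℂ) (j : ℕ) :
    logTerm (Complex.exp (-τ)) (2 * j + 1) = sechTerm τ j := by
  have h1 : ((-1 : ℂ)) ^ (2 * j + 1) = -1 := by rw [pow_succ, pow_mul]; simp
  rw [logTerm, h1, neg_one_mul, sub_neg_eq_add, exp_neg_pow_div', sechTerm]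
  push_cast
  rfl

theorem logTerm_neg_even (q : ℂ) (j : ℕ) : logTerm (-q) (2 * j) = logTerm q (2 * j) := by
  rw [logTerm, logTerm, (even_two_mul j).neg_pow q, (even_two_mul (2 * j)).neg_pow q]

theorem logTerm_neg_odd (q : ℂ) (j : ℕ) : logTerm (-q) (2 * j + 1) = -logTerm q (2 * j + 1) := by
  rw [logTerm, logTerm, (even_two_mul (2 * j + 1)).neg_pow q, (odd_two_mul_add_one j).neg_pow q,
    neg_div]

theorem norm_exp_neg_lt_one {τ : ℂ} (h : 0 < τ.re) : ‖Complex.exp (-τ)‖ < 1 := by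
  rw [Complex.norm_exp, Real.exp_lt_one_iff]
  simpa using h

theorem tsum_logTerm {τ : ℂ} (h : 0 < τ.re) :
    ∑' n, logTerm (Complex.exp (-τ)) n = cschSum τ + sechSum τ ∧
      ∑' n, logTerm (-Complex.exp (-τ)) n = cschSum τ - sechSum τ := by
  have h0 : ∀ q, logTerm q (2 * 0) = 0 := fun q => by simp [logTerm]
  have e1 : HasSum (fun j => logTerm (Complex.exp (-τ)) (2 * j)) (cschSum τ) := by
    rw [← hasSum_nat_add_iff' 1]
    simp only [Finset.sum_range_one, h0, sub_zero, logTerm_even]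
    exact (summable_cschTerm h).hasSum
  have e2 : HasSum (fun j => logTerm (Complex.exp (-τ)) (2 * j + 1)) (sechSum τ) := by
    simp only [logTerm_odd]
    exact (summable_sechTerm h).hasSum
  refine ⟨(e1.even_add_odd e2).tsum_eq, ?_⟩
  rw [sub_eq_add_neg]
  refine (HasSum.even_add_odd ?_ ?_).tsum_eq
  · simpa only [logTerm_neg_even] using e1
  · simpa only [logTerm_neg_odd] using e2.neg

theorem evalAt_G_exp {τ : ℂ} (h : 0 < τ.re) :
    evalAt (Complex.exp (-τ)) G = Complex.exp (cschSum τ + sechSum τ) := by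
  rw [evalAt_G_eq_exp (norm_exp_neg_lt_one h), (tsum_logTerm h).1]

theorem evalAt_G_neg_exp {τ : ℂ} (h : 0 < τ.re) :
    evalAt (-Complex.exp (-τ)) G = Complex.exp (cschSum τ - sechSum τ) := by
  rw [evalAt_G_eq_exp (by rw [norm_neg]; exact norm_exp_neg_lt_one h), (tsum_logTerm h).2]

/-! ### Coefficients as integrals -/

theorem continuous_evalAt_G {r : ℝ} (hr0 : 0 ≤ r) (hr : r < 1) {f : ℝ → ℂ} (hf : Continuous f)
    (hfr : ∀ x, ‖f x‖ = r) : Continuous fun x => evalAt (f x) G := by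
  refine continuous_tsum (fun n => by fun_prop) (summableAt_G hr0 hr) fun n x => ?_
  rw [norm_mul, norm_pow, hfr, Complex.norm_intCast]

theorem integral_cos_two_mul (d : ℤ) :
    ∫ θ in (0 : ℝ)..Real.pi / 2, 2 * Real.cos (2 * d * θ) = if d = 0 then Real.pi else 0 := by
  split_ifs with hd
  · subst hd
    simp
  · have hd' : (2 * d : ℝ) ≠ 0 := by exact_mod_cast mul_ne_zero two_ne_zero hd
    rw [intervalIntegral.integral_const_mul,
      intervalIntegral.integral_comp_mul_left (fun x => Real.cos x) hd', integral_cos,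
      show 2 * (d : ℝ) * (Real.pi / 2) = d * Real.pi by ring, Real.sin_int_mul_pi]
    simp

/-- The integrand in the formula for the `n`-th coefficient of `G`. -/
noncomputable def coeffIntegrand (t : ℝ) (n : ℕ) (θ : ℝ) : ℝ :=
  ((evalAt (Complex.exp (-⟨t, -θ⟩)) G + (-1) ^ n * evalAt (-Complex.exp (-⟨t, -θ⟩)) G) *
    Complex.exp (-(n * θ * Complex.I))).re

theorem mk_eq (t θ : ℝ) : (⟨t, -θ⟩ : ℂ) = t - θ * Complex.I := by
  apply Complex.ext <;> simp

theorem norm_exp_neg_mk (t θ : ℝ) : ‖Complex.exp (-⟨t, -θ⟩)‖ = Real.exp (-t) := by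
  rw [Complex.norm_exp]; simp

theorem continuous_coeffIntegrand {t : ℝ} (ht : 0 < t) (n : ℕ) :
    Continuous (coeffIntegrand t n) := by
  have h1 : Real.exp (-t) < 1 := Real.exp_lt_one_iff.mpr (by linarith)
  have h2 : Continuous fun θ : ℝ => Complex.exp (-⟨t, -θ⟩) := by
    simp only [mk_eq]; fun_prop
  have h3 := continuous_evalAt_G (Real.exp_pos _).le h1 h2 (norm_exp_neg_mk t)
  have h4 := continuous_evalAt_G (Real.exp_pos _).le h1 h2.neg (fun x => by
    rw [Pi.neg_apply, norm_neg]; exact norm_exp_neg_mk t x)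
  unfold coeffIntegrand
  fun_prop

/-- Adding (-1)^n G(-q) removes the coefficients whose index m has the wrong parity. For the others
m - n is even, so cos((m-n)θ) already integrates to 0 over a quarter circle unless m = n. -/
theorem integral_coeffIntegrand {t : ℝ} (ht : 0 < t) (n : ℕ) :
    ∫ θ in (0 : ℝ)..Real.pi / 2, coeffIntegrand t n θ =
      Real.pi * (coeff n G : ℤ) * Real.exp (-(n * t)) := by
  have h1 : Real.exp (-t) < 1 := Real.exp_lt_one_iff.mpr (by linarith)
  have hs := summableAt_G (Real.exp_pos _).le h1
  have hsum : ∀ θ : ℝ, HasSum (fun m : ℕ => ((coeff m G : ℤ) : ℝ) * Real.exp (-(m * t)) *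
      ((1 + (-1) ^ (n + m)) * Real.cos (((m : ℤ) - (n : ℤ) : ℤ) * θ))) (coeffIntegrand t n θ) := by
    intro θ
    have a1 := (hs.summable_norm (norm_exp_neg_mk t θ)).of_norm.hasSum
    have a2 := (hs.summable_norm (q := -Complex.exp (-⟨t, -θ⟩))
      (by rw [norm_neg]; exact norm_exp_neg_mk t θ)).of_norm.hasSum
    have a3 := ((a1.add (a2.mul_left ((-1) ^ n))).mul_right
      (Complex.exp (-(n * θ * Complex.I))))
    have a4 := Complex.hasSum_re a3
    convert a4 using 1
    swap
    · rfl
    funext m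
    have e1 : Complex.exp (-⟨t, -θ⟩) ^ m * Complex.exp (-(n * θ * Complex.I)) =
        (Real.exp (-(m * t)) : ℂ) * Complex.exp (((((m : ℤ) - (n : ℤ) : ℤ) * θ : ℝ) : ℂ) *
          Complex.I) := by
      rw [← Complex.exp_nat_mul, ← Complex.exp_add, Complex.ofReal_exp, ← Complex.exp_add, mk_eq]
      congr 1
      push_cast
      ring
    have e2 : (((coeff m G : ℤ) : ℂ) * Complex.exp (-⟨t, -θ⟩) ^ m +
        (-1) ^ n * (((coeff m G : ℤ) : ℂ) * (-Complex.exp (-⟨t, -θ⟩)) ^ m)) *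
        Complex.exp (-(n * θ * Complex.I)) =
        ((((coeff m G : ℤ) : ℝ) * Real.exp (-(m * t)) * (1 + (-1) ^ (n + m)) : ℝ) : ℂ) *
        Complex.exp (((((m : ℤ) - (n : ℤ) : ℤ) * θ : ℝ) : ℂ) * Complex.I) := by
      rw [neg_pow (Complex.exp _) m]
      push_cast at e1 ⊢
      linear_combination ((coeff m G : ℤ) : ℂ) * (1 + (-1) ^ (n + m)) * e1
    rw [e2, Complex.re_ofReal_mul, Complex.exp_ofReal_mul_I_re]
    ring
  have key := intervalIntegral.hasSum_integral_of_dominated_convergence (a := 0)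
    (b := Real.pi / 2) (μ := MeasureTheory.volume)
    (F := fun m θ => ((coeff m G : ℤ) : ℝ) * Real.exp (-(m * t)) *
      ((1 + (-1) ^ (n + m)) * Real.cos (((m : ℤ) - (n : ℤ) : ℤ) * θ)))
    (f := coeffIntegrand t n) (fun m _ => 2 * (|((coeff m G : ℤ) : ℝ)| * Real.exp (-t) ^ m))
    (fun m => Continuous.aestronglyMeasurable (by fun_prop))
    (fun m => Eventually.of_forall fun θ _ => by
      rw [norm_mul, norm_mul, norm_mul, ← Real.exp_nat_mul, mul_comm (m : ℝ) (-t), neg_mul,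
        mul_comm t, Real.norm_eq_abs, Real.norm_of_nonneg (Real.exp_pos _).le, mul_comm 2]
      refine mul_le_mul_of_nonneg_left ?_ (by positivity)
      have b1 : ‖(1 : ℝ) + (-1) ^ (n + m)‖ ≤ 2 := by
        refine (norm_add_le _ _).trans ?_
        rw [norm_pow, norm_neg, norm_one, one_pow]; norm_num
      have b2 : ‖Real.cos (((m : ℤ) - (n : ℤ) : ℤ) * θ)‖ ≤ 1 := Real.abs_cos_le_one _
      calc _ ≤ 2 * 1 := mul_le_mul b1 b2 (norm_nonneg _) (by norm_num)
        _ = 2 := by norm_num)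
    (Eventually.of_forall fun θ _ => hs.mul_left 2)
    (by simp) (Eventually.of_forall fun θ _ => hsum θ)
  rw [← key.tsum_eq, tsum_eq_single n]
  · rw [intervalIntegral.integral_const_mul]
    simp only [sub_self, Int.cast_zero, zero_mul, Real.cos_zero, mul_one, ← two_mul, pow_mul]
    simp
    ring
  · intro m hm
    rw [intervalIntegral.integral_const_mul]
    rcases Nat.even_or_odd (n + m) with he | ho
    · have hd : ∃ d : ℤ, (m : ℤ) - n = 2 * d ∧ d ≠ 0 := by
        obtain ⟨c, hc⟩ := he
        exact ⟨m - c, by omega, by omega⟩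
      obtain ⟨d, hd1, hd2⟩ := hd
      have := integral_cos_two_mul d
      rw [if_neg hd2] at this
      rw [hd1, he.neg_one_pow]
      push_cast
      norm_num
      norm_num at this
      exact Or.inr this
    · rw [ho.neg_one_pow]
      simp

end CollMayersMayers

namespace CollMayersMayers

open PowerSeries

/-! ### The integrand near the positive real axis -/

theorem cschTerm_ofReal (t : ℝ) (j : ℕ) :
    cschTerm t j = (((Real.sinh (2 * ((j : ℝ) + 1) * t))⁻¹ / (4 * ((j : ℝ) + 1)) : ℝ) : ℂ) := by
  rw [cschTerm]
  push_cast
  rfl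

theorem sechTerm_ofReal (t : ℝ) (j : ℕ) :
    sechTerm t j = (((Real.cosh ((2 * (j : ℝ) + 1) * t))⁻¹ / (2 * (2 * (j : ℝ) + 1)) : ℝ) : ℂ) := by
  rw [sechTerm]
  push_cast
  rfl

theorem logPeak_ofReal (t : ℝ) : (logPeak t : ℂ) = cschSum t + sechSum t := by
  have h1 : (((cschSum t).re : ℝ) : ℂ) = cschSum t := by
    simp only [cschSum, cschTerm_ofReal]
    rw [← Complex.ofReal_tsum, Complex.ofReal_re]
  have h2 : (((sechSum t).re : ℝ) : ℂ) = sechSum t := by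
    simp only [sechSum, sechTerm_ofReal]
    rw [← Complex.ofReal_tsum, Complex.ofReal_re]
  rw [logPeak, Complex.ofReal_add, h1, h2]

theorem coeffIntegrand_eq {t : ℝ} (ht : 0 < t) (n : ℕ) (θ : ℝ) :
    coeffIntegrand t n θ =
      (Complex.exp (cschSum ⟨t, -θ⟩ + sechSum ⟨t, -θ⟩ - n * θ * Complex.I)).re +
      (-1) ^ n * (Complex.exp (cschSum ⟨t, -θ⟩ - sechSum ⟨t, -θ⟩ - n * θ * Complex.I)).re := by
  have h : 0 < (⟨t, -θ⟩ : ℂ).re := ht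
  rw [coeffIntegrand, evalAt_G_exp h, evalAt_G_neg_exp h, sub_eq_add_neg _ (n * θ * Complex.I),
    sub_eq_add_neg _ (n * θ * Complex.I), Complex.exp_add (_ + _), Complex.exp_add (_ - _), add_mul,
    Complex.add_re]
  congr 1
  rcases Nat.even_or_odd n with hn | hn <;> simp [hn.neg_one_pow]

theorem abs_coeffIntegrand_le {t : ℝ} (ht : 0 < t) (n : ℕ) (θ : ℝ) :
    |coeffIntegrand t n θ| ≤
      2 * Real.exp ((cschSum ⟨t, -θ⟩).re + |(sechSum ⟨t, -θ⟩).re|) := by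
  rw [coeffIntegrand_eq ht]
  refine (abs_add_le _ _).trans ?_
  rw [abs_mul, abs_pow, abs_neg, abs_one, one_pow, one_mul, two_mul]
  refine add_le_add ?_ ?_ <;>
  · refine (Complex.abs_re_le_norm _).trans ?_
    rw [Complex.norm_exp]
    refine Real.exp_le_exp.2 ?_
    simp
    linarith [le_abs_self (sechSum ⟨t, -θ⟩).re, neg_abs_le (sechSum ⟨t, -θ⟩).re]

/-- Lower bound for the integrand close to the positive real axis. -/
theorem coeffIntegrand_ge_of_le_half {t : ℝ} (h0 : 0 < t) (h : t ≤ 1 / 493) {n : ℕ}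
    (hn : n * t ^ 2 = Real.pi ^ 2 / 48) {y : ℝ} (hy0 : 0 ≤ y) (hy : y ≤ 1 / 2) :
    ∃ x φ : ℝ, |x + n * t * (y ^ 2 / (1 + y ^ 2))| ≤ 12 / 5 * y ∧
      |φ| ≤ n * t * y ^ 3 + 12 / 5 * y ∧
      Real.exp (logPeak t) * (Real.exp x * (Real.cos φ - 1 / 5)) ≤
        coeffIntegrand t n (t * y) := by
  set τ : ℂ := ⟨t, -(t * y)⟩ with hτ
  have hre : τ.re = t := rfl
  have him : |τ.im| = t * y := by
    change |-(t * y)| = _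
    rw [abs_neg, abs_of_nonneg (by positivity)]
  have hdiv : |τ.im| / τ.re = y := by rw [him, hre]; field_simp
  have hτ0 : 0 < τ.re := h0
  have hle : |τ.im| ≤ τ.re / 2 := by rw [him, hre]; nlinarith
  have b1 := norm_cschSum_sub_le hτ0 h hle
  have b2 := norm_sechSum_sub_le hτ0 h hle
  rw [hdiv, hre] at b1 b2
  set A : ℝ := Real.pi ^ 2 / 48 with hA
  set E : ℂ := (cschSum τ - (A : ℂ) / τ) - (cschSum t - (A : ℂ) / (t : ℂ)) +
    (sechSum τ - sechSum t) with hE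
  have bE : ‖E‖ ≤ 12 / 5 * y := (norm_add_le _ _).trans (by linarith)
  have hy1 : (0 : ℝ) < 1 + y ^ 2 := by positivity
  -- With A = n t² the linear terms in y cancel: t is the saddle point, and only a quadratic real
  -- part and a cubic phase remain.
  have hz : (A : ℂ) / τ - A / t - n * (t * y : ℝ) * Complex.I =
      ((-(n * t * (y ^ 2 / (1 + y ^ 2))) : ℝ) : ℂ) +
        ((-(n * t * (y ^ 3 / (1 + y ^ 2))) : ℝ) : ℂ) * Complex.I := by
    have e1 : τ = t * (1 - y * Complex.I) := by
      apply Complex.ext <;> simp [hτ]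
    have e2 : (1 - y * Complex.I) * (1 + y * Complex.I) = ((1 + y ^ 2 : ℝ) : ℂ) := by
      push_cast
      linear_combination -(y : ℂ) ^ 2 * Complex.I_sq
    have e3 : ((1 + y ^ 2 : ℝ) : ℂ) ≠ 0 := by exact_mod_cast hy1.ne'
    have e4 : (1 - y * Complex.I) ≠ 0 := by
      intro h; rw [h, zero_mul] at e2; exact e3 e2.symm
    have e5 : (t : ℂ) ≠ 0 := by exact_mod_cast h0.ne'
    have e6 : (1 - y * Complex.I)⁻¹ = (1 + y * Complex.I) / ((1 + y ^ 2 : ℝ) : ℂ) := by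
      rw [← e2]
      have : (1 + y * Complex.I) ≠ 0 := by
        intro h; rw [h, mul_zero] at e2; exact e3 e2.symm
      field_simp
    rw [e1, ← hn, div_eq_mul_inv, mul_inv, e6]
    push_cast at e3 ⊢
    field_simp
    ring_nf
  set W : ℂ := cschSum τ + sechSum τ - n * (t * y : ℝ) * Complex.I with hW
  have hWE : W = (logPeak t : ℂ) + (((-(n * t * (y ^ 2 / (1 + y ^ 2))) : ℝ) : ℂ) +
        ((-(n * t * (y ^ 3 / (1 + y ^ 2))) : ℝ) : ℂ) * Complex.I) + E := by
    rw [← hz, logPeak_ofReal, hW, hE]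
    ring
  have hWre : W.re = logPeak t + -(n * t * (y ^ 2 / (1 + y ^ 2))) + E.re := by
    rw [hWE, Complex.add_re, Complex.add_re, Complex.add_re, Complex.ofReal_re, Complex.ofReal_re,
      Complex.re_ofReal_mul, Complex.I_re, mul_zero, add_zero]
  have hWim : W.im = -(n * t * (y ^ 3 / (1 + y ^ 2))) + E.im := by
    rw [hWE, Complex.add_im, Complex.add_im, Complex.add_im, Complex.ofReal_im, Complex.ofReal_im,
      Complex.im_ofReal_mul, Complex.I_im, mul_one, zero_add, zero_add]
  refine ⟨W.re - logPeak t, W.im, ?_, ?_, ?_⟩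
  · rw [hWre]
    ring_nf
    have := (Complex.abs_re_le_norm E).trans bE
    linarith
  · rw [hWim]
    refine (abs_add_le _ _).trans (add_le_add ?_ ((Complex.abs_im_le_norm E).trans bE))
    rw [abs_neg, abs_of_nonneg (by positivity)]
    refine mul_le_mul_of_nonneg_left (div_le_self (by positivity) (by nlinarith)) (by positivity)
  · rw [coeffIntegrand_eq h0]
    -- The value is 1.4 - 1/2. The contribution of -q is thus smaller by a factor e^(-9/5) ≤ 1/5 and
    -- cannot spoil the sign.
    have hs : 9 / 10 ≤ (sechSum τ).re := by
      have h1 := sechSum_ofReal_ge h0 h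
      have h2 := (Complex.abs_re_le_norm _).trans b2
      rw [Complex.sub_re] at h2
      linarith [neg_abs_le ((sechSum τ).re - (sechSum t).re)]
    have hsec : |(Complex.exp (cschSum τ - sechSum τ - n * (t * y : ℝ) * Complex.I)).re| ≤
        Real.exp W.re * (1 / 5) := by
      refine (Complex.abs_re_le_norm _).trans ?_
      rw [Complex.norm_exp]
      have h1 : Real.exp (-(9 / 5)) ≤ 1 / 5 := by
        rw [Real.exp_neg, inv_le_comm₀ (Real.exp_pos _) (by norm_num)]
        have := Real.quadratic_le_exp_of_nonneg (x := 9 / 5) (by norm_num)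
        have h2 : Real.exp (9 / 5) = Real.exp (9/10) * Real.exp (9/10) := by
          rw [← Real.exp_add]; norm_num
        have h3 := Real.quadratic_le_exp_of_nonneg (x := 9 / 10) (by norm_num)
        rw [h2]
        nlinarith
      refine le_trans ?_ (mul_le_mul_of_nonneg_left h1 (Real.exp_pos _).le)
      rw [← Real.exp_add]
      refine Real.exp_le_exp.2 ?_
      rw [hW]
      simp only [Complex.sub_re, Complex.add_re]
      linarith
    have hfst : (Complex.exp W).re = Real.exp W.re * Real.cos W.im := Complex.exp_re W
    have hexp : Real.exp (logPeak t) * Real.exp (W.re - logPeak t) = Real.exp W.re := by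
      rw [← Real.exp_add]; ring_nf
    rw [← mul_assoc, hexp, mul_sub, ← hfst]
    have hsgn : |(-1 : ℝ) ^ n * (Complex.exp (cschSum τ - sechSum τ -
        n * (t * y : ℝ) * Complex.I)).re| ≤ Real.exp W.re * (1 / 5) := by
      rw [abs_mul, abs_pow, abs_neg, abs_one, one_pow, one_mul]
      exact hsec
    linarith [neg_abs_le ((-1 : ℝ) ^ n * (Complex.exp (cschSum τ - sechSum τ -
        n * (t * y : ℝ) * Complex.I)).re)]

end CollMayersMayers

namespace CollMayersMayers

open PowerSeries

/-! ### Positivity of the large coefficients -/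

section MainArc

variable {t : ℝ} (h0 : 0 < t) (h : t ≤ 1 / 493) {n : ℕ} (hn : n * t ^ 2 = Real.pi ^ 2 / 48)
  {ε : ℝ} (hε0 : 0 < ε) (hε : ε ≤ 1 / 10) (hnε : n * t * ε ^ 2 = 1)

include h0 h hn hε0 hε hnε

/-- The scale y = εu makes the quadratic exponent u². Then exp x ≥ 1 + x gives the polynomial, and
|φ| ≤ 0.34 gives cos φ - 1/5 ≥ 0.74. -/
theorem coeffIntegrand_ge_polynomial {u : ℝ} (hu0 : 0 ≤ u) (hu : u ≤ 1) :
    Real.exp (logPeak t) * (74 / 100 * (1 - u ^ 2 - 24 / 100 * u)) ≤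
      coeffIntegrand t n (t * (ε * u)) := by
  obtain ⟨x, φ, hx, hφ, hle⟩ := coeffIntegrand_ge_of_le_half h0 h hn (y := ε * u) (by positivity)
    (by nlinarith)
  refine le_trans (mul_le_mul_of_nonneg_left ?_ (Real.exp_pos _).le) hle
  have hnt : 0 ≤ n * t := by positivity
  have h1 : n * t * ((ε * u) ^ 2 / (1 + (ε * u) ^ 2)) ≤ u ^ 2 := by
    have : (ε * u) ^ 2 / (1 + (ε * u) ^ 2) ≤ (ε * u) ^ 2 :=
      div_le_self (by positivity) (by nlinarith [sq_nonneg (ε * u)])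
    refine (mul_le_mul_of_nonneg_left this hnt).trans (le_of_eq ?_)
    linear_combination u ^ 2 * hnε
  have h2 : 1 - u ^ 2 - 24 / 100 * u ≤ Real.exp x := by
    have := Real.add_one_le_exp x
    have := (abs_le.1 hx).1
    nlinarith
  have h3 : n * t * (ε * u) ^ 3 = ε * u ^ 3 := by linear_combination ε * u ^ 3 * hnε
  have h4 : |φ| ≤ 34 / 100 := by
    rw [h3] at hφ
    have : u ^ 3 ≤ 1 := pow_le_one₀ hu0 hu
    nlinarith [mul_le_mul hε this (by positivity) (by norm_num)]
  have h5 : 94 / 100 ≤ Real.cos φ := by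
    have := Real.one_sub_sq_div_two_le_cos (x := φ)
    have : φ ^ 2 ≤ (34 / 100) ^ 2 := sq_le_sq' (by linarith [(abs_le.1 h4).1]) (abs_le.1 h4).2
    linarith
  nlinarith [Real.exp_pos x]

theorem coeffIntegrand_nonneg_of_le {u : ℝ} (hu0 : 0 ≤ u) (hu : u ≤ 3 / 2) :
    0 ≤ coeffIntegrand t n (t * (ε * u)) := by
  obtain ⟨x, φ, hx, hφ, hle⟩ := coeffIntegrand_ge_of_le_half h0 h hn (y := ε * u) (by positivity)
    (by nlinarith)
  refine le_trans ?_ hle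
  have h3 : n * t * (ε * u) ^ 3 = ε * u ^ 3 := by linear_combination ε * u ^ 3 * hnε
  have h4 : |φ| ≤ 7 / 10 := by
    rw [h3] at hφ
    have : u ^ 3 ≤ (3 / 2) ^ 3 := pow_le_pow_left₀ hu0 hu 3
    nlinarith [mul_le_mul hε this (by positivity) (by norm_num)]
  have h5 : 74 / 100 ≤ Real.cos φ := by
    have := Real.one_sub_sq_div_two_le_cos (x := φ)
    have : φ ^ 2 ≤ (7 / 10) ^ 2 := sq_le_sq' (by linarith [(abs_le.1 h4).1]) (abs_le.1 h4).2
    linarith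
  have : 0 ≤ Real.cos φ - 1 / 5 := by linarith
  positivity

/-- The exponent -4u²/5 + 6u/25 is replaced by its tangent bound at u = 3/2, so that the tail
integral is elementary; cos φ - 1/5 ≥ -6/5. -/
theorem coeffIntegrand_ge_neg_exp {u : ℝ} (hu0 : 3 / 2 ≤ u) (hu : ε * u ≤ 1 / 2) :
    Real.exp (logPeak t) * -(6 / 5 * Real.exp (9 / 5 - 54 / 25 * u)) ≤
      coeffIntegrand t n (t * (ε * u)) := by
  obtain ⟨x, φ, hx, hφ, hle⟩ := coeffIntegrand_ge_of_le_half h0 h hn (y := ε * u) (by positivity) hu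
  refine le_trans (mul_le_mul_of_nonneg_left ?_ (Real.exp_pos _).le) hle
  have hnt : 0 ≤ n * t := by positivity
  have h1 : 4 / 5 * u ^ 2 ≤ n * t * ((ε * u) ^ 2 / (1 + (ε * u) ^ 2)) := by
    have : 4 / 5 * (ε * u) ^ 2 ≤ (ε * u) ^ 2 / (1 + (ε * u) ^ 2) := by
      rw [le_div_iff₀ (by positivity)]
      have : (ε * u) ^ 2 ≤ (1 / 2) ^ 2 := pow_le_pow_left₀ (by positivity) hu 2
      nlinarith [sq_nonneg (ε * u)]
    refine le_trans (le_of_eq ?_) (mul_le_mul_of_nonneg_left this hnt)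
    linear_combination -(4 / 5 * u ^ 2) * hnε
  have h2 : Real.exp x ≤ Real.exp (9 / 5 - 54 / 25 * u) := by
    refine Real.exp_le_exp.2 ?_
    have := (abs_le.1 hx).2
    nlinarith [sq_nonneg (u - 3 / 2)]
  have := Real.neg_one_le_cos φ
  nlinarith [Real.exp_pos x]

/-- In the variable u, [0,1] contributes at least 0.40, [1,3/2] is nonnegative, and the rest costs
at most 0.14. -/
theorem integral_coeffIntegrand_center_ge :
    Real.exp (logPeak t) * (26 / 100 * (t * ε)) ≤
      ∫ θ in (0 : ℝ)..t / 2, coeffIntegrand t n θ := by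
  have hcont := continuous_coeffIntegrand h0 n
  have hint : ∀ a b : ℝ, IntervalIntegrable (fun u => coeffIntegrand t n (t * ε * u))
      MeasureTheory.volume a b := fun a b => (by fun_prop : Continuous _).intervalIntegrable _ _
  have hε' : t * ε ≠ 0 := by positivity
  have hε2 : 5 ≤ 1 / (2 * ε) := by
    rw [le_div_iff₀ (by positivity)]; linarith
  have e1 : ∫ θ in (0 : ℝ)..t / 2, coeffIntegrand t n θ =
      (t * ε) * ∫ u in (0 : ℝ)..1 / (2 * ε), coeffIntegrand t n (t * ε * u) := by
    rw [intervalIntegral.integral_comp_mul_left _ hε', smul_eq_mul, mul_inv_cancel_left₀ hε',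
      mul_zero]
    congr 1
    field_simp
  have i1 : Real.exp (logPeak t) * (40 / 100) ≤
      ∫ u in (0 : ℝ)..1, coeffIntegrand t n (t * ε * u) := by
    have : ∫ u in (0 : ℝ)..1, Real.exp (logPeak t) * (74 / 100 * (1 - u ^ 2 - 24 / 100 * u)) ≤
        ∫ u in (0 : ℝ)..1, coeffIntegrand t n (t * ε * u) := by
      refine intervalIntegral.integral_mono_on (by norm_num)
        ((by fun_prop : Continuous _).intervalIntegrable _ _) (hint _ _) fun u hu => ?_
      rw [mul_assoc t]
      exact coeffIntegrand_ge_polynomial h0 h hn hε0 hε hnε hu.1 hu.2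
    refine le_trans ?_ this
    rw [intervalIntegral.integral_const_mul, intervalIntegral.integral_const_mul,
      intervalIntegral.integral_sub, intervalIntegral.integral_sub,
      intervalIntegral.integral_const_mul, integral_pow, integral_id, integral_one]
    · have := Real.exp_pos (logPeak t)
      norm_num
      linarith
    all_goals exact (by fun_prop : Continuous _).intervalIntegrable _ _
  have i2 : 0 ≤ ∫ u in (1 : ℝ)..3 / 2, coeffIntegrand t n (t * ε * u) := by
    refine intervalIntegral.integral_nonneg (by norm_num) fun u hu => ?_
    rw [mul_assoc t]
    exact coeffIntegrand_nonneg_of_le h0 h hn hε0 hε hnε (by linarith [hu.1]) hu.2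
  have i3 : Real.exp (logPeak t) * -(14 / 100) ≤
      ∫ u in (3 / 2 : ℝ)..1 / (2 * ε), coeffIntegrand t n (t * ε * u) := by
    have : ∫ u in (3 / 2 : ℝ)..1 / (2 * ε),
        Real.exp (logPeak t) * -(6 / 5 * Real.exp (9 / 5 - 54 / 25 * u)) ≤
        ∫ u in (3 / 2 : ℝ)..1 / (2 * ε), coeffIntegrand t n (t * ε * u) := by
      refine intervalIntegral.integral_mono_on (by linarith)
        ((by fun_prop : Continuous _).intervalIntegrable _ _) (hint _ _) fun u hu => ?_
      rw [mul_assoc t]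
      refine coeffIntegrand_ge_neg_exp h0 h hn hε0 hε hnε hu.1 ?_
      have := hu.2
      rw [le_div_iff₀ (by positivity)] at this
      linarith
    refine le_trans ?_ this
    rw [intervalIntegral.integral_const_mul, intervalIntegral.integral_neg,
      intervalIntegral.integral_const_mul]
    refine mul_le_mul_of_nonneg_left (neg_le_neg ?_) (Real.exp_pos _).le
    rw [intervalIntegral.integral_comp_sub_mul (fun x => Real.exp x) (by norm_num), integral_exp]
    have b1 : Real.exp (9 / 5 - 54 / 25 * (3 / 2)) ≤ 1 / 4 := by
      rw [show (9 / 5 - 54 / 25 * (3 / 2) : ℝ) = -(36 / 25) by norm_num, Real.exp_neg,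
        inv_le_comm₀ (Real.exp_pos _) (by norm_num)]
      have h2 : Real.exp (36 / 25) = Real.exp (12 / 25) ^ 3 := by
        rw [← Real.exp_nat_mul]; norm_num
      have h3 := Real.quadratic_le_exp_of_nonneg (x := 12 / 25) (by norm_num)
      rw [h2]
      refine le_trans ?_ (pow_le_pow_left₀ (by norm_num) h3 3)
      norm_num
    have b2 := Real.exp_pos (9 / 5 - 54 / 25 * (1 / (2 * ε)))
    rw [smul_eq_mul]
    norm_num at b1 b2 ⊢
    linarith
  rw [e1]
  have split : ∫ u in (0 : ℝ)..1 / (2 * ε), coeffIntegrand t n (t * ε * u) =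
      (∫ u in (0 : ℝ)..1, coeffIntegrand t n (t * ε * u)) +
      (∫ u in (1 : ℝ)..3 / 2, coeffIntegrand t n (t * ε * u)) +
      ∫ u in (3 / 2 : ℝ)..1 / (2 * ε), coeffIntegrand t n (t * ε * u) := by
    rw [intervalIntegral.integral_add_adjacent_intervals (hint _ _) (hint _ _),
      intervalIntegral.integral_add_adjacent_intervals (hint _ _) (hint _ _)]
  rw [split]
  have : Real.exp (logPeak t) * (26 / 100) ≤ _ :=
    le_trans (by linarith) (add_le_add (add_le_add i1 i2) i3)
  have := mul_le_mul_of_nonneg_left this (by positivity : 0 ≤ t * ε)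
  linarith

end MainArc

/-! ### The complementary arcs and positivity for n ≥ 50000. -/

theorem integral_coeffIntegrand_ge_neg {t : ℝ} (h0 : 0 < t) (n : ℕ) {a b c : ℝ} (hab : a ≤ b)
    (hc : ∀ θ ∈ Set.Icc a b,
      (cschSum ⟨t, -θ⟩).re + |(sechSum ⟨t, -θ⟩).re| ≤ logPeak t + c) :
    -(Real.exp (logPeak t) * (2 * (b - a) * Real.exp c)) ≤
      ∫ θ in a..b, coeffIntegrand t n θ := by
  have : ∫ θ in a..b, -(2 * Real.exp (logPeak t + c)) ≤ ∫ θ in a..b, coeffIntegrand t n θ := by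
    refine intervalIntegral.integral_mono_on hab (by simp)
      ((continuous_coeffIntegrand h0 n).intervalIntegrable _ _) fun θ hθ => ?_
    have h1 := abs_coeffIntegrand_le h0 n θ
    have h2 := Real.exp_le_exp.2 (hc θ hθ)
    linarith [neg_abs_le (coeffIntegrand t n θ)]
  refine le_trans (le_of_eq ?_) this
  rw [intervalIntegral.integral_const, smul_eq_mul, Real.exp_add]
  ring

theorem exp_neg_natCast_le (k : ℕ) : Real.exp (-k) ≤ (368 / 1000) ^ k := by
  have : Real.exp (-k) = Real.exp (-1) ^ k := by
    rw [← Real.exp_nat_mul]; ring_nf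
  rw [this]
  refine pow_le_pow_left₀ (Real.exp_pos _).le ?_ k
  have := Real.exp_neg_one_lt_d9
  norm_num at this ⊢
  linarith

/-- With s = 1/(493t) ≥ 1 the inequality s ≤ e^(s-1) trades part of the exponential decay for the
factor (493t)^j, as needed for comparison with t². -/
theorem exp_neg_div_le {t : ℝ} (h0 : 0 < t) (h : t ≤ 1 / 493) {c : ℝ} {k j : ℕ}
    (hk : j ≤ 493 * c) (b : ℝ) (hc : k ≤ 493 * c - b) :
    Real.exp (-(c / t) + b) ≤ (368 / 1000) ^ k * (493 * t) ^ j := by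
  have hs : 1 ≤ 1 / (493 * t) := by
    rw [le_div_iff₀ (by positivity)]; linarith
  set s := 1 / (493 * t) with hs'
  have e1 : c / t = 493 * c * s := by rw [hs']; field_simp
  have e2 : 493 * t = s⁻¹ := by rw [hs', one_div, inv_inv]
  have h1 : s ^ j ≤ Real.exp (j * (s - 1)) := by
    rw [Real.exp_nat_mul]
    exact pow_le_pow_left₀ (by linarith) (by linarith [Real.add_one_le_exp (s - 1)]) j
  have h2 := exp_neg_natCast_le k
  have h3 : Real.exp (-(c / t) + b) ≤ Real.exp (-k) * Real.exp (-(j * (s - 1))) := by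
    rw [← Real.exp_add, e1]
    refine Real.exp_le_exp.2 ?_
    nlinarith
  refine h3.trans (mul_le_mul h2 ?_ (Real.exp_pos _).le (by positivity))
  rw [e2, Real.exp_neg, inv_pow]
  exact inv_anti₀ (by positivity) h1

/-- Arcs of length proportional to t need one extra power of t (j = 1); the two arcs of bounded
length need two (j = 2). -/
theorem integral_coeffIntegrand_outer_ge {t : ℝ} (h0 : 0 < t) (h : t ≤ 1 / 493) (n : ℕ) :
    -(Real.exp (logPeak t) * (4 * t ^ 2)) ≤
      ∫ θ in (t / 2)..Real.pi / 2, coeffIntegrand t n θ := by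
  have hint : ∀ a b : ℝ, IntervalIntegrable (coeffIntegrand t n)
      MeasureTheory.volume a b := (continuous_coeffIntegrand h0 n).intervalIntegrable
  have hpi := Real.pi_gt_three
  have hpi' := Real.pi_lt_d2
  have i1 := integral_coeffIntegrand_ge_neg h0 n (a := t / 2) (b := 2 * t)
    (c := -(198 / 10000 / t) + 0) (by linarith) fun θ hθ =>
      (log_le_mid₁ h0 h hθ.1 hθ.2).trans (by linarith)
  have i2 := integral_coeffIntegrand_ge_neg h0 n (a := 2 * t) (b := Real.pi / 4)
    (c := -(373 / 10000 / t) + 0) (by linarith) fun θ hθ =>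
      (log_le_mid₂ h0 h hθ.1 hθ.2).trans (by linarith)
  have i3 := integral_coeffIntegrand_ge_neg h0 n (a := Real.pi / 4) (b := Real.pi / 2 - 16 * t)
    (c := -(322 / 10000 / t) + 0) (by linarith) fun θ hθ =>
      (log_le_mid₃ h0 h hθ.1 hθ.2).trans (by linarith)
  have i4 := integral_coeffIntegrand_ge_neg h0 n (a := Real.pi / 2 - 16 * t)
    (b := Real.pi / 2 - 3 * t) (c := -(776 / 10000 / t) + 18) (by linarith) fun θ hθ =>
      (log_le_near_I_outer h0 h hθ.1 hθ.2).trans (by linarith)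
  have i5 := integral_coeffIntegrand_ge_neg h0 n (a := Real.pi / 2 - 3 * t)
    (b := Real.pi / 2) (c := -(208 / 10000 / t) + 282 / 100) (by linarith) fun θ hθ =>
      (log_le_near_I_inner h0 h hθ.1 hθ.2).trans (by linarith)
  have b1 := exp_neg_div_le h0 h (c := 198 / 10000) (k := 9) (j := 1) (by norm_num) 0 (by norm_num)
  have b2 := exp_neg_div_le h0 h (c := 373 / 10000) (k := 15) (j := 2) (by norm_num) 0 (by norm_num)
  have b3 := exp_neg_div_le h0 h (c := 322 / 10000) (k := 15) (j := 2) (by norm_num) 0 (by norm_num)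
  have b4 := exp_neg_div_le h0 h (c := 776 / 10000) (k := 20) (j := 1) (by norm_num) 18
    (by norm_num)
  have b5 := exp_neg_div_le h0 h (c := 208 / 10000) (k := 7) (j := 1) (by norm_num) (282 / 100)
    (by norm_num)
  have s1 := intervalIntegral.integral_add_adjacent_intervals (hint (t / 2) (2 * t))
      (hint _ (Real.pi / 2))
  have s2 := intervalIntegral.integral_add_adjacent_intervals (hint (2 * t) (Real.pi / 4))
      (hint _ (Real.pi / 2))
  have s3 := intervalIntegral.integral_add_adjacent_intervals
      (hint (Real.pi / 4) (Real.pi / 2 - 16 * t)) (hint _ (Real.pi / 2))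
  have s4 := intervalIntegral.integral_add_adjacent_intervals
      (hint (Real.pi / 2 - 16 * t) (Real.pi / 2 - 3 * t)) (hint _ (Real.pi / 2))
  have key : 2 * (2 * t - t / 2) * Real.exp (-(198 / 10000 / t) + 0) +
      2 * (Real.pi / 4 - 2 * t) * Real.exp (-(373 / 10000 / t) + 0) +
      2 * (Real.pi / 2 - 16 * t - Real.pi / 4) * Real.exp (-(322 / 10000 / t) + 0) +
      2 * (Real.pi / 2 - 3 * t - (Real.pi / 2 - 16 * t)) * Real.exp (-(776 / 10000 / t) + 18) +
      2 * (Real.pi / 2 - (Real.pi / 2 - 3 * t)) * Real.exp (-(208 / 10000 / t) + 282 / 100) ≤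
      4 * t ^ 2 := by
    have c1 := mul_le_mul (show 2 * (2 * t - t / 2) ≤ 3 * t by linarith) b1 (Real.exp_pos _).le
      (by positivity)
    have c2 := mul_le_mul (show 2 * (Real.pi / 4 - 2 * t) ≤ 8 / 5 by linarith) b2
      (Real.exp_pos _).le (by positivity)
    have c3 := mul_le_mul (show 2 * (Real.pi / 2 - 16 * t - Real.pi / 4) ≤ 8 / 5 by linarith) b3
      (Real.exp_pos _).le (by positivity)
    have c4 := mul_le_mul (show 2 * (Real.pi / 2 - 3 * t - (Real.pi / 2 - 16 * t)) ≤ 26 * t by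
      linarith) b4 (Real.exp_pos _).le (by positivity)
    have c5 := mul_le_mul (show 2 * (Real.pi / 2 - (Real.pi / 2 - 3 * t)) ≤ 6 * t by
      linarith) b5 (Real.exp_pos _).le (by positivity)
    refine (add_le_add (add_le_add (add_le_add (add_le_add c1 c2) c3) c4) c5).trans ?_
    norm_num
    nlinarith
  have := mul_le_mul_of_nonneg_left key (Real.exp_pos (logPeak t)).le
  rw [← s1, ← s2, ← s3, ← s4]
  linarith

theorem coeff_G_pos_of_ge {n : ℕ} (hn : 50000 ≤ n) : 0 < coeff n G := by
  have hn' : (50000 : ℝ) ≤ n := by exact_mod_cast hn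
  have hpi := Real.pi_gt_d4
  have hpi' := Real.pi_lt_d4
  have hn0 : (0 : ℝ) < n := by linarith
  set t : ℝ := Real.pi / √(48 * n) with ht
  have hsq : √(48 * n) ^ 2 = 48 * n := Real.sq_sqrt (by positivity)
  have hs0 : 0 < √(48 * (n : ℝ)) := Real.sqrt_pos.2 (by positivity)
  have h0 : 0 < t := by positivity
  have hnt : n * t ^ 2 = Real.pi ^ 2 / 48 := by
    rw [ht, div_pow, hsq]; field_simp
  have h : t ≤ 1 / 493 := by
    rw [ht, div_le_div_iff₀ hs0 (by norm_num)]
    rw [one_mul]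
    refine Real.le_sqrt_of_sq_le ?_
    nlinarith
  set ε : ℝ := √(1 / (n * t)) with hε
  have hnt0 : 0 < n * t := by positivity
  have hε2 : ε ^ 2 = 1 / (n * t) := Real.sq_sqrt (by positivity)
  have hε0 : 0 < ε := Real.sqrt_pos.2 (by positivity)
  have hnε : n * t * ε ^ 2 = 1 := by rw [hε2]; field_simp
  have hA : n * t = Real.pi ^ 2 / 48 / t := by rw [← hnt]; field_simp
  have hA2 := pi_sq_div_ge
  have hA3 : Real.pi ^ 2 / 48 ≤ 2057 / 10000 := by nlinarith
  have hε10 : ε ≤ 1 / 10 := by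
    refine Real.sqrt_le_iff.2 ⟨by norm_num, ?_⟩
    rw [hA, one_div_div, div_le_iff₀ (by positivity)]
    linarith
  have hεt : 40 * t ≤ ε := by
    -- With ε ≥ 40t the central contribution 0.26 t ε is at least 10.4t², exceeding the loss 4t².
    refine Real.le_sqrt_of_sq_le ?_
    rw [hA, one_div_div, le_div_iff₀ (by positivity)]
    have : (40 * t) ^ 2 * (Real.pi ^ 2 / 48) ≤ (40 * t) ^ 2 * (2057 / 10000) := by gcongr
    nlinarith
  have c1 := integral_coeffIntegrand_center_ge h0 h hnt hε0 hε10 hnε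
  have c2 := integral_coeffIntegrand_outer_ge h0 h n
  have c3 := intervalIntegral.integral_add_adjacent_intervals
    ((continuous_coeffIntegrand h0 n).intervalIntegrable (μ := MeasureTheory.volume) 0 (t / 2))
    ((continuous_coeffIntegrand h0 n).intervalIntegrable _ (Real.pi / 2))
  rw [integral_coeffIntegrand h0] at c3
  have c4 : 0 < Real.exp (logPeak t) * (26 / 100 * (t * ε) - 4 * t ^ 2) := by
    refine mul_pos (Real.exp_pos _) ?_
    nlinarith
  have c5 : 0 < Real.pi * (coeff n G : ℤ) * Real.exp (-(n * t)) := by rw [← c3]; linarith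
  have c6 : 0 < Real.pi * ((coeff n G : ℤ) : ℝ) := pos_of_mul_pos_left c5 (Real.exp_pos _).le
  exact_mod_cast pos_of_mul_pos_right c6 Real.pi_pos.le

end CollMayersMayers

namespace CollMayersMayers

open PowerSeries

/-! ### An explicit bound for the coefficients below 50000. -/

theorem re_cschSum_ofReal_le {t : ℝ} (h0 : 0 < t) :
    (cschSum t).re ≤ Real.pi ^ 2 / 48 / t := by
  have ht : 0 < (t : ℂ).re := by simpa using h0
  rw [re_cschSum ht]
  have h1 : HasSum (fun j : ℕ => 1 / (8 * t) / ((j : ℝ) + 1) ^ 2) (Real.pi ^ 2 / 48 / t) := by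
    have e : (fun j : ℕ => 1 / (8 * t) / ((j : ℝ) + 1) ^ 2) =
        fun j : ℕ => 1 / (8 * ((j : ℝ) + 1) ^ 2) / t := by
      funext j
      field_simp
    rw [e]
    exact hasSum_one_div_eight_mul_sq.div_const t
  refine ((summable_re_cschTerm ht).tsum_le_tsum (fun j => ?_) h1.summable).trans h1.tsum_eq.le
  exact (Complex.re_le_norm _).trans (by simpa using norm_cschTerm_le ht j)

-- The single radius exp(-1/493) serves all n. The worst excess over the peak is 1/(200t) = 2.465,
-- and 101.5 + 105.21 + 2.465 < 304 log 2.
set_option exponentiation.threshold 400 in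
theorem abs_coeff_G_lt {n : ℕ} (hn : n < 50000) : |coeff n G| < 2 ^ 304 := by
  set t : ℝ := 1 / 493 with ht
  have h0 : 0 < t := by positivity
  have h : t ≤ 1 / 493 := le_rfl
  have hpi := Real.pi_gt_three
  have hpi' := Real.pi_lt_d2
  have hsup : ∀ θ ∈ Set.uIoc 0 (Real.pi / 2),
      ‖coeffIntegrand t n θ‖ ≤ 2 * Real.exp (logPeak t + 2465 / 1000) := by
    intro θ hθ
    rw [Set.uIoc_of_le (by positivity)] at hθ
    refine (abs_coeffIntegrand_le h0 n θ).trans ?_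
    refine mul_le_mul_of_nonneg_left (Real.exp_le_exp.2 ?_) (by norm_num)
    rcases le_total θ (2 * t) with h1 | h1
    · refine (log_le_of_le_two_mul h0 h hθ.1.le h1).trans ?_
      rw [ht]; norm_num
    rcases le_total θ (Real.pi / 4) with h2 | h2
    · refine (log_le_mid₂ h0 h h1 h2).trans ?_
      rw [ht]; norm_num; linarith
    rcases le_total θ (Real.pi / 2 - 16 * t) with h3 | h3
    · refine (log_le_mid₃ h0 h h2 h3).trans ?_
      rw [ht]; norm_num; linarith
    rcases le_total θ (Real.pi / 2 - 3 * t) with h4 | h4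
    · refine (log_le_near_I_outer h0 h h3 h4).trans ?_
      rw [ht]; norm_num; linarith
    · refine (log_le_near_I_inner h0 h h4 hθ.2).trans ?_
      rw [ht]; norm_num; linarith
  have h1 := intervalIntegral.norm_integral_le_of_norm_le_const hsup
  rw [integral_coeffIntegrand h0, norm_mul, norm_mul, Real.norm_of_nonneg Real.pi_pos.le,
    Real.norm_of_nonneg (Real.exp_pos _).le, sub_zero, abs_of_pos (by positivity)] at h1
  have hlog : logPeak t ≤ 10521 / 100 := by
    have e1 := re_cschSum_ofReal_le h0
    have e2 := abs_re_sechSum_le_of_abs_im_le (τ := (t : ℂ)) (by simpa using h0) (by simpa using h)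
      (by simp [h0.le])
    have e3 : Real.pi ^ 2 / 48 / t ≤ 1014 / 10 := by
      rw [ht]
      have := Real.pi_lt_d4
      norm_num
      nlinarith
    rw [logPeak]
    have e4 := le_abs_self (sechSum (t : ℂ)).re
    simp only [Complex.ofReal_re] at e2
    rw [ht] at e2 e3 e4 e1 ⊢
    norm_num at e1 e2 e3 e4 ⊢
    linarith
  have hnt : n * t ≤ 1015 / 10 := by
    have : (n : ℝ) ≤ 50000 := by exact_mod_cast hn.le
    rw [ht]; linarith
  have h2 : ‖((coeff n G : ℤ) : ℝ)‖ ≤ Real.exp (n * t) * Real.exp (logPeak t + 2465 / 1000) := by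
    rw [Real.exp_neg] at h1
    have e1 := Real.exp_pos (n * t)
    have h3 : Real.pi * ‖((coeff n G : ℤ) : ℝ)‖ * (Real.exp (n * t))⁻¹ ≤
      Real.pi * Real.exp (logPeak t + 2465 / 1000) := h1.trans (by linarith)
    rw [← div_eq_mul_inv, div_le_iff₀ e1, mul_assoc] at h3
    have := le_of_mul_le_mul_left h3 Real.pi_pos
    linarith
  rw [← Real.exp_add] at h2
  have h3 : Real.exp (n * t + (logPeak t + 2465 / 1000)) < 2 ^ 304 := by
    have : (2 : ℝ) ^ 304 = Real.exp (304 * Real.log 2) := by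
      rw [mul_comm, Real.exp_mul, Real.exp_log (by norm_num)]
      norm_num
    rw [this]
    refine Real.exp_lt_exp.2 ?_
    have := Real.log_two_gt_d9
    linarith
  have h4 := h2.trans_lt h3
  rw [Real.norm_eq_abs] at h4
  exact_mod_cast h4

end CollMayersMayers

namespace CollMayersMayers

/-! ### A finite form of Euler's product expansion -/

section Euler

variable {R : Type*} [CommRing R]

/-- The product `∏ (-z x ^ (i + j))` over `j < l`. -/
def eulerTail (x z : R) (i l : ℕ) : R := ∏ j ∈ Finset.range l, (-(z * x ^ (i + j)))

/-- The product `∏ (1 - x ^ (i + j + 1))` over `j < l`. -/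
def eulerProd (x : R) (i l : ℕ) : R := ∏ j ∈ Finset.range l, (1 - x ^ (i + j + 1))

/-- The sum of `eulerTail x z i m * eulerProd x (i + m) (l - m)` over `m < l`. -/
def eulerHead (x z : R) (i : ℕ) : ℕ → R
  | 0 => 0
  | l + 1 => (eulerHead x z i l + eulerTail x z i l) * (1 - x ^ (i + l + 1))

theorem eulerTail_succ (x z : R) (i l : ℕ) :
    eulerTail x z i (l + 1) = eulerTail x z i l * -(z * x ^ (i + l)) :=
  Finset.prod_range_succ _ _

theorem eulerProd_succ (x : R) (i l : ℕ) :
    eulerProd x i (l + 1) = eulerProd x i l * (1 - x ^ (i + l + 1)) :=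
  Finset.prod_range_succ _ _

theorem eulerTail_add (x z : R) (i l₁ l₂ : ℕ) :
    eulerTail x z i (l₁ + l₂) = eulerTail x z i l₁ * eulerTail x z (i + l₁) l₂ := by
  simp only [eulerTail, Finset.prod_range_add, add_assoc]

theorem eulerProd_add (x : R) (i l₁ l₂ : ℕ) :
    eulerProd x i (l₁ + l₂) = eulerProd x i l₁ * eulerProd x (i + l₁) l₂ := by
  simp only [eulerProd, Finset.prod_range_add, add_assoc]

/-- The recursion for binary splitting. It is clean because `eulerHead` omits the last summand m =
l, which `eulerTail` carries. -/
theorem eulerHead_add (x z : R) (i l₁ l₂ : ℕ) :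
    eulerHead x z i (l₁ + l₂) = eulerHead x z i l₁ * eulerProd x (i + l₁) l₂ +
      eulerTail x z i l₁ * eulerHead x z (i + l₁) l₂ := by
  induction l₂ with
  | zero => simp [eulerHead, eulerProd]
  | succ l ih =>
    rw [← add_assoc, eulerHead, ih, eulerTail_add, eulerHead, eulerProd_succ]
    ring_nf

/-- The polynomial `∑ (-z) ^ m x ^ (m (m - 1) / 2) ∏_{m < i ≤ l} (1 - x ^ i)` in `z`. -/
def eulerSum (x z : R) (l : ℕ) : R := eulerHead x z 0 l + eulerTail x z 0 l

theorem eulerSum_succ (x z : R) (l : ℕ) :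
    eulerSum x z (l + 1) = eulerSum x z l * (1 - x ^ (l + 1)) + eulerTail x z 0 (l + 1) := by
  simp only [eulerSum, eulerHead, zero_add]

theorem eulerTail_succ' (x z : R) (l : ℕ) :
    eulerTail x z 0 (l + 1) = -z * eulerTail x (x * z) 0 l := by
  rw [eulerTail, Finset.prod_range_succ', mul_comm, eulerTail]
  congr 1
  · simp
  · refine Finset.prod_congr rfl fun j _ => ?_
    ring

/-- A finite form of (z; x)_∞ = (1 - z)(xz; x)_∞, with an explicit error term. -/
theorem eulerSum_eq (x z : R) (l : ℕ) :
    eulerSum x z l = (1 - z) * eulerSum x (x * z) l + z * eulerTail x (x * z) 0 l := by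
  induction l with
  | zero => simp [eulerSum, eulerHead, eulerTail]
  | succ l ih =>
    have h := eulerTail_succ x (x * z) 0 l
    rw [eulerSum_succ, ih, eulerTail_succ', eulerSum_succ, h]
    ring

theorem pow_dvd_eulerTail (b y : R) (i l : ℕ) :
    b ^ (l * (2 * i + l)) ∣ eulerTail (-b ^ 2) (b * y) i l := by
  induction l with
  | zero => simp
  | succ l ih =>
    rw [eulerTail_succ,
      show (l + 1) * (2 * i + (l + 1)) = l * (2 * i + l) + (2 * (i + l) + 1) by ring,
      pow_add]
    refine mul_dvd_mul ih ⟨-(y * (-1) ^ (i + l)), ?_⟩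
    rw [neg_pow (b ^ 2)]
    ring

/-- With x = -b² and z = b, iterating the functional equation produces the denominator's factors.
Each error term is divisible by b^(l²), hence zero. -/
theorem eulerSum_eq_prod {b : R} {l N : ℕ} (hb : b ^ N = 0) (hl : N ≤ l * l) (J : ℕ) :
    eulerSum (-b ^ 2) b l = (∏ j ∈ Finset.range J, (1 - (-1) ^ j * b ^ (2 * j + 1))) *
      eulerSum (-b ^ 2) ((-1) ^ J * b ^ (2 * J + 1)) l := by
  induction J with
  | zero => simp
  | succ J ih =>
    rw [ih, eulerSum_eq _ ((-1) ^ J * b ^ (2 * J + 1)), Finset.prod_range_succ]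
    have h1 : -b ^ 2 * ((-1) ^ J * b ^ (2 * J + 1)) = (-1) ^ (J + 1) * b ^ (2 * (J + 1) + 1) := by
      ring
    have h2 : eulerTail (-b ^ 2) ((-1) ^ (J + 1) * b ^ (2 * (J + 1) + 1)) 0 l = 0 := by
      have h3 := pow_dvd_eulerTail b ((-1) ^ (J + 1) * b ^ (2 * (J + 1))) 0 l
      rw [mul_zero, zero_add, pow_eq_zero_of_le hl hb, zero_dvd_iff] at h3
      rw [← h3]
      congr 1
      ring
    rw [h1, h2]
    ring

theorem eulerSum_zero (x : R) (l : ℕ) : eulerSum x 0 l = eulerProd x 0 l := by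
  induction l with
  | zero => simp [eulerSum, eulerHead, eulerTail, eulerProd]
  | succ l ih => rw [eulerSum_succ, ih, eulerProd_succ, eulerTail_succ]; simp

/-- For J large enough the remaining argument z vanishes, where the Euler sum is just `eulerProd`;
the last summand vanishes as well. -/
theorem eulerHead_eq_prod_mul {b : R} {l N : ℕ} (hb : b ^ N = 0) (hl : N ≤ l * l) {J : ℕ}
    (hJ : N ≤ 2 * J + 1) :
    eulerHead (-b ^ 2) b 0 l =
      (∏ j ∈ Finset.range J, (1 - (-1) ^ j * b ^ (2 * j + 1))) * eulerProd (-b ^ 2) 0 l := by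
  have h1 := eulerSum_eq_prod hb hl J
  rw [pow_eq_zero_of_le hJ hb, mul_zero, eulerSum_zero, eulerSum] at h1
  have h3 := pow_dvd_eulerTail b 1 0 l
  rw [mul_zero, zero_add, pow_eq_zero_of_le hl hb, zero_dvd_iff, mul_one] at h3
  rw [← h1, h3, add_zero]

end Euler

/-! ### Evaluation of truncated power series at a nilpotent element -/

section Nilpotent

variable {R : Type*} [CommRing R]

/-- The value at `b` of the truncation of a power series. -/
noncomputable def truncEval (N : ℕ) (b : R) (f : PowerSeries ℤ) : R :=
  (PowerSeries.trunc N f).eval₂ (Int.castRingHom R) b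

theorem truncEval_eq_sum (N : ℕ) (b : R) (f : PowerSeries ℤ) :
    truncEval N b f = ∑ i ∈ Finset.range N, ((PowerSeries.coeff i f : ℤ) : R) * b ^ i := by
  rw [truncEval, PowerSeries.eval₂_trunc_eq_sum_range]
  rfl

theorem truncEval_congr {N : ℕ} (b : R) {f g : PowerSeries ℤ}
    (h : ∀ i < N, PowerSeries.coeff i f = PowerSeries.coeff i g) :
    truncEval N b f = truncEval N b g := by
  rw [truncEval_eq_sum, truncEval_eq_sum]
  exact Finset.sum_congr rfl fun i hi => by rw [h i (Finset.mem_range.1 hi)]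

/-- Nilpotency of b makes truncation harmless; this is why `truncEval` is multiplicative. -/
theorem truncEval_coe {N : ℕ} {b : R} (hb : b ^ N = 0) (p : Polynomial ℤ) :
    truncEval N b p = p.eval₂ (Int.castRingHom R) b := by
  have h : Polynomial.X ^ N ∣ p - PowerSeries.trunc N (p : PowerSeries ℤ) := by
    rw [Polynomial.X_pow_dvd_iff]
    intro d hd
    simp [PowerSeries.coeff_trunc, hd]
  obtain ⟨r, hr⟩ := h
  have h2 := congrArg (Polynomial.eval₂ (Int.castRingHom R) b) hr
  rw [Polynomial.eval₂_sub, Polynomial.eval₂_mul, Polynomial.eval₂_X_pow, hb, zero_mul,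
    sub_eq_zero] at h2
  exact h2.symm

theorem truncEval_mul {N : ℕ} {b : R} (hb : b ^ N = 0) (f g : PowerSeries ℤ) :
    truncEval N b (f * g) = truncEval N b f * truncEval N b g := by
  have h := truncEval_coe hb (PowerSeries.trunc N f * PowerSeries.trunc N g)
  rw [Polynomial.eval₂_mul, Polynomial.coe_mul, truncEval, PowerSeries.trunc_trunc_mul_trunc] at h
  exact h

theorem truncEval_one {N : ℕ} {b : R} (hb : b ^ N = 0) : truncEval N b 1 = 1 := by
  have := truncEval_coe hb (1 : Polynomial ℤ)
  simpa using this

theorem truncEval_prod {N : ℕ} {b : R} (hb : b ^ N = 0) {ι : Type*} (s : Finset ι)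
    (f : ι → PowerSeries ℤ) : truncEval N b (∏ i ∈ s, f i) = ∏ i ∈ s, truncEval N b (f i) := by
  classical
  induction s using Finset.induction_on with
  | empty => simpa using truncEval_one hb
  | insert i s hi ih => rw [Finset.prod_insert hi, Finset.prod_insert hi, truncEval_mul hb, ih]

theorem truncEval_denFactor {N : ℕ} {b : R} (hb : b ^ N = 0) (j : ℕ) :
    truncEval N b (denFactor j) = 1 - (-1) ^ j * b ^ (2 * j + 1) := by
  have := truncEval_coe hb (1 - (-1) ^ j * Polynomial.X ^ (2 * j + 1) : Polynomial ℤ)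
  rw [denFactor]
  simpa [Polynomial.eval₂_pow] using this

theorem truncEval_G_mul_eulerHead {N l : ℕ} {b : R} (hb : b ^ N = 0) (hl : N ≤ l * l) :
    truncEval N b G * eulerHead (-b ^ 2) b 0 l = eulerProd (-b ^ 2) 0 l := by
  have h1 : ∀ᶠ J in Filter.atTop, ∀ i ∈ Finset.range N,
      PowerSeries.coeff i (∏ j ∈ Finset.range (2 * J), denFactor j) =
        PowerSeries.coeff i denominator :=
    (eventually_coeff_prod_denFactor N).mono fun J h i hi => h i (Finset.mem_range.1 hi).le
  obtain ⟨J, hJ1, hJ2⟩ := (h1.and (Filter.eventually_ge_atTop N)).exists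
  have h2 : truncEval N b denominator =
      ∏ j ∈ Finset.range (2 * J), (1 - (-1) ^ j * b ^ (2 * j + 1)) := by
    rw [← truncEval_congr b fun i hi => hJ1 i (Finset.mem_range.2 hi), truncEval_prod hb]
    exact Finset.prod_congr rfl fun j _ => truncEval_denFactor hb j
  rw [eulerHead_eq_prod_mul hb hl (J := 2 * J) (by omega), ← h2, ← mul_assoc,
    mul_comm _ (truncEval N b denominator),
    ← truncEval_mul hb, denominator_mul_G, truncEval_one hb, one_mul]

end Nilpotent

end CollMayersMayers

namespace CollMayersMayers

/-! ### The first coefficients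

All coefficients of `G` below a bound are packed into one natural number, which is obtained by a
division modulo a power of two. -/

/-- `f x`, with `x` evaluated first. -/
def force (x : ℕ) (f : ℕ → Bool) : Bool := Nat.casesOn x (f 0) fun k => f (Nat.succ k)

theorem force_eq (x : ℕ) (f : ℕ → Bool) : force x f = f x := by
  cases x <;> rfl

/-- Passes to `f` the numbers `p`, `r`, `t` for which `p`, `r` and `2 ^ t` are up to a common sign
the values of `eulerProd`, `eulerHead` and `eulerTail` on the block of `2 ^ (d + 1)` indices that
begins at `i`. -/
def withBlock (K : ℕ) : ℕ → ℕ → (ℕ → ℕ → ℕ → Bool) → Bool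
  | 0, i, f =>
    force (2 ^ (K * (2 * (i + 2))) - 1) fun u =>
      force (2 ^ (K * (2 * (i + 1))) + 1) fun v =>
        f (v * u) ((v - 2 ^ (K * (2 * i + 1))) * u) (K * (4 * i + 4))
  | d + 1, i, f =>
    withBlock K d i fun p₁ r₁ t₁ =>
      withBlock K d (i + 2 ^ (d + 1)) fun p₂ r₂ t₂ =>
        force (p₁ * p₂) fun p =>
          force (r₁ * p₂ + Nat.shiftLeft r₂ t₁) fun r =>
            force (t₁ + t₂) fun t => f p r t

/-- Newton's iteration for the inverse of `A` modulo a power of two. -/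
def withNewton (A K N : ℕ) : ℕ → ℕ → (ℕ → Bool) → Bool
  | 0, h, f => f h
  | j + 1, h, f =>
    force (2 ^ (K * ((N - 1) / 2 ^ j + 1))) fun E =>
      force (Nat.land h (E - 1)) fun h₁ =>
        force (Nat.land (h₁ * (E + 2 - Nat.land (Nat.land A (E - 1) * h₁) (E - 1))) (E - 1))
          fun h₂ => withNewton A K N j h₂ f

/-- Checks that the first `N` coefficients of `G` are nonnegative, if they are known to be less than
`2 ^ b` in absolute value. -/
def checkSigns (K N b d T : ℕ) : Bool :=
  withBlock K d 0 fun P A' _ =>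
    force (2 ^ (K * N) - 1) fun mask =>
      force (Nat.land A' mask) fun A =>
        withNewton A K N T 1 fun h =>
          force (Nat.land (h * Nat.land P mask) mask) fun g =>
            force (mask / (2 ^ K - 1) * 2 ^ b) fun c =>
              Nat.beq (Nat.land A 1) 1 && (Nat.beq (Nat.land (A * g) mask) (Nat.land P mask) &&
                Nat.beq (Nat.land (Nat.land (g + c) mask) c) c)

/-- Base 2^305, 50000 digits, 2^(7+1) = 256 Euler terms (256² ≥ 50000), and 16 Newton steps of
doubling precision. -/
theorem checkSigns_eq_true : checkSigns 305 50000 304 7 16 = true := by decide +kernel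

theorem exists_withBlock_eq {R : Type*} [CommRing R] (K d : ℕ) {i : ℕ} (hi : Even i) :
    ∃ p r t : ℕ, (∀ f, withBlock K d i f = f p r t) ∧ ∃ s : R, s * s = 1 ∧
      eulerProd (-(2 ^ K : R) ^ 2) i (2 ^ (d + 1)) = s * p ∧
      eulerHead (-(2 ^ K : R) ^ 2) (2 ^ K) i (2 ^ (d + 1)) = s * r ∧
      eulerTail (-(2 ^ K : R) ^ 2) (2 ^ K) i (2 ^ (d + 1)) = s * 2 ^ t := by
  induction d generalizing i with
  | zero =>
    -- For i even, 1 - x^(i+2) = -(2^(K·2(i+2)) - 1); the common sign -1 keeps the stored numbers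
    -- natural.
    refine ⟨_, _, _, fun f => by rw [withBlock, force_eq, force_eq], -1, by ring, ?_, ?_, ?_⟩
    all_goals
      have h2 : (1 : ℕ) ≤ 2 ^ (K * (2 * (i + 2))) := Nat.one_le_two_pow
      have h3 : 2 ^ (K * (2 * i + 1)) ≤ 2 ^ (K * (2 * (i + 1))) + 1 :=
        (Nat.pow_le_pow_right (by norm_num) (Nat.mul_le_mul_left _ (by omega))).trans
          (Nat.le_succ _)
      simp only [eulerProd, eulerHead, eulerTail, Finset.prod_range_succ, Finset.prod_range_zero,
        zero_add, pow_one, add_zero]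
      push_cast [Nat.cast_sub h2, Nat.cast_sub h3]
      ring_nf
      simp [hi.neg_one_pow, pow_mul]
  | succ d ih =>
    obtain ⟨p₁, r₁, t₁, hf₁, s₁, hs₁, hp₁, hr₁, ht₁⟩ := ih hi
    obtain ⟨p₂, r₂, t₂, hf₂, s₂, hs₂, hp₂, hr₂, ht₂⟩ := ih (i := i + 2 ^ (d + 1))
      (hi.add (by simp [Nat.even_pow]))
    refine ⟨_, _, _, fun f => by rw [withBlock, hf₁, hf₂, force_eq, force_eq, force_eq],
      s₁ * s₂, by linear_combination s₂ * s₂ * hs₁ + hs₂, ?_, ?_, ?_⟩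
    · rw [pow_succ 2 (d + 1), mul_two, eulerProd_add, hp₁, hp₂]
      push_cast
      ring
    · rw [pow_succ 2 (d + 1), mul_two, eulerHead_add, hp₂, hr₁, hr₂, ht₁]
      rw [show Nat.shiftLeft r₂ t₁ = r₂ * 2 ^ t₁ from Nat.shiftLeft_eq _ _]
      push_cast
      ring
    · rw [pow_succ 2 (d + 1), mul_two, eulerTail_add, ht₁, ht₂]
      ring

/-- Nothing is claimed about the output: `checkSigns` verifies the resulting quotient by a
multiplication, so Newton's iteration needs no correctness proof. -/
theorem exists_withNewton_eq (A K N : ℕ) (T h : ℕ) :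
    ∃ h', ∀ f, withNewton A K N T h f = f h' := by
  induction T generalizing h with
  | zero => exact ⟨h, fun f => rfl⟩
  | succ T ih =>
    obtain ⟨h', hh⟩ := ih _
    exact ⟨h', fun f => by rw [withNewton, force_eq, force_eq, force_eq, hh]⟩

theorem land_two_pow_sub_one (x e : ℕ) : Nat.land x (2 ^ e - 1) = x % 2 ^ e :=
  Nat.and_two_pow_sub_one_eq_mod x e

/-- Numbers with bounded base `2 ^ K` digits, written as a sum. -/
theorem sum_lt_two_pow {K : ℕ} (N : ℕ) {f : ℕ → ℕ} (hf : ∀ i < N, f i < 2 ^ K) :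
    ∑ i ∈ Finset.range N, f i * (2 ^ K) ^ i < 2 ^ (K * N) := by
  induction N with
  | zero => simp
  | succ N ih =>
    rw [Finset.sum_range_succ, mul_add, mul_one, pow_add, pow_mul]
    have h1 := ih fun i hi => hf i (by omega)
    have h2 := hf N (by omega)
    rw [pow_mul] at h1
    have h3 : (f N + 1) * (2 ^ K) ^ N ≤ 2 ^ K * (2 ^ K) ^ N := Nat.mul_le_mul_right _ h2
    linarith

theorem testBit_sum {K b : ℕ} (hb : b < K) (N : ℕ) {f : ℕ → ℕ} (hf : ∀ i < N, f i < 2 ^ K) {j : ℕ}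
    (hj : j < N) : (∑ i ∈ Finset.range N, f i * (2 ^ K) ^ i).testBit (K * j + b) =
      (f j).testBit b := by
  induction N with
  | zero => omega
  | succ N ih =>
    have h1 := sum_lt_two_pow N fun i hi => hf i (by omega)
    rw [Finset.sum_range_succ, add_comm, mul_comm (f N), ← pow_mul,
      Nat.testBit_two_pow_mul_add _ h1]
    rcases Nat.lt_succ_iff_lt_or_eq.1 hj with h | rfl
    · rw [if_pos, ih (fun i hi => hf i (by omega)) h]
      calc K * j + b < K * j + K := by omega
        _ = K * (j + 1) := by ring
        _ ≤ K * N := Nat.mul_le_mul_left _ h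
    · rw [if_neg (by omega), Nat.add_sub_cancel_left]

/-- Modulo 2^(KN) the base 2^K is nilpotent, so `G` can be evaluated there. The common sign s
cancels, A is a unit because it is odd, and hence g is the packed value of `G`. -/
theorem coeff_G_nonneg_of_checkSigns {K N b d T : ℕ} (hK : b < K)
    (hN : N ≤ 2 ^ (d + 1) * 2 ^ (d + 1))
    (hb : ∀ n < N, |PowerSeries.coeff n G| < 2 ^ b) (h : checkSigns K N b d T = true) {n : ℕ}
    (hn : n < N) : 0 ≤ PowerSeries.coeff n G := by
  obtain ⟨m, hm⟩ : ∃ m, m = 2 ^ (K * N) := ⟨_, rfl⟩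
  obtain ⟨P, A', t, hf, s, hs, hP, hA, -⟩ :=
    exists_withBlock_eq (R := ZMod m) K d (i := 0) Even.zero
  rw [checkSigns, hf, force_eq, force_eq, land_two_pow_sub_one] at h
  rw [← hm] at h
  obtain ⟨h', hh⟩ := exists_withNewton_eq (A' % m) K N T 1
  rw [hh, force_eq, force_eq] at h
  set g := Nat.land (h' * Nat.land P (m - 1)) (m - 1)
  set c := (m - 1) / (2 ^ K - 1) * 2 ^ b with hc
  rw [Bool.and_eq_true, Bool.and_eq_true, Nat.beq_eq, Nat.beq_eq, Nat.beq_eq] at h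
  obtain ⟨hodd, hmul, hland⟩ := h
  rw [hm, land_two_pow_sub_one, land_two_pow_sub_one, ← hm] at hmul
  rw [hm, land_two_pow_sub_one, ← hm] at hland
  have hB : (2 ^ K : ZMod m) ^ N = 0 := by
    rw [← pow_mul]
    have h1 : ((2 ^ (K * N) : ℕ) : ZMod m) = 0 := by rw [← hm, ZMod.natCast_self]
    exact_mod_cast h1
  have hG : truncEval N (2 ^ K : ZMod m) G = g := by
    have h1 := truncEval_G_mul_eulerHead hB hN
    rw [hP, hA] at h1
    have h2 : truncEval N (2 ^ K : ZMod m) G * A' = P := by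
      linear_combination s * h1 + (P - truncEval N (2 ^ K : ZMod m) G * A') * hs
    have h3 : ((A' % m : ℕ) : ZMod m) * g = P := by
      exact_mod_cast (ZMod.natCast_eq_natCast_iff' _ _ _).2 hmul
    rw [ZMod.natCast_mod] at h3
    have h4 : IsUnit ((A' : ℕ) : ZMod m) := by
      rw [← ZMod.natCast_mod, ZMod.isUnit_iff_coprime]
      have h5 : (A' % m).Coprime (2 ^ (K * N)) := by
        refine Nat.Coprime.pow_right _ (Nat.coprime_two_right.2 (Nat.odd_iff.2 ?_))
        exact (Nat.and_one_is_mod (A' % m)).symm.trans hodd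
      rwa [← hm] at h5
    refine h4.mul_right_cancel ?_
    rw [h2, ← h3, mul_comm]
  have hc' : c = ∑ i ∈ Finset.range N, 2 ^ b * (2 ^ K) ^ i := by
    rw [hc, hm, ← Finset.mul_sum, Nat.geomSum_eq, pow_mul, mul_comm]
    calc 2 = 2 ^ 1 := rfl
      _ ≤ 2 ^ K := Nat.pow_le_pow_right (by norm_num) (by omega)
  -- Adding 2^b to every coefficient gives digits in [0, 2^(b+1)), so there are no carries and bit b
  -- of a digit is set exactly when the coefficient is nonnegative.
  set f : ℕ → ℕ := fun i => (PowerSeries.coeff i G + 2 ^ b).toNat with hfdef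
  have hf1 : ∀ i < N, ((f i : ℕ) : ℤ) = PowerSeries.coeff i G + 2 ^ b := fun i hi => by
    have := (abs_lt.1 (hb i hi)).1
    exact Int.toNat_of_nonneg (by linarith)
  have hf2 : ∀ i < N, f i < 2 ^ K := fun i hi => by
    have h1 := (abs_lt.1 (hb i hi)).2
    have h2 : (2 : ℤ) ^ (b + 1) ≤ 2 ^ K := pow_le_pow_right₀ (by norm_num) hK
    have h3 := hf1 i hi
    rw [pow_succ] at h2
    have : ((f i : ℕ) : ℤ) < 2 ^ K := by linarith
    exact_mod_cast this
  have hZ : ∑ i ∈ Finset.range N, f i * (2 ^ K) ^ i = (g + c) % m := by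
    rw [← Nat.mod_eq_of_lt (sum_lt_two_pow N hf2), ← hm]
    refine (ZMod.natCast_eq_natCast_iff' _ _ _).1 ?_
    rw [Nat.cast_add, ← hG, hc', truncEval_eq_sum]
    push_cast
    rw [← Finset.sum_add_distrib]
    refine Finset.sum_congr rfl fun i hi => ?_
    have := congrArg (Int.cast : ℤ → ZMod m) (hf1 i (Finset.mem_range.1 hi))
    push_cast at this
    rw [this]
    ring
  have hbit : (c.testBit (K * n + b)) = true := by
    rw [hc', testBit_sum hK N (fun i _ => Nat.pow_lt_pow_right (by norm_num) hK) hn]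
    exact Nat.testBit_two_pow_self
  have hbit' : (f n).testBit b = true := by
    rw [← testBit_sum hK N hf2 hn, hZ]
    have h1 : ((((g + c) % m) &&& c).testBit (K * n + b)) = true := by
      rw [show ((g + c) % m) &&& c = c from hland, hbit]
    rw [Nat.testBit_and, Bool.and_eq_true] at h1
    exact h1.1
  have h1 := Nat.ge_two_pow_of_testBit hbit'
  have h2 := hf1 n hn
  have h3 : ((2 ^ b : ℕ) : ℤ) ≤ f n := by exact_mod_cast h1
  push_cast at h3
  linarith

theorem coeff_G_nonneg (n : ℕ) : 0 ≤ PowerSeries.coeff n G := by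
  rcases lt_or_ge n 50000 with h | h
  · exact coeff_G_nonneg_of_checkSigns (by norm_num) (by norm_num)
      (fun _ => abs_coeff_G_lt) checkSigns_eq_true h
  · exact (coeff_G_pos_of_ge h).le

end CollMayersMayers

namespace CollMayersMayers

/-! ### The parity of the index of a Lie algebra -/

section Alternating

variable {k : Type*} [Field k]

theorem finrank_add_two_of_apply_ne_zero {V : Type*} [AddCommGroup V] [Module k V]
    [FiniteDimensional k V] {B : V →ₗ[k] V →ₗ[k] k} (hB : B.IsAlt) {x y : V} (hxy : B x y ≠ 0) :
    Module.finrank k (LinearMap.ker ((B x).prod (B y)) : Submodule k V) + 2 =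
      Module.finrank k V := by
  have hyx : B y x ≠ 0 := fun h => hxy (by rw [← hB.neg, h, neg_zero])
  have hsurj : LinearMap.range ((B x).prod (B y)) = ⊤ := by
    rw [LinearMap.range_eq_top]
    rintro ⟨a, b⟩
    refine ⟨(a / B x y) • y + (b / B y x) • x, ?_⟩
    have h1 := hB x
    have h2 := hB y
    simp [h1, h2, hxy, hyx]
  have := LinearMap.finrank_range_add_finrank_ker ((B x).prod (B y))
  rw [hsurj, finrank_top, Module.finrank_prod, Module.finrank_self] at this
  omega

/-- Splitting off a hyperbolic plane spanned by x and y lowers the dimension by 2 and leaves the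
radical unchanged. Alternation, not mere skew symmetry, makes this valid in characteristic 2. -/
theorem finrank_ker_mod_two {V : Type*} [AddCommGroup V] [Module k V] [FiniteDimensional k V]
    {B : V →ₗ[k] V →ₗ[k] k} (hB : B.IsAlt) :
    Module.finrank k (LinearMap.ker B) % 2 = Module.finrank k V % 2 := by
  induction hd : Module.finrank k V using Nat.strong_induction_on generalizing V with
  | _ d ih =>
    by_cases h0 : B = 0
    · rw [h0, LinearMap.ker_zero, finrank_top, hd]
    obtain ⟨x, y, hxy⟩ : ∃ x y, B x y ≠ 0 := by
      by_contra! h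
      exact h0 (LinearMap.ext fun x => LinearMap.ext fun y => h x y)
    have hW := finrank_add_two_of_apply_ne_zero hB hxy
    set W : Submodule k V := LinearMap.ker ((B x).prod (B y)) with hWdef
    have hmem : ∀ v, v ∈ W ↔ B x v = 0 ∧ B y v = 0 := fun v => by
      rw [hWdef, LinearMap.mem_ker, LinearMap.prod_apply, Function.prod_apply, Prod.mk_eq_zero]
    have hxy' : B y x ≠ 0 := fun h => hxy (by rw [← hB.neg, h, neg_zero])
    have hker : (LinearMap.ker (B.compl₁₂ W.subtype W.subtype)).map W.subtype =
        LinearMap.ker B := by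
      ext v
      constructor
      · rintro ⟨⟨w, hw⟩, hw', rfl⟩
        have hw2 := (hmem w).1 hw
        refine LinearMap.ext fun u => ?_
        -- The component of u orthogonal to x and y.
        have h1 : u - (B x u / B x y) • y - (B y u / B y x) • x ∈ W := by
          have h1 := hB x
          have h2 := hB y
          rw [hmem]
          simp [h1, h2, hxy, hxy']
        have h2 := LinearMap.congr_fun hw' ⟨_, h1⟩
        have h3 : B w x = 0 := by rw [← hB.neg, hw2.1, neg_zero]
        have h4 : B w y = 0 := by rw [← hB.neg, hw2.2, neg_zero]
        simpa [h3, h4] using h2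
      · intro hv
        have hv' : ∀ u, B v u = 0 := fun u => LinearMap.congr_fun hv u
        have hvW : v ∈ W := (hmem v).2 ⟨by rw [← hB.neg, hv', neg_zero],
          by rw [← hB.neg, hv', neg_zero]⟩
        exact ⟨⟨v, hvW⟩, LinearMap.ext fun u => hv' u, rfl⟩
    have h1 := ih (Module.finrank k W) (by omega) (B := B.compl₁₂ W.subtype W.subtype)
      (fun w => hB w) rfl
    rw [← hker, LinearEquiv.finrank_eq (Submodule.equivMapOfInjective _ W.injective_subtype _).symm,
      h1]
    omega

end Alternating

theorem lieIndex_mod_two (k : Type*) [Field k] (L : Type*) [LieRing L] [LieAlgebra k L]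
    [FiniteDimensional k L] : lieIndex k L % 2 = Module.finrank k L % 2 := by
  obtain ⟨f, hf⟩ := Nat.sInf_mem
    (Set.range_nonempty fun f : Module.Dual k L => Module.finrank k (kirillovKer k L f))
  have h1 : lieIndex k L = Module.finrank k (kirillovKer k L f) := hf.symm
  set B : L →ₗ[k] L →ₗ[k] k := LinearMap.mk₂ k (fun x y => f ⁅x, y⁆) (by simp) (by simp) (by simp)
    (by simp) with hB
  have h2 : kirillovKer k L f = LinearMap.ker B := by
    ext x
    rw [LinearMap.mem_ker, LinearMap.ext_iff]
    rfl
  rw [h1, h2]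
  exact finrank_ker_mod_two fun x => by simp [hB]

/-! ### The dimension of a seaweed algebra -/

section Dimension

variable (k : Type*) [Field k] {n : ℕ}

theorem mem_headSpan {s : ℕ} {v : Fin n → k} :
    v ∈ headSpan k n s ↔ ∀ i : Fin n, s ≤ i.val → v i = 0 := by
  constructor
  · intro h i hi
    refine Submodule.span_induction (p := fun v _ => v i = 0) ?_ rfl ?_ ?_ h
    · rintro _ ⟨j, hj, rfl⟩
      exact Pi.single_eq_of_ne (fun h => by subst h; omega) _
    · intro x y _ _ hx hy
      simp [hx, hy]
    · intro a x _ hx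
      simp [hx]
  · intro h
    rw [pi_eq_sum_univ' v]
    refine Submodule.sum_mem _ fun i _ => ?_
    by_cases hi : i.val < s
    · refine Submodule.smul_mem _ _ (Submodule.subset_span ⟨i, hi, ?_⟩)
      ext j
      simp [Pi.single_apply, eq_comm]
    · simp [h i (by omega)]

theorem tailSpan_zero : tailSpan k n 0 = ⊤ := by
  rw [eq_top_iff]
  rintro v -
  rw [pi_eq_sum_univ' v]
  refine Submodule.sum_mem _ fun i _ => ?_
  refine Submodule.smul_mem _ _ (Submodule.subset_span ⟨i, Nat.zero_le _, ?_⟩)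
  ext j
  simp [Pi.single_apply, eq_comm]

theorem tailSpan_self : tailSpan k n n = ⊥ := by
  rw [tailSpan, Submodule.span_eq_bot]
  rintro _ ⟨i, hi, -⟩
  omega

/-- Hence the second family of invariant subspaces in the seaweed algebra imposes no condition. -/
theorem partialSum_indiscrete (n j : ℕ) :
    partialSum (Nat.Partition.indiscrete n) j = 0 ∨
      partialSum (Nat.Partition.indiscrete n) j = n := by
  rcases Nat.eq_zero_or_pos n with rfl | hn
  · left
    simp [partialSum, sortedParts]
  · rw [partialSum, sortedParts, Nat.Partition.indiscrete_parts hn.ne', Multiset.sort_singleton]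
    rcases j with _ | j
    · simp
    · simp

/-- The positions at which the matrices of the seaweed algebra of `(p, {n})` may be nonzero, where
`l` is the list of the parts of `p`. -/
def Allowed (l : List ℕ) (r c : ℕ) : Prop := ∀ j, c < (l.take j).sum → r < (l.take j).sum

theorem mem_seaweed_indiscrete {p : n.Partition} {M : Matrix (Fin n) (Fin n) k} :
    M ∈ seaweed k p (Nat.Partition.indiscrete n) ↔
      ∀ r c : Fin n, ¬ Allowed (sortedParts p) r c → M r c = 0 := by
  have h1 : M ∈ seaweed k p (Nat.Partition.indiscrete n) ↔ ∀ j : ℕ,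
      ∀ v ∈ headSpan k n (partialSum p j), M.mulVec v ∈ headSpan k n (partialSum p j) := by
    refine and_iff_left fun j v hv => ?_
    rcases partialSum_indiscrete n j with h | h
    · rw [h, tailSpan_zero]; trivial
    · rw [h, tailSpan_self, Submodule.mem_bot] at hv ⊢
      rw [hv, Matrix.mulVec_zero]
  rw [h1]
  constructor
  · intro h r c hrc
    rw [Allowed] at hrc
    push Not at hrc
    obtain ⟨j, hc, hr⟩ := hrc
    have h2 := (mem_headSpan k).1 (h j (Pi.single c 1) ((mem_headSpan k).2 fun i hi =>
      Pi.single_eq_of_ne (fun h => by subst h; rw [partialSum] at hi; omega) _)) r hr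
    simpa using h2
  · intro h j v hv
    rw [mem_headSpan] at hv ⊢
    intro r hr
    rw [Matrix.mulVec, dotProduct]
    refine Finset.sum_eq_zero fun c _ => ?_
    by_cases hc : partialSum p j ≤ c
    · rw [hv c hc, mul_zero]
    · rw [h r c, zero_mul]
      intro hA
      have := hA j (by rw [partialSum] at hc; omega)
      rw [partialSum] at hr
      omega

open Classical in
/-- The number of allowed positions. -/
noncomputable def allowedCount (l : List ℕ) (n : ℕ) : ℕ :=
  ((Finset.range n ×ˢ Finset.range n).filter fun x => Allowed l x.1 x.2).card

theorem finrank_seaweed_indiscrete (p : n.Partition) :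
    Module.finrank k (seaweed k p (Nat.Partition.indiscrete n)) =
      allowedCount (sortedParts p) n := by
  classical
  let S := {x : Fin n × Fin n // Allowed (sortedParts p) x.1 x.2}
  let e : seaweed k p (Nat.Partition.indiscrete n) ≃ₗ[k] (S → k) :=
    { toFun := fun M x => M.1 x.1.1 x.1.2
      map_add' := fun _ _ => rfl
      map_smul' := fun _ _ => rfl
      invFun := fun f => ⟨Matrix.of fun r c =>
        if h : Allowed (sortedParts p) r c then f ⟨(r, c), h⟩ else 0, by
          rw [mem_seaweed_indiscrete]
          intro r c h
          simp [h]⟩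
      left_inv := fun M => by
        ext r c
        by_cases h : Allowed (sortedParts p) r c
        · simp [h]
        · simp [h, (mem_seaweed_indiscrete k).1 M.2 r c h]
      right_inv := fun f => by
        ext x
        simp [x.2] }
  rw [e.finrank_eq, Module.finrank_pi, allowedCount, Fintype.card_subtype]
  refine Finset.card_bij (fun x _ => (x.1.val, x.2.val)) ?_ ?_ ?_
  · rintro ⟨r, c⟩ h
    simpa using h
  · rintro ⟨r, c⟩ _ ⟨r', c'⟩ _ h
    simpa [Fin.ext_iff] using h
  · rintro ⟨r, c⟩ h
    simp only [Finset.mem_filter, Finset.mem_product, Finset.mem_range] at h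
    exact ⟨(⟨r, h.1.1⟩, ⟨c, h.1.2⟩), by simpa using h.2, rfl⟩

theorem allowed_cons_of_lt {a r c : ℕ} {l : List ℕ} (h : r < a) : Allowed (a :: l) r c := by
  rintro (_ | j) hj
  · simp at hj
  · rw [List.take_succ_cons, List.sum_cons]
    omega

theorem not_allowed_cons {a r c : ℕ} {l : List ℕ} (hr : a ≤ r) (hc : c < a) :
    ¬ Allowed (a :: l) r c := fun h => by
  have := h 1
  simp at this
  omega

theorem allowed_cons_add {a r c : ℕ} {l : List ℕ} :
    Allowed (a :: l) (a + r) (a + c) ↔ Allowed l r c := by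
  constructor
  · intro h j hj
    have := h (j + 1)
    rw [List.take_succ_cons, List.sum_cons] at this
    omega
  · rintro h (_ | j) hj
    · simp at hj
    · rw [List.take_succ_cons, List.sum_cons] at hj ⊢
      have := h j
      omega

/-- The first a rows are unrestricted; below them the first a columns vanish, and the remaining
block has the same shape. -/
theorem allowedCount_cons (a n : ℕ) (l : List ℕ) :
    allowedCount (a :: l) (a + n) = a * (a + n) + allowedCount l n := by
  classical
  have h : (Finset.range (a + n) ×ˢ Finset.range (a + n)).filter
      (fun x => Allowed (a :: l) x.1 x.2) = (Finset.range a ×ˢ Finset.range (a + n)) ∪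
      ((Finset.range n ×ˢ Finset.range n).filter fun x => Allowed l x.1 x.2).map
        ((addLeftEmbedding a).prodMap (addLeftEmbedding a)) := by
    ext ⟨r, c⟩
    simp only [Finset.mem_filter, Finset.mem_product, Finset.mem_range, Finset.mem_union,
      Finset.mem_map, Prod.exists, Function.Embedding.coe_prodMap, Prod.map_apply, Prod.mk.injEq,
      addLeftEmbedding_apply]
    constructor
    · rintro ⟨⟨hr, hc⟩, hA⟩
      rcases lt_or_ge r a with h | h
      · exact Or.inl ⟨h, hc⟩
      · have hca : a ≤ c := by
          by_contra! hc
          exact not_allowed_cons h hc hA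
        obtain ⟨r, rfl⟩ := Nat.exists_eq_add_of_le h
        obtain ⟨c, rfl⟩ := Nat.exists_eq_add_of_le hca
        exact Or.inr ⟨r, c, ⟨⟨by omega, by omega⟩, allowed_cons_add.1 hA⟩, rfl, rfl⟩
    · rintro (⟨hr, hc⟩ | ⟨r, c, ⟨⟨hr, hc⟩, hA⟩, rfl, rfl⟩)
      · exact ⟨⟨by omega, hc⟩, allowed_cons_of_lt hr⟩
      · exact ⟨⟨by omega, by omega⟩, allowed_cons_add.2 hA⟩
  rw [allowedCount, h, Finset.card_union_of_disjoint, Finset.card_map, Finset.card_product,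
    Finset.card_range, Finset.card_range, allowedCount]
  rw [Finset.disjoint_left]
  rintro ⟨r, c⟩ h1 h2
  simp only [Finset.mem_product, Finset.mem_range, Finset.mem_map, Prod.exists,
    Function.Embedding.coe_prodMap, Prod.map_apply, Prod.mk.injEq, addLeftEmbedding_apply] at h1 h2
  obtain ⟨r', c', -, rfl, -⟩ := h2
  omega

/-- For a odd, a(a + n) has the parity of n + 1, that is, of the new number of parts; these add up
to a triangular number. -/
theorem allowedCount_mod_two (l : List ℕ) (hl : ∀ a ∈ l, Odd a) :
    l.sum % 2 = l.length % 2 ∧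
      allowedCount l l.sum % 2 = (l.length * (l.length + 1) / 2) % 2 := by
  induction l with
  | nil => simp [allowedCount]
  | cons a l ih =>
    obtain ⟨ih1, ih2⟩ := ih fun b hb => hl b (List.mem_cons_of_mem _ hb)
    obtain ⟨u, rfl⟩ := hl a List.mem_cons_self
    rw [List.sum_cons, allowedCount_cons, List.length_cons]
    refine ⟨by omega, ?_⟩
    have h1 : (l.length + 1) * (l.length + 1 + 1) / 2 =
        l.length * (l.length + 1) / 2 + (l.length + 1) := by
      rw [show (l.length + 1) * (l.length + 1 + 1) =
        l.length * (l.length + 1) + (l.length + 1) * 2 by ring, Nat.add_mul_div_right _ _ two_pos]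
    have h2 : (2 * u + 1) * (2 * u + 1 + l.sum) =
        2 * (u * (2 * u + 1 + l.sum) + u) + (l.sum + 1) := by
      ring
    rw [h1, h2]
    omega

end Dimension

section PartitionIndex

attribute [local instance] LieRing.ofAssociativeRing

theorem partitionIndex_mod_two (k : Type*) [Field k] {n : ℕ} (p : n.Partition)
    (hp : ∀ a ∈ p.parts, Odd a) :
    partitionIndex k p % 2 =
      (Multiset.card p.parts * (Multiset.card p.parts + 1) / 2) % 2 := by
  have hfin : FiniteDimensional k (seaweed k p (Nat.Partition.indiscrete n)) :=
    FiniteDimensional.finiteDimensional_submodule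
      (seaweed k p (Nat.Partition.indiscrete n)).toSubmodule
  rw [partitionIndex, pairIndex, lieIndex_mod_two, finrank_seaweed_indiscrete]
  have h1 := (allowedCount_mod_two (sortedParts p) fun a ha =>
    hp a ((Multiset.mem_sort _).1 ha)).2
  have h2 : (sortedParts p).sum = n := by
    rw [← Multiset.sum_coe, sortedParts, Multiset.sort_eq, p.parts_sum]
  have h3 : (sortedParts p).length = Multiset.card p.parts := Multiset.length_sort _
  rwa [h2, h3] at h1

end PartitionIndex

end CollMayersMayers

namespace CollMayersMayers

open PowerSeries Filter Topology
open scoped PowerSeries.WithPiTopology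

/-! ### The coefficients as signed counts of partitions -/

/-- The contribution of `c` parts `i` to the coefficients of `G`. -/
def partWeight (i c : ℕ) : ℤ := if Odd i then ((-1) ^ (i / 2)) ^ c else 0

theorem one_add_tsum_partWeight_odd (j : ℕ) :
    (1 + ∑' c, C (partWeight (2 * j + 1) (c + 1)) * (X : PowerSeries ℤ) ^ ((2 * j + 1) * (c + 1))) =
      geomFactor j := by
  have hs := Nat.Partition.summable_genFun_term partWeight (2 * j)
  simp only [smul_eq_C_mul] at hs
  ext n
  rw [map_add, hs.map_tsum _ (WithPiTopology.continuous_coeff ℤ n), geomFactor, coeff_mk, coeff_one]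
  simp only [partWeight, if_pos (odd_two_mul_add_one j), coeff_C_mul, coeff_X_pow,
    mul_ite, mul_one, mul_zero, show (2 * j + 1) / 2 = j by omega]
  rcases Nat.eq_zero_or_pos n with rfl | hn
  · simp
  rw [if_neg hn.ne', zero_add]
  by_cases hd : 2 * j + 1 ∣ n
  · obtain ⟨m, rfl⟩ := hd
    obtain ⟨m, rfl⟩ : ∃ m', m = m' + 1 := Nat.exists_eq_succ_of_ne_zero (by rintro rfl; simp at hn)
    rw [tsum_eq_single m]
    · rw [if_pos rfl, if_pos (dvd_mul_right _ _), Nat.mul_div_cancel_left _ (by omega)]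
    · intro c hc
      rw [if_neg]
      intro h
      have := Nat.eq_of_mul_eq_mul_left (by omega) h
      omega
  · rw [if_neg hd]
    refine (tsum_congr fun c => if_neg ?_).trans tsum_zero
    rintro rfl
    exact hd (dvd_mul_right _ _)

theorem one_add_tsum_partWeight_even (j : ℕ) :
    (1 + ∑' c, C (partWeight (2 * j + 2) (c + 1)) * (X : PowerSeries ℤ) ^ ((2 * j + 2) * (c + 1))) =
      1 := by
  have h : ¬ Odd (2 * j + 2) := by
    rw [Nat.not_odd_iff_even]; exact ⟨j + 1, by ring⟩
  simp [partWeight, h]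

theorem genFun_partWeight : Nat.Partition.genFun partWeight = G := by
  have h1 := (Nat.Partition.hasProd_genFun partWeight).tendsto_prod_nat
  simp only [smul_eq_C_mul] at h1
  have h2 : ∀ J, ∏ i ∈ Finset.range (2 * J), ((1 : PowerSeries ℤ) + ∑' c,
      C (partWeight (i + 1) (c + 1)) * (X : PowerSeries ℤ) ^ ((i + 1) * (c + 1))) =
      partialGF J := by
    intro J
    induction J with
    | zero => simp [partialGF]
    | succ J ih =>
      rw [mul_add, mul_one, Finset.prod_range_succ, Finset.prod_range_succ, ih,
        one_add_tsum_partWeight_odd, one_add_tsum_partWeight_even, mul_one, partialGF, partialGF,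
        Finset.prod_range_succ]
  -- Only odd part sizes contribute a factor, so 4J sizes correspond to `partialGF (2 * J)`.
  have h3 : Tendsto (fun J : ℕ => 2 * (2 * J)) atTop atTop :=
    tendsto_atTop_mono (fun J => by rw [id]; omega) tendsto_id
  have h4 := h1.comp h3
  ext n
  have h5 := (WithPiTopology.tendsto_iff_coeff_tendsto ℤ _ _ _).1 h4 n
  simp only [nhds_discrete, tendsto_pure, Function.comp_def, h2] at h5
  obtain ⟨J, hJ1, hJ2⟩ := (h5.and (eventually_coeff_partialGF n)).exists
  rw [← hJ1, hJ2]

theorem coeff_G_eq_sum (n : ℕ) :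
    coeff n G = ∑ p ∈ Nat.Partition.odds n, (p.parts.map fun i => (-1 : ℤ) ^ (i / 2)).prod := by
  rw [← genFun_partWeight, Nat.Partition.coeff_genFun]
  symm
  rw [← Finset.sum_subset (Finset.subset_univ (Nat.Partition.odds n))]
  · refine Finset.sum_congr rfl fun p hp => ?_
    rw [Nat.Partition.odds, Nat.Partition.restricted, Finset.mem_filter] at hp
    rw [Finset.prod_multiset_map_count, Finsupp.prod, Multiset.toFinsupp_support]
    refine Finset.prod_congr rfl fun i hi => ?_
    rw [Multiset.toFinsupp_apply, partWeight,
      if_pos (Nat.not_even_iff_odd.1 (hp.2 i (Multiset.mem_toFinset.1 hi)))]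
  · intro p _ hp
    rw [Nat.Partition.odds, Nat.Partition.restricted, Finset.mem_filter] at hp
    push Not at hp
    obtain ⟨i, hi, hi2⟩ := hp (Finset.mem_univ _)
    refine Finset.prod_eq_zero (i := i) (by simpa using hi) ?_
    rw [partWeight, if_neg (Nat.not_odd_iff_even.2 hi2)]

/-- A part 2u + 1 adds u to h and contributes the sign (-1)^u. -/
theorem sum_eq_two_mul_add_card (s : Multiset ℕ) (hs : ∀ a ∈ s, Odd a) :
    ∃ h, s.sum = 2 * h + Multiset.card s ∧
      (s.map fun i => (-1 : ℤ) ^ (i / 2)).prod = (-1) ^ h := by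
  induction s using Multiset.induction_on with
  | empty => exact ⟨0, by simp⟩
  | cons a s ih =>
    obtain ⟨h, h1, h2⟩ := ih fun b hb => hs b (Multiset.mem_cons_of_mem hb)
    obtain ⟨u, rfl⟩ := hs a (Multiset.mem_cons_self _ _)
    refine ⟨h + u, ?_, ?_⟩
    · rw [Multiset.sum_cons, Multiset.card_cons, h1]; ring
    · rw [Multiset.map_cons, Multiset.prod_cons, h2, show (2 * u + 1) / 2 = u by omega, pow_add,
        mul_comm]

/-- Both sides are (-1)^⌈m/2⌉. The factor involving 2h + m depends on n alone and can leave the sum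
over partitions. -/
theorem neg_one_pow_triangle (m h : ℕ) :
    (-1 : ℤ) ^ (m * (m + 1) / 2) = (-1) ^ ((2 * h + m + 1) / 2) * (-1) ^ h := by
  rw [← pow_add]
  refine neg_one_pow_congr ?_
  rw [Nat.even_iff, Nat.even_iff]
  obtain ⟨u, rfl | rfl⟩ := Nat.even_or_odd' m
  · rw [show 2 * u * (2 * u + 1) = 2 * (u * (2 * u + 1)) by ring, Nat.mul_div_cancel_left _ two_pos,
      show u * (2 * u + 1) = 2 * (u * u) + u by ring]
    omega
  · rw [show (2 * u + 1) * (2 * u + 1 + 1) = 2 * ((2 * u + 1) * (u + 1)) by ring,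
      Nat.mul_div_cancel_left _ two_pos,
      show (2 * u + 1) * (u + 1) = 2 * (u * (u + 1)) + u + 1 by ring]
    omega

theorem evenCount_sub_oddCount (k : Type*) [Field k] (n : ℕ) :
    (evenCount k n : ℤ) - oddCount k n = (-1) ^ ((n + 1) / 2) * coeff n G := by
  have h1 : (evenCount k n : ℤ) - oddCount k n =
      ∑ p ∈ Nat.Partition.odds n, (-1 : ℤ) ^ partitionIndex k p := by
    rw [evenCount, oddCount, Finset.card_filter, Finset.card_filter, Nat.cast_sum, Nat.cast_sum,
      ← Finset.sum_sub_distrib]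
    refine Finset.sum_congr rfl fun p _ => ?_
    rcases Nat.even_or_odd (partitionIndex k p) with h | h
    · simp [h, h.neg_one_pow, Nat.not_odd_iff_even.2 h]
    · simp [h, h.neg_one_pow, Nat.not_even_iff_odd.2 h]
  rw [h1, coeff_G_eq_sum, Finset.mul_sum]
  refine Finset.sum_congr rfl fun p hp => ?_
  rw [Nat.Partition.odds, Nat.Partition.restricted, Finset.mem_filter] at hp
  have hodd : ∀ a ∈ p.parts, Odd a := fun a ha => Nat.not_even_iff_odd.1 (hp.2 a ha)
  obtain ⟨h, h2, h3⟩ := sum_eq_two_mul_add_card p.parts hodd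
  rw [p.parts_sum] at h2
  have h4 := partitionIndex_mod_two k p hodd
  have h5 : (-1 : ℤ) ^ partitionIndex k p =
      (-1) ^ (Multiset.card p.parts * (Multiset.card p.parts + 1) / 2) :=
    neg_one_pow_congr (by rw [Nat.even_iff, Nat.even_iff, h4])
  rw [h3, h5, neg_one_pow_triangle _ h, ← h2]

end CollMayersMayers

theorem theorem1p1 (k : Type*) [Field k] :
    (∀ n : ℕ, 0 ≤ PowerSeries.coeff n CollMayersMayers.G) ∧
    CollMayersMayers.G = PowerSeries.mk fun n : ℕ =>
      |(CollMayersMayers.evenCount k n : ℤ) - (CollMayersMayers.oddCount k n : ℤ)| := by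
  refine ⟨CollMayersMayers.coeff_G_nonneg, PowerSeries.ext fun n => ?_⟩
  rw [PowerSeries.coeff_mk, CollMayersMayers.evenCount_sub_oddCount, abs_mul, abs_pow, abs_neg,
    abs_one, one_pow, one_mul, abs_of_nonneg (CollMayersMayers.coeff_G_nonneg n)]
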